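/- Let $M$ be a connected (Hausdorff, second countable) $C^\infty$ manifold and let $X_1,\dots,X_m$ be $C^\infty$ vector fields on $M$ which, taken along with their commutator brackets of all orders, span the tangent space at every point. Let $a(x)=\sum_{\ell=1}^m X_\ell(x)\otimes X_\ell(x)$, a symmetric bilinear form on $T_x^*M$. For $x,y\in M$ set $$d(x,y)=\inf_\gamma \sqrt{I(\gamma)},$$ the infimum being over continuous paths $\gamma:[0,1]\to M$ with $\gamma_0=x$ and $\gamma_1=y$. Here, for $\gamma$ absolutely continuous, $I(\gamma)=\inf_\xi\int_0^1\langle\xi_t,a(\gamma_t)\xi_t\rangle\,dt$, where the infimum is over measurable paths $\xi:[0,1]\to T^*M$ with $\xi_t\in T^*_{\gamma_t}M$ for all $t$ and $\dot\gamma_t=a(\gamma_t)\xi_t$ for almost all $t$; and $I(\gamma)=\infty$ if $\gamma$ is not absolutely continuous or there is no such $\xi$. For $A\subseteq M$ set $$d(x,A)=\inf_{z\in A}d(x,z),\qquad d(x,A,y)=\inf_{z\in A}\{d(x,z)+d(z,y)\},$$ with $\inf\emptyset=\infty$. Let $\mathcal F$ be the set of all functions $w:M\to\mathbb R$ which are locally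 Lipschitz (in charts) and satisfy $a(\nabla w,\nabla w)\le 1$ almost everywhere with respect to Lebesgue measure in charts. Then, without any completeness assumption, for all $x,y\in M$ and every closed set $A\subseteq M$, $$d(x,A,y)=\sup\{w^+(y)-w^-(x):\ w^-,w^+\in\mathcal F,\ w^+=w^-\text{ on }A\}$$ and $$d(x,A)=\sup\{w(x):\ w\in\mathcal F,\ w=0\text{ on }A\},$$ where the suprema are taken in $[-\infty,\infty]$. -/

import Mathlib

open scoped Manifold ContDiff ENNReal Bundle

noncomputable section

namespace SubRiemannian

/-- The iterated commutator brackets, of all orders, of the vector fields `X 0, …, X (m - 1)`: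
the smallest family of vector fields containing the `X ℓ` and closed under the Lie bracket. -/
inductive IsIteratedBracket {d m : ℕ} {M : Type*} [TopologicalSpace M]
    [ChartedSpace (EuclideanSpace ℝ (Fin d)) M]
    (X : Fin m → (x : M) → TangentSpace (𝓡 d) x) : ((x : M) → TangentSpace (𝓡 d) x) → Prop
  | base (ℓ : Fin m) : IsIteratedBracket X (X ℓ)
  | bracket (V W : (x : M) → TangentSpace (𝓡 d) x) :
      IsIteratedBracket X V → IsIteratedBracket X W →
        IsIteratedBracket X (VectorField.mlieBracket (𝓡 d) V W)

/-- `X` is a smooth sub-Riemannian structure: the `X ℓ` are smooth vector fields which, taken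
along with their commutator brackets of all orders, span the tangent space at every point. -/
structure IsSubRiemannianStructure {d m : ℕ} {M : Type*} [TopologicalSpace M]
    [ChartedSpace (EuclideanSpace ℝ (Fin d)) M] [IsManifold (𝓡 d) ∞ M]
    (X : Fin m → (x : M) → TangentSpace (𝓡 d) x) : Prop where
  smooth : ∀ ℓ : Fin m,
    ContMDiff (𝓡 d) (𝓡 d).tangent ∞ (fun x : M => (⟨x, X ℓ x⟩ : TangentBundle (𝓡 d) M))
  span_eq_top : ∀ x : M,
    Submodule.span ℝ {v : TangentSpace (𝓡 d) x | ∃ V, IsIteratedBracket X V ∧ V x = v} = ⊤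

/-- The symmetric bilinear form `a(x) = ∑ ℓ, X ℓ x ⊗ X ℓ x` on the cotangent space at `x`. -/
def cometric {d m : ℕ} {M : Type*} [TopologicalSpace M]
    [ChartedSpace (EuclideanSpace ℝ (Fin d)) M]
    (X : Fin m → (x : M) → TangentSpace (𝓡 d) x) (x : M)
    (ξ η : TangentSpace (𝓡 d) x →L[ℝ] ℝ) : ℝ :=
  ∑ ℓ, ξ (X ℓ x) * η (X ℓ x)

/-- The tangent vector `a(x) ξ`, characterised by `η (a(x) ξ) = a(x)(η, ξ)` for all `η`. -/
def sharp {d m : ℕ} {M : Type*} [TopologicalSpace M]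
    [ChartedSpace (EuclideanSpace ℝ (Fin d)) M]
    (X : Fin m → (x : M) → TangentSpace (𝓡 d) x) (x : M)
    (ξ : TangentSpace (𝓡 d) x →L[ℝ] ℝ) : TangentSpace (𝓡 d) x :=
  ∑ ℓ, ξ (X ℓ x) • X ℓ x

/-- A continuous path `γ : [0,1] → M` is absolutely continuous if its expression in every chart
is absolutely continuous on every compact time interval which `γ` maps into the chart domain. -/
def IsAbsolutelyContinuous (d : ℕ) {M : Type*} [TopologicalSpace M]
    [ChartedSpace (EuclideanSpace ℝ (Fin d)) M] {x y : M} (γ : Path x y) : Prop :=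
  ∀ e ∈ atlas (EuclideanSpace ℝ (Fin d)) M, ∀ s t : ℝ, 0 ≤ s → s ≤ t → t ≤ 1 →
    (∀ r ∈ Set.Icc s t, γ.extend r ∈ e.source) →
      AbsolutelyContinuousOnInterval (fun r => e (γ.extend r)) s t

/-- `ξ` is a measurable path in `T*M` over `γ` such that `γ'(t) = a(γ(t)) ξ(t)` for almost all
`t ∈ [0,1]`. (Outside `[0,1]` the path `γ` is extended by constants; this plays no role.) -/
structure IsDriving {d m : ℕ} {M : Type*} [TopologicalSpace M]
    [ChartedSpace (EuclideanSpace ℝ (Fin d)) M] [IsManifold (𝓡 d) ∞ M]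
    (X : Fin m → (x : M) → TangentSpace (𝓡 d) x) {x y : M} (γ : Path x y)
    (ξ : (t : ℝ) → TangentSpace (𝓡 d) (γ.extend t) →L[ℝ] ℝ) : Prop where
  measurable :
    @Measurable ℝ
      (Bundle.TotalSpace (EuclideanSpace ℝ (Fin d) →L[ℝ] ℝ)
        (fun z : M => TangentSpace (𝓡 d) z →L[ℝ] ℝ)) _ (borel _)
      (fun t => ⟨γ.extend t, ξ t⟩)
  velocity : ∀ᵐ t ∂(MeasureTheory.volume.restrict (Set.Icc (0 : ℝ) 1)),
    HasMFDerivAt 𝓘(ℝ, ℝ) (𝓡 d) γ.extend t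
      ((1 : ℝ →L[ℝ] ℝ).smulRight (sharp X (γ.extend t) (ξ t)))

/-- The energy `I(γ)`: the infimum of `∫₀¹ ⟨ξ(t), a(γ(t)) ξ(t)⟩ dt` over the paths `ξ` driving
`γ`; it is `∞` if `γ` is not absolutely continuous or there is no such `ξ`. -/
def energy {d m : ℕ} {M : Type*} [TopologicalSpace M]
    [ChartedSpace (EuclideanSpace ℝ (Fin d)) M] [IsManifold (𝓡 d) ∞ M]
    (X : Fin m → (x : M) → TangentSpace (𝓡 d) x) {x y : M} (γ : Path x y) : ℝ≥0∞ :=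
  ⨅ (_ : IsAbsolutelyContinuous d γ)
    (ξ : (t : ℝ) → TangentSpace (𝓡 d) (γ.extend t) →L[ℝ] ℝ) (_ : IsDriving X γ ξ),
    ∫⁻ t in Set.Icc (0 : ℝ) 1, ENNReal.ofReal (cometric X (γ.extend t) (ξ t) (ξ t))

/-- The sub-Riemannian distance `d(x,y)`: the infimum of `√I(γ)` over continuous paths `γ` from
`x` to `y`. -/
def subDist {d m : ℕ} {M : Type*} [TopologicalSpace M]
    [ChartedSpace (EuclideanSpace ℝ (Fin d)) M] [IsManifold (𝓡 d) ∞ M]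
    (X : Fin m → (x : M) → TangentSpace (𝓡 d) x) (x y : M) : ℝ≥0∞ :=
  ⨅ γ : Path x y, energy X γ ^ (1 / 2 : ℝ)

/-- The distance `d(x,A)` to a set `A`, equal to `∞` if `A` is empty. -/
def distTo {d m : ℕ} {M : Type*} [TopologicalSpace M]
    [ChartedSpace (EuclideanSpace ℝ (Fin d)) M] [IsManifold (𝓡 d) ∞ M]
    (X : Fin m → (x : M) → TangentSpace (𝓡 d) x) (x : M) (A : Set M) : ℝ≥0∞ :=
  ⨅ z ∈ A, subDist X x z

/-- The distance `d(x,A,y)` from `x` to `y` through `A`, equal to `∞` if `A` is empty. -/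
def distThrough {d m : ℕ} {M : Type*} [TopologicalSpace M]
    [ChartedSpace (EuclideanSpace ℝ (Fin d)) M] [IsManifold (𝓡 d) ∞ M]
    (X : Fin m → (x : M) → TangentSpace (𝓡 d) x) (x : M) (A : Set M) (y : M) : ℝ≥0∞ :=
  ⨅ z ∈ A, (subDist X x z + subDist X z y)

/-- `w` is locally Lipschitz on the manifold `M`, that is, locally Lipschitz in every chart. -/
def IsLocallyLipschitz (d : ℕ) {M : Type*} [TopologicalSpace M]
    [ChartedSpace (EuclideanSpace ℝ (Fin d)) M] (w : M → ℝ) : Prop :=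
  ∀ e ∈ atlas (EuclideanSpace ℝ (Fin d)) M, LocallyLipschitzOn e.target (fun u => w (e.symm u))

/-- `P` holds at almost every point of the manifold `M`: the exceptional set is Lebesgue null in
every chart, that is, null for any measure with a positive smooth density. -/
def HoldsAE (d : ℕ) {M : Type*} [TopologicalSpace M]
    [ChartedSpace (EuclideanSpace ℝ (Fin d)) M] (P : M → Prop) : Prop :=
  ∀ e ∈ atlas (EuclideanSpace ℝ (Fin d)) M,
    ∀ᵐ u ∂(MeasureTheory.volume.restrict e.target), P (e.symm u)

/-- The class `𝓕` of locally Lipschitz functions `w` with `a(∇w,∇w) ≤ 1` almost everywhere.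
A locally Lipschitz function is differentiable almost everywhere, and `∇w` is its differential. -/
def subunitFunctions {d m : ℕ} {M : Type*} [TopologicalSpace M]
    [ChartedSpace (EuclideanSpace ℝ (Fin d)) M]
    (X : Fin m → (x : M) → TangentSpace (𝓡 d) x) : Set (M → ℝ) :=
  {w | IsLocallyLipschitz d w ∧
    HoldsAE d (fun z : M =>
      cometric X z (mvfderiv (𝓡 d) w z) (mvfderiv (𝓡 d) w z) ≤ 1)}

end SubRiemannian

end

/-!
Both identities express a duality between curves and functions, and both follow from two facts.

*Functions in `𝓕` are `1`-Lipschitz for the sub-Riemannian distance*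
(`enorm_sub_le_subDist`). Let `γ` be driven by `ξ`. The coefficients `c ℓ = ξ (X ℓ)` satisfy
`γ' = ∑ ℓ, c ℓ • X ℓ` and `‖c‖² = a(ξ, ξ)`, so if `dw` exists along `γ` with `a(dw, dw) ≤ 1`, then
`|w(γ 1) - w(γ 0)| ≤ ∫ ‖c‖ ≤ √I(γ)`. The bound on `dw` is only known almost everywhere, and `γ` may
run inside the exceptional null set; but by Fubini's theorem almost every small translate of `γ` in
a chart meets that set at almost no time, and translating costs little because the `X ℓ` are
Lipschitz in the chart (`enorm_sub_le_lintegral_of_ae_fderiv`). For `w⁺ = w⁻` at `z ∈ A`, the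
decomposition `w⁺ y - w⁻ x = (w⁺ y - w⁺ z) + (w⁻ z - w⁻ x)` bounds the suprema from above.

*Every function which is `1`-Lipschitz for the Carnot–Carathéodory distance is a uniform limit of
functions which are almost in `𝓕`* (`exists_regularization`). Here `ccDist` is the infimum of the
`L` such that `y` can be reached from `x` in unit time with controls of norm at most `L`. These
curves have energy at most `L²`: a measurable covector field inducing the control is found by
Tikhonov regularization (`exists_measurable_frameOperator_eq`). Hence `subDist ≤ ccDist`, while
`ccDist` is finite and continuous by Chow's theorem. The latter is proved by Krener's argument: flows
along the `X ℓ` yield immersed families of reachable points, of growing dimension as long as some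
`X ℓ` is not tangent to them; and the brackets would be tangent too if all `X ℓ` were. Once
the families are submersive, all points near the starting point reach one common point, and this
with arbitrarily small controls, since the flows may be followed for short times only
(`eventually_reach`).

The regularization of `w` is local, so that no completeness is needed. In a chart, the
inf-convolution `z ↦ inf_y (w y + |z - y|² / ε)` is Lipschitz. Its derivative at `z` along
`∑ ℓ, c ℓ • X ℓ` is compared with that of `w` at the minimizer `y`, by moving `z` and `y`
simultaneously along this field; the error is at most a multiple of `‖c‖ |z - y|² / ε`, which tends
to `0` since `w` is continuous. These local regularizations are glued by a partition of unity.
The resulting bound is on upper Dini derivatives along curves, a condition stable under maxima, and at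
points of differentiability it gives `a(dw, dw) ≤ 1` (`mem_subunitFunctions`).

The second fact is applied to `w⁻ = d(x, ·)` and `w⁺ = inf_{a ∈ A} (d(x, a) + d(a, ·))`, with `d`
the Carnot–Carathéodory distance. The regularizations of `w⁻` and `w⁺` only agree approximately on
`A`; replacing that of `w⁺` by its maximum, after lowering it slightly, with that of `w⁻` makes them
agree exactly. For `d(x, A)`, likewise, the regularization of `inf_{a ∈ A} d(a, ·)` is lowered and
cut off at `0`.
-/

noncomputable section

open Set Filter Topology MeasureTheory

namespace SubRiemannian

/-! ### Vector fields and curves in charts -/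

section Charts

theorem two_le_infty : (2 : WithTop ℕ∞) ≤ (∞ : ℕ∞ω) := by
  exact ENat.LEInfty.out

theorem mlieBracket_eq_lieBracket {E : Type*} [NormedAddCommGroup E] [NormedSpace ℝ E]
    (V W : E → E) (u : E) :
    VectorField.mlieBracket 𝓘(ℝ, E) V W u = VectorField.lieBracket ℝ V W u := by
  have h := congrFun (VectorField.mlieBracketWithin_eq_lieBracketWithin (𝕜 := ℝ) (E := E)
    (V := V) (W := W) (s := univ)) u
  exact h.trans (congrFun VectorField.lieBracketWithin_univ u)

variable {d : ℕ} {M : Type*} [TopologicalSpace M] [ChartedSpace (EuclideanSpace ℝ (Fin d)) M]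

/-- The curve `γ` in `M` has velocity `v` at time `t`. -/
abbrev HasVelocity (γ : ℝ → M) (t : ℝ) (v : TangentSpace (𝓡 d) (γ t)) : Prop :=
  HasMFDerivAt 𝓘(ℝ, ℝ) (𝓡 d) γ t ((1 : ℝ →L[ℝ] ℝ).smulRight v)

/-- The differential of the chart `e` at `z`, as a map to the model space. -/
def chartDeriv (e : OpenPartialHomeomorph M (EuclideanSpace ℝ (Fin d))) (z : M) :
    TangentSpace (𝓡 d) z →L[ℝ] EuclideanSpace ℝ (Fin d) :=
  mfderiv (𝓡 d) (𝓡 d) e z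

/-- The expression of the vector field `V` in the chart `e`, a vector field on `e.target`. -/
def coordField (e : OpenPartialHomeomorph M (EuclideanSpace ℝ (Fin d)))
    (V : (x : M) → TangentSpace (𝓡 d) x) (u : EuclideanSpace ℝ (Fin d)) :
    EuclideanSpace ℝ (Fin d) :=
  chartDeriv e (e.symm u) (V (e.symm u))

theorem coordField_apply {e : OpenPartialHomeomorph M (EuclideanSpace ℝ (Fin d))}
    {V : (x : M) → TangentSpace (𝓡 d) x} {z : M} (hz : z ∈ e.source) :
    coordField e V (e z) = chartDeriv e z (V z) := by
  unfold coordField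
  rw [e.left_inv hz]

theorem HasVelocity.comp {γ : ℝ → M} {φ : ℝ → ℝ} {t a : ℝ} {v : TangentSpace (𝓡 d) (γ (φ t))}
    (h : HasVelocity γ (φ t) v) (hφ : HasDerivAt φ a t) :
    HasVelocity (γ ∘ φ) t (a • v) := by
  have h1 := HasMFDerivAt.comp t h hφ.hasFDerivAt.hasMFDerivAt
  refine h1.congr_mfderiv ?_
  ext1
  change ((1 : ℝ) • a) • v = (1 : ℝ) • a • v
  rw [one_smul, one_smul]

variable [IsManifold (𝓡 d) ∞ M] {e : OpenPartialHomeomorph M (EuclideanSpace ℝ (Fin d))}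

theorem mdifferentiable_of_mem_atlas_infty (he : e ∈ atlas (EuclideanSpace ℝ (Fin d)) M) :
    e.MDifferentiable (𝓡 d) (𝓡 d) := by
  have : IsManifold (𝓡 d) 1 M := IsManifold.of_le (n := ∞) (by simp)
  exact mdifferentiable_of_mem_atlas he

theorem contMDiffAt_symm_of_mem_atlas (he : e ∈ atlas (EuclideanSpace ℝ (Fin d)) M)
    {u : EuclideanSpace ℝ (Fin d)} (hu : u ∈ e.target) :
    ContMDiffAt (𝓡 d) (𝓡 d) ∞ e.symm u :=
  contMDiffAt_symm_of_mem_maximalAtlas (IsManifold.subset_maximalAtlas he) hu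

theorem contMDiffAt_of_mem_atlas (he : e ∈ atlas (EuclideanSpace ℝ (Fin d)) M)
    {z : M} (hz : z ∈ e.source) :
    ContMDiffAt (𝓡 d) (𝓡 d) ∞ e z :=
  contMDiffAt_of_mem_maximalAtlas (IsManifold.subset_maximalAtlas he) hz

theorem isInvertible_mfderiv_symm (he : e ∈ atlas (EuclideanSpace ℝ (Fin d)) M)
    {u : EuclideanSpace ℝ (Fin d)} (hu : u ∈ e.target) :
    (mfderiv (𝓡 d) (𝓡 d) e.symm u).IsInvertible := by
  have h := mdifferentiable_of_mem_atlas_infty he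
  exact ⟨h.symm.mfderiv hu, rfl⟩

theorem mpullback_symm_eq_coordField (he : e ∈ atlas (EuclideanSpace ℝ (Fin d)) M)
    (V : (x : M) → TangentSpace (𝓡 d) x) {u : EuclideanSpace ℝ (Fin d)} (hu : u ∈ e.target) :
    VectorField.mpullback (𝓡 d) (𝓡 d) e.symm V u = coordField e V u := by
  have h := mdifferentiable_of_mem_atlas_infty he
  have hinv : (mfderiv (𝓡 d) (𝓡 d) e.symm u).inverse = mfderiv (𝓡 d) (𝓡 d) e (e.symm u) := by
    have : mfderiv (𝓡 d) (𝓡 d) e.symm u = (h.symm.mfderiv hu : _ →L[ℝ] _) := rfl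
    rw [this, ContinuousLinearMap.inverse_equiv]
    rfl
  rw [VectorField.mpullback_apply, hinv]
  rfl

/-- The chart expression of a smooth vector field is smooth. -/
theorem contDiffOn_coordField (he : e ∈ atlas (EuclideanSpace ℝ (Fin d)) M)
    {V : (x : M) → TangentSpace (𝓡 d) x}
    (hV : ContMDiff (𝓡 d) (𝓡 d).tangent ∞ (fun x : M => (⟨x, V x⟩ : TangentBundle (𝓡 d) M))) :
    ContDiffOn ℝ ∞ (coordField e V) e.target := by
  intro u hu
  have h1 : ContMDiffAt (𝓡 d) (𝓡 d).tangent ∞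
      (fun x => (⟨x, VectorField.mpullback (𝓡 d) (𝓡 d) e.symm V x⟩ :
        TangentBundle (𝓡 d) (EuclideanSpace ℝ (Fin d)))) u :=
    ContMDiffAt.mpullback_vectorField_preimage (n := ∞) (hV _) (contMDiffAt_symm_of_mem_atlas he hu)
      (isInvertible_mfderiv_symm he hu) (by simp)
  have h2 := contMDiffAt_vectorSpace_iff_contDiffAt.1 h1
  refine (h2.congr_of_eventuallyEq ?_).contDiffWithinAt
  filter_upwards [e.open_target.mem_nhds hu] with y hy
  exact (mpullback_symm_eq_coordField he V hy).symm

/-- The Lie bracket is computed in charts. -/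
theorem coordField_mlieBracket (he : e ∈ atlas (EuclideanSpace ℝ (Fin d)) M)
    {V W : (x : M) → TangentSpace (𝓡 d) x}
    (hV : ContMDiff (𝓡 d) (𝓡 d).tangent ∞ (fun x : M => (⟨x, V x⟩ : TangentBundle (𝓡 d) M)))
    (hW : ContMDiff (𝓡 d) (𝓡 d).tangent ∞ (fun x : M => (⟨x, W x⟩ : TangentBundle (𝓡 d) M)))
    {u : EuclideanSpace ℝ (Fin d)} (hu : u ∈ e.target) :
    coordField e (VectorField.mlieBracket (𝓡 d) V W) u =
      VectorField.lieBracket ℝ (coordField e V) (coordField e W) u := by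
  rw [← mpullback_symm_eq_coordField he _ hu]
  have : IsManifold (𝓡 d) (minSmoothness ℝ 2) M := IsManifold.of_le (n := ∞) (by simpa using two_le_infty)
  have h := VectorField.mpullback_mlieBracket (I := 𝓡 d) (I' := 𝓡 d) (n := ∞)
    (f := e.symm) (x₀ := u) (V := V) (W := W)
    ((hV _).mdifferentiableAt (by simp)) ((hW _).mdifferentiableAt (by simp))
    (contMDiffAt_symm_of_mem_atlas he hu) (by simpa using two_le_infty)
  have key : ∀ A B : EuclideanSpace ℝ (Fin d) → EuclideanSpace ℝ (Fin d),
      A =ᶠ[𝓝 u] coordField e V → B =ᶠ[𝓝 u] coordField e W →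
      VectorField.mlieBracket (𝓡 d) A B u =
        VectorField.lieBracket ℝ (coordField e V) (coordField e W) u := fun A B hA hB => by
    rw [mlieBracket_eq_lieBracket, hA.lieBracket_vectorField_eq hB]
  rw [h]
  refine key _ _ ?_ ?_
  · filter_upwards [e.open_target.mem_nhds hu] with y hy
      using mpullback_symm_eq_coordField he V hy
  · filter_upwards [e.open_target.mem_nhds hu] with y hy
      using mpullback_symm_eq_coordField he W hy

theorem HasVelocity.hasDerivAt_chart (he : e ∈ atlas (EuclideanSpace ℝ (Fin d)) M)
    {γ : ℝ → M} {t : ℝ} {v : TangentSpace (𝓡 d) (γ t)} (h : HasVelocity γ t v)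
    (ht : γ t ∈ e.source) :
    HasDerivAt (fun r => e (γ r))
      (chartDeriv e (γ t) v) t := by
  have h1 := ((mdifferentiable_of_mem_atlas_infty he).mdifferentiableAt ht).hasMFDerivAt.comp t h
  have h2 : HasFDerivAt (fun r => e (γ r)) ((1 : ℝ →L[ℝ] ℝ).smulRight (chartDeriv e (γ t) v)) t := by
    refine h1.hasFDerivAt.congr_fderiv ?_
    ext1
    change chartDeriv e (γ t) ((1 : ℝ) • v) = (1 : ℝ) • chartDeriv e (γ t) v
    rw [map_smul]
  simpa using h2.hasDerivAt

theorem hasVelocity_symm_comp (he : e ∈ atlas (EuclideanSpace ℝ (Fin d)) M)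
    {f : ℝ → EuclideanSpace ℝ (Fin d)} {t : ℝ} {v : EuclideanSpace ℝ (Fin d)}
    (h : HasDerivAt f v t) (ht : f t ∈ e.target) :
    HasVelocity (fun r => e.symm (f r)) t (mfderiv (𝓡 d) (𝓡 d) e.symm (f t) v) := by
  have h1 := ((mdifferentiable_of_mem_atlas_infty he).mdifferentiableAt_symm ht).hasMFDerivAt.comp t
    h.hasFDerivAt.hasMFDerivAt
  refine h1.congr_mfderiv ?_
  ext1
  change mfderiv (𝓡 d) (𝓡 d) e.symm (f t) ((1 : ℝ) • v) =
    (1 : ℝ) • mfderiv (𝓡 d) (𝓡 d) e.symm (f t) v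
  rw [one_smul, one_smul]

theorem mfderiv_symm_coordField (he : e ∈ atlas (EuclideanSpace ℝ (Fin d)) M)
    (V : (x : M) → TangentSpace (𝓡 d) x) {u : EuclideanSpace ℝ (Fin d)} (hu : u ∈ e.target) :
    mfderiv (𝓡 d) (𝓡 d) e.symm u (coordField e V u) = V (e.symm u) := by
  have h := (mdifferentiable_of_mem_atlas_infty he).symm.comp_symm_deriv (x := e.symm u)
    (e.map_target hu)
  have h' := congrArg (fun L => L (V (e.symm u))) h
  change mfderiv (𝓡 d) (𝓡 d) e.symm (e (e.symm u)) (coordField e V u) = V (e.symm u) at h'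
  rwa [e.right_inv hu] at h'

/-- The derivative of a function on `M` in a chart. -/
theorem mvfderiv_eq_fderiv_chart (he : e ∈ atlas (EuclideanSpace ℝ (Fin d)) M) {w : M → ℝ}
    {u : EuclideanSpace ℝ (Fin d)} (hu : u ∈ e.target)
    (hw : DifferentiableAt ℝ (fun u => w (e.symm u)) u) (V : (x : M) → TangentSpace (𝓡 d) x) :
    mvfderiv (𝓡 d) w (e.symm u) (V (e.symm u)) =
      fderiv ℝ (fun u => w (e.symm u)) u (coordField e V u) := by
  have h := mdifferentiable_of_mem_atlas_infty he
  have hz := e.map_target hu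
  have h1 : HasMFDerivAt (𝓡 d) 𝓘(ℝ, ℝ) (fun u => w (e.symm u)) (e (e.symm u))
      (fderiv ℝ (fun u => w (e.symm u)) u) := by
    rw [e.right_inv hu]
    exact hw.hasFDerivAt.hasMFDerivAt
  have h2 := h1.comp (e.symm u) (h.mdifferentiableAt hz).hasMFDerivAt
  have h3 := h2.congr_of_eventuallyEq (f₁ := w) (by
    filter_upwards [e.open_source.mem_nhds hz] with y hy
    simp [e.left_inv hy])
  simp only [mvfderiv, h3.mfderiv]
  rfl

end Charts

/-! ### Horizontal curves -/

section Reach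

variable {d m : ℕ} {M : Type*} [TopologicalSpace M] [ChartedSpace (EuclideanSpace ℝ (Fin d)) M]

/-- The vector field `∑ ℓ, c ℓ • X ℓ`. -/
def horizontalField (X : Fin m → (x : M) → TangentSpace (𝓡 d) x) (c : EuclideanSpace ℝ (Fin m))
    (x : M) : TangentSpace (𝓡 d) x :=
  ∑ ℓ, c ℓ • X ℓ x

theorem horizontalField_smul (X : Fin m → (x : M) → TangentSpace (𝓡 d) x) (a : ℝ)
    (c : EuclideanSpace ℝ (Fin m)) (x : M) :
    horizontalField X (a • c) x = a • horizontalField X c x := by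
  simp [horizontalField, mul_smul, Finset.smul_sum]

theorem coordField_horizontalField (X : Fin m → (x : M) → TangentSpace (𝓡 d) x)
    (c : EuclideanSpace ℝ (Fin m)) (e : OpenPartialHomeomorph M (EuclideanSpace ℝ (Fin d)))
    (u : EuclideanSpace ℝ (Fin d)) :
    coordField e (horizontalField X c) u = ∑ ℓ, c ℓ • coordField e (X ℓ) u := by
  simp [coordField, horizontalField]

/-- Equal base points have equal tangent vectors; the tangent spaces are identified with the model
space, which is harmless as the base points agree. -/
theorem field_eq_of_eq (V : (x : M) → TangentSpace (𝓡 d) x) {a b : M} (h : a = b) :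
    @Eq (EuclideanSpace ℝ (Fin d)) (V a) (V b) := by
  subst h; rfl

/-- `g` restricted to `[0,1]` is a horizontal curve, Lipschitz in charts, driven by the measurable
control `u`, whose norm is at most `L`. -/
structure IsHorizontal (X : Fin m → (x : M) → TangentSpace (𝓡 d) x) (L : ℝ) (g : ℝ → M)
    (u : ℝ → EuclideanSpace ℝ (Fin m)) : Prop where
  continuousOn : ContinuousOn g (Icc 0 1)
  measurable : Measurable u
  norm_le : ∀ t, ‖u t‖ ≤ L
  velocity : ∀ᵐ t : ℝ, t ∈ Ioo (0 : ℝ) 1 → HasVelocity g t (horizontalField X (u t) (g t))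
  lipschitz : ∀ e ∈ atlas (EuclideanSpace ℝ (Fin d)) M, ∀ s t : ℝ, 0 ≤ s → s ≤ t → t ≤ 1 →
    (∀ r ∈ Icc s t, g r ∈ e.source) → ∃ K, LipschitzOnWith K (fun r => e (g r)) (Icc s t)

/-- `y` can be reached from `x` in unit time by a horizontal curve with controls of norm at
most `L`; equivalently, along a curve of length at most `L`. -/
def Reach (X : Fin m → (x : M) → TangentSpace (𝓡 d) x) (L : ℝ) (x y : M) : Prop :=
  ∃ (g : ℝ → M) (u : ℝ → EuclideanSpace ℝ (Fin m)), IsHorizontal X L g u ∧ g 0 = x ∧ g 1 = y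

variable {X : Fin m → (x : M) → TangentSpace (𝓡 d) x}

theorem Reach.nonneg {L : ℝ} {x y : M} (h : Reach X L x y) : 0 ≤ L := by
  obtain ⟨g, u, hg, -⟩ := h
  exact (norm_nonneg _).trans (hg.norm_le 0)

theorem Reach.mono {L L' : ℝ} {x y : M} (h : Reach X L x y) (hL : L ≤ L') : Reach X L' x y := by
  obtain ⟨g, u, hg, h0, h1⟩ := h
  exact ⟨g, u, ⟨hg.1, hg.2, fun t => (hg.3 t).trans hL, hg.4, hg.5⟩, h0, h1⟩

theorem reach_refl {L : ℝ} (hL : 0 ≤ L) (x : M) : Reach X L x x := by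
  refine ⟨fun _ => x, fun _ => 0, ⟨continuousOn_const, measurable_const, by simpa using hL, ?_, ?_⟩,
    rfl, rfl⟩
  · refine Eventually.of_forall fun t _ => ?_
    refine (hasMFDerivAt_const x t).congr_mfderiv ?_
    ext1
    simp [horizontalField]
    rfl
  · intro e _ s t _ _ _ _
    exact ⟨0, (LipschitzWith.const (e x)).lipschitzOnWith⟩

theorem ae_comp_affine {P : ℝ → Prop} (h : ∀ᵐ t : ℝ, P t) {a : ℝ} (ha : a ≠ 0) (b : ℝ) :
    ∀ᵐ t : ℝ, P (a * t + b) := by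
  have h1 : ∀ᵐ t : ℝ, P (t + b) := by
    rw [ae_iff] at h ⊢
    exact (measure_preimage_add_right volume b {t | ¬ P t}).trans h
  rw [ae_iff] at h1 ⊢
  have := Real.volume_preimage_mul_left ha {t | ¬ P (t + b)}
  rw [h1, mul_zero] at this
  exact this

theorem lipschitzOnWith_comp_affine {E : Type*} [PseudoMetricSpace E] {f : ℝ → E} {K : NNReal}
    {s t a b : ℝ} (ha : 0 ≤ a) (h : LipschitzOnWith K f (Icc (a * s + b) (a * t + b))) :
    ∃ K', LipschitzOnWith K' (fun r => f (a * r + b)) (Icc s t) := by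
  refine ⟨K * a.toNNReal, LipschitzOnWith.of_dist_le_mul fun x hx y hy => ?_⟩
  refine (h.dist_le_mul _ ⟨?_, ?_⟩ _ ⟨?_, ?_⟩).trans ?_
  · nlinarith [hx.1]
  · nlinarith [hx.2]
  · nlinarith [hy.1]
  · nlinarith [hy.2]
  · have : dist (a * x + b) (a * y + b) = a * dist x y := by
      rw [Real.dist_eq, Real.dist_eq, add_sub_add_right_eq_sub, ← mul_sub, abs_mul,
        abs_of_nonneg ha]
    rw [this, NNReal.coe_mul, mul_assoc, Real.coe_toNNReal a ha]

theorem lipschitzOnWith_Icc_union {E : Type*} [PseudoMetricSpace E] {f : ℝ → E} {K₁ K₂ : NNReal}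
    {s θ t : ℝ} (h₁ : LipschitzOnWith K₁ f (Icc s θ)) (h₂ : LipschitzOnWith K₂ f (Icc θ t)) :
    LipschitzOnWith (K₁ + K₂) f (Icc s t) := by
  have key : ∀ x ∈ Icc s t, ∀ y ∈ Icc s t, x ≤ y → dist (f x) (f y) ≤ (K₁ + K₂) * (y - x) := by
    intro x hx y hy hxy
    have e1 : ∀ {a b : ℝ}, a ≤ b → a ∈ Icc s θ → b ∈ Icc s θ →
        dist (f a) (f b) ≤ K₁ * (b - a) := fun {a b} hab ha hb => by
      have := h₁.dist_le_mul a ha b hb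
      rwa [Real.dist_eq, abs_sub_comm, abs_of_nonneg (by linarith)] at this
    have e2 : ∀ {a b : ℝ}, a ≤ b → a ∈ Icc θ t → b ∈ Icc θ t →
        dist (f a) (f b) ≤ K₂ * (b - a) := fun {a b} hab ha hb => by
      have := h₂.dist_le_mul a ha b hb
      rwa [Real.dist_eq, abs_sub_comm, abs_of_nonneg (by linarith)] at this
    have p1 := K₁.coe_nonneg
    have p2 := K₂.coe_nonneg
    rcases le_total y θ with hy' | hy'
    · have := e1 hxy ⟨hx.1, hxy.trans hy'⟩ ⟨hy.1, hy'⟩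
      nlinarith [mul_nonneg p2 (sub_nonneg.2 hxy)]
    · rcases le_total x θ with hx' | hx'
      · have a1 := e1 hx' ⟨hx.1, hx'⟩ ⟨hx.1.trans hx', le_rfl⟩
        have a2 := e2 hy' ⟨le_rfl, hy'.trans hy.2⟩ ⟨hy', hy.2⟩
        have := dist_triangle (f x) (f θ) (f y)
        nlinarith [mul_nonneg p2 (sub_nonneg.2 hx'), mul_nonneg p1 (sub_nonneg.2 hy')]
      · have := e2 hxy ⟨hx', hx.2⟩ ⟨hy', hy.2⟩
        nlinarith [mul_nonneg p1 (sub_nonneg.2 hxy)]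
  refine LipschitzOnWith.of_dist_le_mul fun x hx y hy => ?_
  rcases le_total x y with hxy | hxy
  · rw [Real.dist_eq x y, abs_sub_comm, abs_of_nonneg (sub_nonneg.2 hxy)]
    exact key x hx y hy hxy
  · rw [dist_comm, Real.dist_eq x y, abs_of_nonneg (sub_nonneg.2 hxy)]
    exact key y hy x hx hxy

theorem HasVelocity.comp_affine {γ : ℝ → M} {a b t : ℝ} {u : EuclideanSpace ℝ (Fin m)}
    (h : HasVelocity γ (a * t + b) (horizontalField X u (γ (a * t + b)))) :
    HasVelocity (fun r => γ (a * r + b)) t (horizontalField X (a • u) (γ (a * t + b))) := by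
  have hφ : HasDerivAt (fun r : ℝ => a * r + b) a t := by
    simpa using ((hasDerivAt_id t).const_mul a).add_const b
  have := HasVelocity.comp (φ := fun r : ℝ => a * r + b) h hφ
  rw [horizontalField_smul]
  exact this

theorem HasVelocity.congr_horizontal {γ γ' : ℝ → M} {t : ℝ} {u : EuclideanSpace ℝ (Fin m)}
    (h : HasVelocity γ t (horizontalField X u (γ t))) (hγ : γ' =ᶠ[𝓝 t] γ) :
    HasVelocity γ' t (horizontalField X u (γ' t)) := by
  refine (h.congr_of_eventuallyEq hγ).congr_mfderiv ?_
  have := field_eq_of_eq (horizontalField X u) hγ.eq_of_nhds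
  exact congrArg (fun v : EuclideanSpace ℝ (Fin d) => (1 : ℝ →L[ℝ] ℝ).smulRight v) this.symm

theorem measurable_comp_affine {E : Type*} [MeasurableSpace E] {u : ℝ → E} (hu : Measurable u)
    (a b : ℝ) : Measurable (fun t => u (a * t + b)) :=
  hu.comp ((measurable_id.const_mul a).add_const b)

theorem Reach.symm {L : ℝ} {x y : M} (h : Reach X L x y) : Reach X L y x := by
  obtain ⟨g, u, hg, h0, h1⟩ := h
  refine ⟨fun t => g (-1 * t + 1), fun t => (-1 : ℝ) • u (-1 * t + 1),
    ⟨?_, ?_, ?_, ?_, ?_⟩, by simpa using h1, by simpa using h0⟩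
  · refine hg.continuousOn.comp (by fun_prop) fun t ht => ⟨?_, ?_⟩ <;> linarith [ht.1, ht.2]
  · exact (measurable_comp_affine hg.measurable (-1) 1).const_smul (-1 : ℝ)
  · intro t
    rw [norm_smul]
    simpa using hg.norm_le _
  · filter_upwards [ae_comp_affine hg.velocity (a := -1) (by norm_num) 1] with t ht h
    exact (ht ⟨by linarith [h.2], by linarith [h.1]⟩).comp_affine
  · intro e he s t hs hst ht hr
    obtain ⟨K, hK⟩ := hg.lipschitz e he (1 - t) (1 - s) (by linarith) (by linarith) (by linarith)
      (fun r hr' => by simpa using hr (1 - r) ⟨by linarith [hr'.2], by linarith [hr'.1]⟩)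
    refine ⟨K, LipschitzOnWith.of_dist_le_mul fun a ha b hb => ?_⟩
    have := hK.dist_le_mul (-1 * a + 1) ⟨by linarith [ha.2], by linarith [ha.1]⟩ (-1 * b + 1)
      ⟨by linarith [hb.2], by linarith [hb.1]⟩
    refine this.trans_eq ?_
    rw [Real.dist_eq, Real.dist_eq, add_sub_add_right_eq_sub, ← mul_sub, abs_mul]
    simp

/-- Two horizontal curves are joined by running them at speeds proportional to their lengths. -/
theorem Reach.trans {L₁ L₂ : ℝ} (hL₁ : 0 < L₁) (hL₂ : 0 < L₂) {x y z : M}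
    (h₁ : Reach X L₁ x y) (h₂ : Reach X L₂ y z) : Reach X (L₁ + L₂) x z := by
  obtain ⟨g₁, u₁, hg₁, h₁0, h₁1⟩ := h₁
  obtain ⟨g₂, u₂, hg₂, h₂0, h₂1⟩ := h₂
  set θ : ℝ := L₁ / (L₁ + L₂) with hθ
  set a : ℝ := (L₁ + L₂) / L₁ with ha
  set b : ℝ := (L₁ + L₂) / L₂ with hb
  set c : ℝ := - (L₁ / L₂) with hc
  have hθ0 : 0 < θ := by positivity
  have hθ1 : θ < 1 := by rw [hθ, div_lt_one (by positivity)]; linarith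
  have ha0 : 0 < a := by positivity
  have hb0 : 0 < b := by positivity
  have haθ : a * θ + 0 = 1 := by rw [ha, hθ]; field_simp; simp
  have hbθ : b * θ + c = 0 := by rw [hb, hθ, hc]; field_simp; ring
  have hb1 : b * 1 + c = 1 := by rw [hb, hc]; field_simp; ring
  set g : ℝ → M := fun t => if t ≤ θ then g₁ (a * t + 0) else g₂ (b * t + c) with hg
  have gl : ∀ t ≤ θ, g t = g₁ (a * t + 0) := fun t ht => by simp only [hg, if_pos ht]
  have gr : ∀ t, θ ≤ t → g t = g₂ (b * t + c) := fun t ht => by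
    rcases ht.eq_or_lt with rfl | ht
    · rw [gl _ le_rfl, haθ, hbθ, h₁1, h₂0]
    · simp only [hg, if_neg ht.not_ge]
  refine ⟨g, fun t => if t ≤ θ then a • u₁ (a * t + 0) else b • u₂ (b * t + c),
    ⟨?_, ?_, ?_, ?_, ?_⟩, ?_, ?_⟩
  · have c1 : ContinuousOn g (Icc 0 θ) := by
      refine ContinuousOn.congr (f := fun t => g₁ (a * t + 0)) ?_ fun t ht => gl t ht.2
      refine hg₁.continuousOn.comp (by fun_prop) fun t ht => ⟨?_, ?_⟩ <;> nlinarith [ht.1, ht.2]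
    have c2 : ContinuousOn g (Icc θ 1) := by
      refine ContinuousOn.congr (f := fun t => g₂ (b * t + c)) ?_ fun t ht => gr t ht.1
      refine hg₂.continuousOn.comp (by fun_prop) fun t ht => ⟨?_, ?_⟩ <;> nlinarith [ht.1, ht.2]
    have := c1.union_of_isClosed c2 isClosed_Icc isClosed_Icc
    rwa [Icc_union_Icc_eq_Icc hθ0.le hθ1.le] at this
  · refine Measurable.ite measurableSet_Iic ?_ ?_
    · exact (measurable_comp_affine hg₁.measurable a 0).const_smul a
    · exact (measurable_comp_affine hg₂.measurable b c).const_smul b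
  · intro t
    beta_reduce
    split_ifs
    · rw [norm_smul, Real.norm_eq_abs, abs_of_pos ha0]
      refine (mul_le_mul_of_nonneg_left (hg₁.norm_le _) ha0.le).trans_eq ?_
      rw [ha]; field_simp
    · rw [norm_smul, Real.norm_eq_abs, abs_of_pos hb0]
      refine (mul_le_mul_of_nonneg_left (hg₂.norm_le _) hb0.le).trans_eq ?_
      rw [hb]; field_simp
  · have hne : ∀ᵐ t : ℝ, t ≠ θ := by simp [ae_iff, measure_singleton]
    filter_upwards [ae_comp_affine hg₁.velocity ha0.ne' 0, ae_comp_affine hg₂.velocity hb0.ne' c,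
      hne] with t ht₁ ht₂ htθ ht
    rcases lt_or_gt_of_ne htθ with hlt | hlt
    · have h := (ht₁ ⟨by nlinarith [ht.1], by nlinarith [ht.2]⟩).comp_affine
      simp only [if_pos hlt.le]
      exact h.congr_horizontal (by
        filter_upwards [Iio_mem_nhds hlt] with r hr using gl r (le_of_lt hr))
    · have h := (ht₂ ⟨by nlinarith [ht.1], by nlinarith [ht.2]⟩).comp_affine
      simp only [if_neg hlt.not_ge]
      exact h.congr_horizontal (by
        filter_upwards [Ioi_mem_nhds hlt] with r hr using gr r (le_of_lt hr))
  · intro e he s t hs hst ht hr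
    have A : ∀ s t, 0 ≤ s → s ≤ t → t ≤ θ → (∀ r ∈ Icc s t, g r ∈ e.source) →
        ∃ K, LipschitzOnWith K (fun r => e (g r)) (Icc s t) := by
      intro s t hs hst ht hr
      obtain ⟨K, hK⟩ := hg₁.lipschitz e he (a * s + 0) (a * t + 0) (by positivity)
        (by nlinarith) (by nlinarith) (fun r hr' => by
          have h3 : a * (r / a) + 0 = r := by field_simp; simp
          have h1 : s ≤ r / a := by rw [le_div_iff₀ ha0]; linarith [hr'.1]
          have h2 : r / a ≤ t := by rw [div_le_iff₀ ha0]; linarith [hr'.2]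
          have := hr (r / a) ⟨h1, h2⟩
          rwa [gl _ (h2.trans ht), h3] at this)
      obtain ⟨K', hK'⟩ := lipschitzOnWith_comp_affine ha0.le hK
      exact ⟨K', fun p hp q hq => by
        simpa only [gl p (hp.2.trans ht), gl q (hq.2.trans ht)] using hK' hp hq⟩
    have B : ∀ s t, θ ≤ s → s ≤ t → t ≤ 1 → (∀ r ∈ Icc s t, g r ∈ e.source) →
        ∃ K, LipschitzOnWith K (fun r => e (g r)) (Icc s t) := by
      intro s t hs hst ht hr
      obtain ⟨K, hK⟩ := hg₂.lipschitz e he (b * s + c) (b * t + c) (by nlinarith)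
        (by nlinarith) (by nlinarith) (fun r hr' => by
          have h3 : b * ((r - c) / b) + c = r := by field_simp; simp
          have h1 : s ≤ (r - c) / b := by rw [le_div_iff₀ hb0]; linarith [hr'.1]
          have h2 : (r - c) / b ≤ t := by rw [div_le_iff₀ hb0]; linarith [hr'.2]
          have := hr ((r - c) / b) ⟨h1, h2⟩
          rwa [gr _ (hs.trans h1), h3] at this)
      obtain ⟨K', hK'⟩ := lipschitzOnWith_comp_affine hb0.le hK
      exact ⟨K', fun p hp q hq => by
        simpa only [gr p (hs.trans hp.1), gr q (hs.trans hq.1)] using hK' hp hq⟩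
    rcases le_total t θ with htθ | htθ
    · exact A s t hs hst htθ hr
    · rcases le_total s θ with hsθ | hsθ
      · obtain ⟨K₁, hK₁⟩ := A s θ hs hsθ le_rfl fun r hr' => hr r ⟨hr'.1, hr'.2.trans htθ⟩
        obtain ⟨K₂, hK₂⟩ := B θ t le_rfl htθ ht fun r hr' => hr r ⟨hsθ.trans hr'.1, hr'.2⟩
        exact ⟨_, lipschitzOnWith_Icc_union hK₁ hK₂⟩
      · exact B s t hsθ hst ht hr
  · rw [gl 0 hθ0.le]; simpa using h₁0
  · rw [gr 1 hθ1.le, hb1, h₂1]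

/-- Integral curves of a constant-coefficient combination of the `X ℓ` in a chart are
horizontal. -/
theorem reach_of_integralCurve [IsManifold (𝓡 d) ∞ M]
    (hX : ∀ ℓ : Fin m,
      ContMDiff (𝓡 d) (𝓡 d).tangent ∞ (fun x : M => (⟨x, X ℓ x⟩ : TangentBundle (𝓡 d) M)))
    {e : OpenPartialHomeomorph M (EuclideanSpace ℝ (Fin d))}
    (he : e ∈ atlas (EuclideanSpace ℝ (Fin d)) M) {f : ℝ → EuclideanSpace ℝ (Fin d)}
    (c : EuclideanSpace ℝ (Fin m)) (hf : ∀ t ∈ Icc (0 : ℝ) 1, f t ∈ e.target)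
    (hf' : ∀ t ∈ Icc (0 : ℝ) 1,
      HasDerivWithinAt f (coordField e (horizontalField X c) (f t)) (Icc 0 1) t) :
    Reach X ‖c‖ (e.symm (f 0)) (e.symm (f 1)) := by
  refine ⟨fun t => e.symm (f t), fun _ => c, ⟨?_, measurable_const, fun _ => le_rfl, ?_, ?_⟩,
    rfl, rfl⟩
  · exact e.continuousOn_symm.comp (fun t ht => (hf' t ht).continuousWithinAt) hf
  · refine Eventually.of_forall fun t ht => ?_
    have h := (hf' t ⟨ht.1.le, ht.2.le⟩).hasDerivAt (Icc_mem_nhds ht.1 ht.2)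
    have htt := hf t ⟨ht.1.le, ht.2.le⟩
    refine (hasVelocity_symm_comp he h htt).congr_mfderiv ?_
    congr 1
    exact mfderiv_symm_coordField he (horizontalField X c) htt
  · intro e' he' s t hs hst ht hr
    have hsub : Icc s t ⊆ Icc 0 1 := Icc_subset_Icc hs ht
    have hf1 : ContDiffOn ℝ 1 f (Icc 0 1) := by
      refine ODE.contDiffOn_enat_Icc_of_hasDerivWithinAt (n := 1) (u := e.target)
        (f := fun _ v => coordField e (horizontalField X c) v) ?_ hf' hf
      simp only [Function.uncurry_def, coordField_horizontalField]
      refine ContDiffOn.sum fun ℓ _ => ContDiffOn.const_smul _ ?_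
      exact (((contDiffOn_coordField he (hX ℓ)).of_le (by simp)).comp contDiffOn_snd
        fun p hp => hp.2)
    have hg : ContDiffOn ℝ 1 (fun r => e' (e.symm (f r))) (Icc s t) := by
      intro r hr'
      have h1 : ContMDiffAt (𝓡 d) (𝓡 d) ∞ (fun v => e' (e.symm v)) (f r) :=
        (contMDiffAt_of_mem_atlas he' (hr r hr')).comp _
          (contMDiffAt_symm_of_mem_atlas he (hf r (hsub hr')))
      exact (h1.contDiffAt.of_le (by simp)).comp_contDiffWithinAt r
        ((hf1.mono hsub) r hr')
    obtain ⟨K, hK⟩ := hg.exists_lipschitzOnWith (by simp) (convex_Icc _ _) isCompact_Icc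
    exact ⟨K, hK⟩

end Reach

/-! ### Measurable selection of covectors of minimal norm -/

section Selection

variable {E : Type*} [NormedAddCommGroup E] [InnerProductSpace ℝ E] {m : ℕ}

open scoped RealInnerProductSpace

/-- The frame operator `η ↦ ∑ ℓ, ⟪V ℓ, η⟫ • V ℓ` of a finite family of vectors. -/
def frameOperator (V : Fin m → E) : E →L[ℝ] E :=
  ∑ ℓ, (innerSL ℝ (V ℓ)).smulRight (V ℓ)

theorem frameOperator_apply (V : Fin m → E) (η : E) :
    frameOperator V η = ∑ ℓ, ⟪V ℓ, η⟫ • V ℓ := by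
  simp [frameOperator]

theorem inner_frameOperator (V : Fin m → E) (η ζ : E) :
    ⟪frameOperator V η, ζ⟫ = ∑ ℓ, ⟪V ℓ, η⟫ * ⟪V ℓ, ζ⟫ := by
  simp [frameOperator_apply, sum_inner, inner_smul_left]

theorem isSymmetric_frameOperator (V : Fin m → E) :
    (frameOperator V : E →ₗ[ℝ] E).IsSymmetric := fun η ζ => by
  have h := inner_frameOperator V ζ η
  rw [real_inner_comm] at h
  refine (inner_frameOperator V η ζ).trans (Eq.trans ?_ h.symm)
  exact Finset.sum_congr rfl fun ℓ _ => mul_comm _ _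

theorem norm_le_norm_frameOperator_add (V : Fin m → E) (ε : ℝ) (η : E) :
    ε * ‖η‖ ≤ ‖(frameOperator V + ε • (1 : E →L[ℝ] E)) η‖ := by
  rcases eq_or_ne η 0 with rfl | h
  · simp
  have hη : 0 < ‖η‖ := norm_pos_iff.2 h
  refine le_of_mul_le_mul_right ?_ hη
  refine le_trans ?_ (real_inner_le_norm _ η)
  have h1 : 0 ≤ ⟪frameOperator V η, η⟫ := by
    rw [inner_frameOperator]
    exact Finset.sum_nonneg fun ℓ _ => mul_self_nonneg _
  have h2 : ⟪(frameOperator V + ε • (1 : E →L[ℝ] E)) η, η⟫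
      = ⟪frameOperator V η, η⟫ + ε * (‖η‖ * ‖η‖) := by
    simp [inner_add_left, inner_smul_left, ← real_inner_self_eq_norm_mul_norm]
  rw [h2]; nlinarith

theorem isUnit_frameOperator_add [FiniteDimensional ℝ E] (V : Fin m → E) {ε : ℝ} (hε : 0 < ε) :
    IsUnit (frameOperator V + ε • (1 : E →L[ℝ] E)) := by
  have hinj : Function.Injective (frameOperator V + ε • (1 : E →L[ℝ] E)) := by
    rw [injective_iff_map_eq_zero]
    intro η hη
    have := norm_le_norm_frameOperator_add V ε η
    rw [hη, norm_zero] at this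
    exact norm_le_zero_iff.1 (by nlinarith)
  have := FiniteDimensional.complete ℝ E
  rw [ContinuousLinearMap.isUnit_iff_bijective]
  exact ⟨hinj, LinearMap.injective_iff_surjective
    (f := ((frameOperator V + ε • (1 : E →L[ℝ] E) : E →L[ℝ] E) : E →ₗ[ℝ] E)).1 hinj⟩

/-- Every combination of the `V ℓ` lies in the range of the square of the frame operator, since
that operator is symmetric with kernel the orthogonal complement of the `V ℓ`. -/
theorem exists_frameOperator_frameOperator_eq [FiniteDimensional ℝ E] (V : Fin m → E)
    (c : Fin m → ℝ) :
    ∃ ζ : E, frameOperator V (frameOperator V ζ) = ∑ ℓ, c ℓ • V ℓ := by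
  set T : E →ₗ[ℝ] E := (frameOperator V : E →ₗ[ℝ] E) with hT
  have hsym : T.IsSymmetric := isSymmetric_frameOperator V
  have hsym2 : (T ∘ₗ T).IsSymmetric := fun x y => by
    simp only [LinearMap.comp_apply]
    rw [hsym, hsym]
  have hr : LinearMap.range (T ∘ₗ T) = (LinearMap.ker (T ∘ₗ T))ᗮ := by
    rw [← hsym2.orthogonal_range, Submodule.orthogonal_orthogonal]
  have hmem : (∑ ℓ, c ℓ • V ℓ) ∈ LinearMap.range (T ∘ₗ T) := by
    rw [hr, Submodule.mem_orthogonal]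
    intro η hη
    have h1 : T (T η) = 0 := hη
    have h2 : T η = 0 := by
      rw [← inner_self_eq_zero (𝕜 := ℝ), hsym, h1, inner_zero_right]
    have h3 : ∑ ℓ, ⟪V ℓ, η⟫ * ⟪V ℓ, η⟫ = 0 := by
      rw [← inner_frameOperator]
      exact (congrArg (fun v => ⟪v, η⟫) h2).trans (inner_zero_left _)
    rw [inner_sum]
    refine Finset.sum_eq_zero fun ℓ _ => ?_
    rw [Finset.sum_eq_zero_iff_of_nonneg fun _ _ => mul_self_nonneg _] at h3
    have := mul_self_eq_zero.1 (h3 ℓ (Finset.mem_univ _))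
    rw [inner_smul_right, real_inner_comm, this, mul_zero]
  obtain ⟨ζ, hζ⟩ := hmem
  exact ⟨ζ, hζ⟩

/-- Solutions `ζ` of `∑ ℓ, ⟪V ℓ, ζ⟫ • V ℓ = ∑ ℓ, c ℓ • V ℓ` can be chosen measurably in `V` and
`c`: take the limit of the Tikhonov regularizations `(T + ε)⁻¹ ∑ ℓ, c ℓ • V ℓ`, with `T` the frame
operator, which are continuous in `V` and `c`. -/
theorem exists_measurable_frameOperator_eq [FiniteDimensional ℝ E] [MeasurableSpace E]
    [BorelSpace E] :
    ∃ ζ : (Fin m → E) × EuclideanSpace ℝ (Fin m) → E, Measurable ζ ∧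
      ∀ p, frameOperator p.1 (ζ p) = ∑ ℓ, p.2 ℓ • p.1 ℓ := by
  have hc := FiniteDimensional.complete ℝ E
  set v : (Fin m → E) × EuclideanSpace ℝ (Fin m) → E := fun p => ∑ ℓ, p.2 ℓ • p.1 ℓ with hv
  set ε : ℕ → ℝ := fun n => 1 / ((n : ℝ) + 1) with hεdef
  have hε : ∀ n, 0 < ε n := fun n => Nat.one_div_pos_of_nat
  set A : ℕ → (Fin m → E) × EuclideanSpace ℝ (Fin m) → (E →L[ℝ] E) :=
    fun n p => frameOperator p.1 + ε n • (1 : E →L[ℝ] E) with hA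
  have hAu : ∀ n p, IsUnit (A n p) := fun n p => isUnit_frameOperator_add p.1 (hε n)
  have hAc : ∀ n, Continuous (A n) := fun n => by
    refine Continuous.add ?_ continuous_const
    refine continuous_finsetSum _ fun ℓ _ => ?_
    have h1 : Continuous fun p : (Fin m → E) × EuclideanSpace ℝ (Fin m) => innerSL ℝ (p.1 ℓ) := by
      fun_prop
    have h2 : Continuous fun p : (Fin m → E) × EuclideanSpace ℝ (Fin m) => p.1 ℓ := by fun_prop
    exact (((ContinuousLinearMap.smulRightL ℝ E E).continuous.comp h1).clm_apply h2)
  set f : ℕ → (Fin m → E) × EuclideanSpace ℝ (Fin m) → E :=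
    fun n p => Ring.inverse (A n p) (v p) with hf
  have hfm : ∀ n, Measurable (f n) := fun n => by
    refine Continuous.measurable ?_
    refine Continuous.clm_apply ?_ (by fun_prop)
    rw [continuous_iff_continuousAt]
    intro p
    obtain ⟨a, ha⟩ := hAu n p
    have := NormedRing.inverse_continuousAt a
    rw [ha] at this
    exact ContinuousAt.comp (g := Ring.inverse) this (hAc n).continuousAt
  have hlim : ∀ p, ∃ z, frameOperator p.1 z = v p ∧ Tendsto (fun n => f n p) atTop (𝓝 z) := by
    intro p
    obtain ⟨ζ₂, hζ₂⟩ := exists_frameOperator_frameOperator_eq p.1 p.2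
    set T := frameOperator p.1 with hT
    refine ⟨T ζ₂, hζ₂, ?_⟩
    have hbound : ∀ n, dist (f n p) (T ζ₂) ≤ ε n * (2 * ‖ζ₂‖) := by
      intro n
      have hi : ∀ z, Ring.inverse (A n p) (A n p z) = z := fun z => by
        have := Ring.inverse_mul_cancel _ (hAu n p)
        exact congrArg (fun L : E →L[ℝ] E => L z) this
      have hTe : ∀ z, T z = A n p z - ε n • z := fun z => by simp [hA, hT]
      have hnorm : ∀ z, ‖ε n • Ring.inverse (A n p) z‖ ≤ ‖z‖ := fun z => by
        have h1 := norm_le_norm_frameOperator_add p.1 (ε n) (Ring.inverse (A n p) z)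
        have h2 : A n p (Ring.inverse (A n p) z) = z := by
          have := Ring.mul_inverse_cancel _ (hAu n p)
          exact congrArg (fun L : E →L[ℝ] E => L z) this
        rw [norm_smul, Real.norm_eq_abs, abs_of_pos (hε n)]
        exact h1.trans_eq (congrArg norm h2)
      have hTR : ∀ z, Ring.inverse (A n p) (T z) = z - ε n • Ring.inverse (A n p) z := fun z => by
        rw [hTe, map_sub, hi, map_smul]
      have : f n p - T ζ₂ = -(ε n • (ζ₂ - ε n • Ring.inverse (A n p) ζ₂)) := by
        have h1 : f n p = Ring.inverse (A n p) (T (T ζ₂)) :=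
          congrArg (fun z => Ring.inverse (A n p) z) hζ₂.symm
        rw [h1, hTR (T ζ₂), hTR ζ₂]; abel
      rw [dist_eq_norm, this, norm_neg, norm_smul, Real.norm_eq_abs, abs_of_pos (hε n)]
      refine mul_le_mul_of_nonneg_left ((norm_sub_le _ _).trans ?_) (hε n).le
      linarith [hnorm ζ₂]
    rw [tendsto_iff_dist_tendsto_zero]
    refine squeeze_zero (fun _ => dist_nonneg) hbound ?_
    simpa only [zero_mul] using
      (tendsto_one_div_add_atTop_nhds_zero_nat (𝕜 := ℝ)).mul_const (2 * ‖ζ₂‖)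
  choose ζ hζ₁ hζ₂ using hlim
  exact ⟨ζ, measurable_of_tendsto_metrizable hfm (tendsto_pi_nhds.2 hζ₂), hζ₁⟩

/-- Among the controls producing a given vector, the one of the form `⟪V ·, ζ⟫` is shortest. -/
theorem sum_sq_le_of_sum_smul_eq {F : Type*} [AddCommGroup F] [Module ℝ F] (V : Fin m → F)
    (η : F →ₗ[ℝ] ℝ) (c : EuclideanSpace ℝ (Fin m))
    (h : ∑ ℓ, η (V ℓ) • V ℓ = ∑ ℓ, c ℓ • V ℓ) :
    ∑ ℓ, η (V ℓ) * η (V ℓ) ≤ ‖c‖ ^ 2 := by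
  have h1 := congrArg η h
  simp only [map_sum, map_smul, smul_eq_mul] at h1
  have h2 : 0 ≤ ∑ ℓ, (c ℓ - η (V ℓ)) ^ 2 := Finset.sum_nonneg fun ℓ _ => sq_nonneg _
  have h3 : ∑ ℓ, (c ℓ - η (V ℓ)) ^ 2
      = ∑ ℓ, c ℓ ^ 2 - 2 * ∑ ℓ, c ℓ * η (V ℓ) + ∑ ℓ, η (V ℓ) * η (V ℓ) := by
    rw [Finset.mul_sum, ← Finset.sum_sub_distrib, ← Finset.sum_add_distrib]
    exact Finset.sum_congr rfl fun ℓ _ => by ring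
  rw [EuclideanSpace.norm_sq_eq]
  simp only [Real.norm_eq_abs, sq_abs]
  rw [← h1] at h3
  linarith

end Selection

/-! ### The energy of horizontal curves -/

section Covector

variable {d m : ℕ} {M : Type*} [TopologicalSpace M] [ChartedSpace (EuclideanSpace ℝ (Fin d)) M]
  [IsManifold (𝓡 d) ∞ M]

/-- The covector at `z` with gradient `η` in the trivialization of the tangent bundle at `x₀`; it
is zero if `z` is outside the domain of that trivialization. -/
def trivCovector (x₀ : M) (z : M) (η : EuclideanSpace ℝ (Fin d)) :
    TangentSpace (𝓡 d) z →L[ℝ] ℝ :=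
  (innerSL ℝ η).comp ((trivializationAt (EuclideanSpace ℝ (Fin d))
    (TangentSpace (𝓡 d) : M → Type _) x₀).continuousLinearMapAt ℝ z)

theorem trivCovector_apply {x₀ z : M} (hz : z ∈ (trivializationAt (EuclideanSpace ℝ (Fin d))
    (TangentSpace (𝓡 d) : M → Type _) x₀).baseSet) (η : EuclideanSpace ℝ (Fin d))
    (v : TangentSpace (𝓡 d) z) :
    trivCovector x₀ z η v = inner ℝ η ((trivializationAt (EuclideanSpace ℝ (Fin d))
      (TangentSpace (𝓡 d) : M → Type _) x₀) ⟨z, v⟩).2 := by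
  simp only [trivCovector, ContinuousLinearMap.comp_apply, innerSL_apply_apply,
    Bundle.Trivialization.continuousLinearMapAt_apply]
  rw [Bundle.Trivialization.coe_linearMapAt_of_mem _ hz]

theorem trivCovector_eq_symm {x₀ z : M} (hz : z ∈ (trivializationAt (EuclideanSpace ℝ (Fin d))
    (TangentSpace (𝓡 d) : M → Type _) x₀).baseSet) (η : EuclideanSpace ℝ (Fin d)) :
    (⟨z, trivCovector x₀ z η⟩ : Bundle.TotalSpace (EuclideanSpace ℝ (Fin d) →L[ℝ] ℝ)
        (fun z : M => TangentSpace (𝓡 d) z →L[ℝ] ℝ))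
      = (trivializationAt (EuclideanSpace ℝ (Fin d) →L[ℝ] ℝ)
          (fun z : M => TangentSpace (𝓡 d) z →L[ℝ] ℝ) x₀).toOpenPartialHomeomorph.symm
            (z, innerSL ℝ η) := by
  set e' := trivializationAt (EuclideanSpace ℝ (Fin d) →L[ℝ] ℝ)
          (fun z : M => TangentSpace (𝓡 d) z →L[ℝ] ℝ) x₀ with he'
  have hz' : z ∈ e'.baseSet := by
    rw [he', hom_trivializationAt_baseSet]; exact ⟨hz, mem_univ _⟩
  have hs : (⟨z, trivCovector x₀ z η⟩ : Bundle.TotalSpace (EuclideanSpace ℝ (Fin d) →L[ℝ] ℝ)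
        (fun z : M => TangentSpace (𝓡 d) z →L[ℝ] ℝ)) ∈ e'.source := by
    rw [e'.mem_source]; exact hz'
  refine ((e'.toOpenPartialHomeomorph.left_inv hs).symm.trans ?_)
  congr 1
  refine Prod.ext (e'.coe_fst hs) ?_
  change (e' _).2 = _
  rw [he', hom_trivializationAt_apply]
  simp only [ContinuousLinearMap.inCoordinates]
  ext v
  have := Bundle.Trivialization.continuousLinearMapAt_symmL (R := ℝ) _ hz v
  simpa [trivCovector] using congrArg (fun w : EuclideanSpace ℝ (Fin d) => inner ℝ η w) this

/-- A path of covectors over a continuous curve is measurable if its gradient in a trivialization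
is. -/
theorem measurable_trivCovector [SecondCountableTopology M] (x₀ : M) {G : ℝ → M}
    (hG : Continuous G) {η : ℝ → EuclideanSpace ℝ (Fin d)} (hη : Measurable η) :
    @Measurable ℝ (Bundle.TotalSpace (EuclideanSpace ℝ (Fin d) →L[ℝ] ℝ)
        (fun z : M => TangentSpace (𝓡 d) z →L[ℝ] ℝ)) _ (borel _)
      (fun t => ⟨G t, trivCovector x₀ (G t) (η t)⟩) := by
  borelize M
  borelize (Bundle.TotalSpace (EuclideanSpace ℝ (Fin d) →L[ℝ] ℝ)
        (fun z : M => TangentSpace (𝓡 d) z →L[ℝ] ℝ))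
  set e := trivializationAt (EuclideanSpace ℝ (Fin d))
    (TangentSpace (𝓡 d) : M → Type _) x₀ with he
  set e' := trivializationAt (EuclideanSpace ℝ (Fin d) →L[ℝ] ℝ)
          (fun z : M => TangentSpace (𝓡 d) z →L[ℝ] ℝ) x₀ with he'
  have hs : MeasurableSet (G ⁻¹' e.baseSet) := (e.open_baseSet.preimage hG).measurableSet
  refine measurable_of_restrict_of_restrict_compl hs ?_ ?_
  · have hmem : ∀ t : ↥(G ⁻¹' e.baseSet), (G t, innerSL ℝ (η t)) ∈ e'.target := fun t => by
      rw [e'.mem_target, he', hom_trivializationAt_baseSet]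
      exact ⟨t.2, mem_univ _⟩
    have h1 : Measurable fun t : ↥(G ⁻¹' e.baseSet) =>
        (⟨(G t, innerSL ℝ (η t)), hmem t⟩ : e'.target) := by
      refine Measurable.subtype_mk (Measurable.prodMk ?_ ?_)
      · exact hG.measurable.comp measurable_subtype_coe
      · exact (innerSL ℝ).continuous.measurable.comp (hη.comp measurable_subtype_coe)
    have h2 : Measurable (e'.target.domRestrict e'.toOpenPartialHomeomorph.symm) :=
      (continuousOn_iff_continuous_domRestrict.1 e'.toOpenPartialHomeomorph.continuousOn_symm).measurable
    convert h2.comp h1 using 1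
    funext t
    exact trivCovector_eq_symm t.2 (η t)
  · have h3 : Measurable fun t : ↥(G ⁻¹' e.baseSet)ᶜ =>
        (Bundle.zeroSection (EuclideanSpace ℝ (Fin d) →L[ℝ] ℝ)
          (fun z : M => TangentSpace (𝓡 d) z →L[ℝ] ℝ) (G t)) :=
      ((Bundle.Trivialization.continuous_zeroSection ℝ).comp (hG.comp continuous_subtype_val)).measurable
    convert h3 using 1
    funext t
    have : trivCovector x₀ (G t) (η t) = 0 := by
      ext v
      have : (e.linearMapAt ℝ (G t)) = 0 := Bundle.Trivialization.linearMapAt_def_of_notMem _ t.2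
      simp only [trivCovector, ContinuousLinearMap.comp_apply, innerSL_apply_apply,
        Bundle.Trivialization.continuousLinearMapAt_apply, ← he, this]
      exact inner_zero_right _
    simp only [Set.domRestrict_apply, Bundle.zeroSection, this]

/-- The covectors `ξ t` over a continuous curve with `a ξ = ∑ ℓ, u ℓ • X ℓ` can be chosen
measurably in `t`. -/
theorem exists_measurable_covector [SecondCountableTopology M]
    {X : Fin m → (x : M) → TangentSpace (𝓡 d) x}
    (hX : ∀ ℓ : Fin m,
      ContMDiff (𝓡 d) (𝓡 d).tangent ∞ (fun x : M => (⟨x, X ℓ x⟩ : TangentBundle (𝓡 d) M)))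
    {G : ℝ → M} (hG : Continuous G) {u : ℝ → EuclideanSpace ℝ (Fin m)} (hu : Measurable u) :
    ∃ ξ : (t : ℝ) → TangentSpace (𝓡 d) (G t) →L[ℝ] ℝ,
      @Measurable ℝ (Bundle.TotalSpace (EuclideanSpace ℝ (Fin d) →L[ℝ] ℝ)
        (fun z : M => TangentSpace (𝓡 d) z →L[ℝ] ℝ)) _ (borel _) (fun t => ⟨G t, ξ t⟩) ∧
      ∀ t, sharp X (G t) (ξ t) = horizontalField X (u t) (G t) := by
  classical
  borelize (Bundle.TotalSpace (EuclideanSpace ℝ (Fin d) →L[ℝ] ℝ)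
        (fun z : M => TangentSpace (𝓡 d) z →L[ℝ] ℝ))
  set e : M → Bundle.Trivialization (EuclideanSpace ℝ (Fin d))
      (Bundle.TotalSpace.proj : TangentBundle (𝓡 d) M → M) := fun x₀ =>
    trivializationAt (EuclideanSpace ℝ (Fin d)) (TangentSpace (𝓡 d) : M → Type _) x₀ with he
  rcases isEmpty_or_nonempty M with hM | hM
  · exact (hM.false (G 0)).elim
  obtain ⟨s, hsc, hs⟩ := TopologicalSpace.countable_cover_nhds
    (f := fun x : M => (e x).baseSet) (fun x =>
      (e x).open_baseSet.mem_nhds (FiberBundle.mem_baseSet_trivializationAt' x))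
  have hsne : s.Nonempty := by
    rcases s.eq_empty_or_nonempty with rfl | h
    · simp only [mem_empty_iff_false, iUnion_of_empty, iUnion_empty] at hs
      exact (hs ▸ mem_univ (Classical.arbitrary M) : Classical.arbitrary M ∈ (∅ : Set M)).elim
    · exact h
  obtain ⟨x, hx⟩ := hsc.exists_eq_range hsne
  have hcov : ∀ t, ∃ n, G t ∈ (e (x n)).baseSet := fun t => by
    have : G t ∈ ⋃ x ∈ s, (e x).baseSet := hs ▸ mem_univ _
    rw [hx] at this
    simpa using this
  obtain ⟨ζ, hζm, hζ⟩ := exists_measurable_frameOperator_eq (E := EuclideanSpace ℝ (Fin d)) (m := m)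
  set V : ℕ → ℝ → Fin m → EuclideanSpace ℝ (Fin d) := fun n t ℓ =>
    if t ∈ G ⁻¹' (e (x n)).baseSet then ((e (x n)) ⟨G t, X ℓ (G t)⟩).2 else 0 with hV
  have hVm : ∀ n, Measurable (V n) := fun n => by
    refine measurable_pi_lambda _ fun ℓ => ?_
    refine ContinuousOn.measurable_piecewise (f := fun t => ((e (x n)) ⟨G t, X ℓ (G t)⟩).2)
      (g := fun _ => 0) (s := G ⁻¹' (e (x n)).baseSet) ?_ continuousOn_const
      ((e (x n)).open_baseSet.preimage hG).measurableSet
    refine continuous_snd.comp_continuousOn ?_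
    refine (e (x n)).continuousOn.comp ((hX ℓ).continuous.comp hG).continuousOn fun t ht => ?_
    rw [(e (x n)).mem_source]; exact ht
  set η : ℕ → ℝ → EuclideanSpace ℝ (Fin d) := fun n t => ζ (V n t, u t) with hη
  have hηm : ∀ n, Measurable (η n) := fun n => hζm.comp ((hVm n).prodMk hu)
  refine ⟨fun t => trivCovector (x (Nat.find (hcov t))) (G t) (η (Nat.find (hcov t)) t), ?_, ?_⟩
  · exact Measurable.find (f := fun n t => (⟨G t, trivCovector (x n) (G t) (η n t)⟩ :
      Bundle.TotalSpace (EuclideanSpace ℝ (Fin d) →L[ℝ] ℝ)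
        (fun z : M => TangentSpace (𝓡 d) z →L[ℝ] ℝ)))
      (fun n => measurable_trivCovector (x n) hG (hηm n))
      (fun n => ((e (x n)).open_baseSet.preimage hG).measurableSet) hcov
  · intro t
    set n := Nat.find (hcov t) with hn
    have hz : G t ∈ (e (x n)).baseSet := Nat.find_spec (hcov t)
    have hVt : ∀ ℓ, V n t ℓ = ((e (x n)) ⟨G t, X ℓ (G t)⟩).2 := fun ℓ => if_pos hz
    have hlin : ∀ v : TangentSpace (𝓡 d) (G t), ((e (x n)) ⟨G t, v⟩).2
        = (e (x n)).continuousLinearEquivAt ℝ (G t) hz v := fun v => rfl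
    refine ((e (x n)).continuousLinearEquivAt ℝ (G t) hz).injective ?_
    have h := hζ (V n t, u t)
    rw [frameOperator_apply] at h
    simp only [sharp, horizontalField, map_sum, map_smul]
    refine Eq.trans (Finset.sum_congr rfl fun ℓ _ => ?_) (h.trans
      (Finset.sum_congr rfl fun ℓ _ => ?_))
    · rw [trivCovector_apply hz, ← hlin, real_inner_comm]
      change inner ℝ _ (η n t) • _ = inner ℝ (V n t ℓ) (ζ (V n t, u t)) • V n t ℓ
      rw [hVt]
    · change u t ℓ • V n t ℓ = _
      rw [hVt, hlin]

/-- A point that can be reached by a horizontal curve of length `L` is at distance at most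
`L`. -/
theorem Reach.subDist_le [SecondCountableTopology M]
    {X : Fin m → (x : M) → TangentSpace (𝓡 d) x}
    (hX : ∀ ℓ : Fin m,
      ContMDiff (𝓡 d) (𝓡 d).tangent ∞ (fun x : M => (⟨x, X ℓ x⟩ : TangentBundle (𝓡 d) M)))
    {L : ℝ} {x y : M} (h : Reach X L x y) : subDist X x y ≤ ENNReal.ofReal L := by
  have hL := h.nonneg
  obtain ⟨g, u, hg, h0, h1⟩ := h
  let γ : Path x y :=
    { toFun := fun t => g t
      continuous_toFun := continuousOn_iff_continuous_domRestrict.1 hg.continuousOn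
      source' := by simpa using h0
      target' := by simpa using h1 }
  have hext : ∀ t ∈ Icc (0 : ℝ) 1, γ.extend t = g t := fun t ht => γ.extend_apply ht
  obtain ⟨ξ, hξm, hξ⟩ := exists_measurable_covector hX γ.continuous_extend hg.measurable
  have hAC : IsAbsolutelyContinuous d γ := by
    intro e he s t hs hst ht hr
    obtain ⟨K, hK⟩ := hg.lipschitz e he s t hs hst ht fun r hr' => by
      have := hr r hr'
      rwa [hext r ⟨hs.trans hr'.1, hr'.2.trans ht⟩] at this
    have hK' : LipschitzOnWith K (fun r => e (γ.extend r)) (Icc s t) := fun p hp q hq => by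
      simpa only [hext p ⟨hs.trans hp.1, hp.2.trans ht⟩,
        hext q ⟨hs.trans hq.1, hq.2.trans ht⟩] using hK hp hq
    rw [← uIcc_of_le hst] at hK'
    exact hK'.absolutelyContinuousOnInterval
  have hd : IsDriving X γ ξ := by
    refine ⟨hξm, ?_⟩
    rw [ae_restrict_iff' measurableSet_Icc]
    have n0 : ∀ᵐ t : ℝ, t ≠ 0 := by simp [ae_iff, measure_singleton]
    have n1 : ∀ᵐ t : ℝ, t ≠ 1 := by simp [ae_iff, measure_singleton]
    filter_upwards [hg.velocity, n0, n1] with t ht ht0 ht1 hti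
    have hti' : t ∈ Ioo (0 : ℝ) 1 := ⟨lt_of_le_of_ne hti.1 ht0.symm, lt_of_le_of_ne hti.2 ht1⟩
    have := (ht hti').congr_horizontal (γ' := γ.extend) (by
      filter_upwards [Icc_mem_nhds hti'.1 hti'.2] with r hr using hext r hr)
    rw [hξ]
    exact this
  have hE : energy X γ ≤ ENNReal.ofReal (L ^ 2) := by
    refine (iInf_le _ hAC).trans ((iInf_le _ ξ).trans ((iInf_le _ hd).trans ?_))
    calc _ ≤ ∫⁻ _ in Icc (0 : ℝ) 1, ENNReal.ofReal (L ^ 2) := by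
          refine lintegral_mono fun t => ENNReal.ofReal_le_ofReal ?_
          refine (sum_sq_le_of_sum_smul_eq (fun ℓ => X ℓ (γ.extend t)) (ξ t).toLinearMap (u t)
            (hξ t)).trans ?_
          exact pow_le_pow_left₀ (norm_nonneg _) (hg.norm_le t) 2
      _ = _ := by simp
  refine (iInf_le _ γ).trans ((ENNReal.rpow_le_rpow hE (by norm_num)).trans_eq ?_)
  rw [ENNReal.ofReal_pow hL, ← ENNReal.rpow_natCast, ← ENNReal.rpow_mul]
  norm_num

end Covector

/-! ### Flows of smooth vector fields -/

section Flow

universe v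

set_option synthInstance.maxHeartbeats 200000

/-- Pointwise application of a path of bilinear maps to a path of vectors, as an operator on the
latter. -/
def pathBilin {G E F : Type v} [NormedAddCommGroup G] [NormedSpace ℝ G] [NormedAddCommGroup E]
    [NormedSpace ℝ E] [NormedAddCommGroup F] [NormedSpace ℝ F] (B : G →L[ℝ] E →L[ℝ] F)
    (A : C(unitInterval, G)) : C(unitInterval, E) →L[ℝ] C(unitInterval, F) :=
  LinearMap.mkContinuous
    { toFun := fun u => ⟨fun t => B (A t) (u t), by fun_prop⟩
      map_add' := fun u w => by ext t; simp
      map_smul' := fun a u => by ext t; simp } (‖B‖ * ‖A‖)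
    (fun u => by
      rw [ContinuousMap.norm_le _ (by positivity)]
      intro t
      refine (B.le_opNorm₂ _ _).trans ?_
      have h1 := A.norm_coe_le_norm t
      have h2 := u.norm_coe_le_norm t
      gcongr)

theorem contDiff_pathBilin_comp {G E F : Type v} [NormedAddCommGroup G] [NormedSpace ℝ G]
    [NormedAddCommGroup E] [NormedSpace ℝ E] [NormedAddCommGroup F] [NormedSpace ℝ F]
    (B : G →L[ℝ] E →L[ℝ] F) {n : ℕ} {N : C(unitInterval, E) → C(unitInterval, G)}
    (hN : ContDiff ℝ n N) : ContDiff ℝ n (fun u => pathBilin B (N u)) := by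
  have hl : IsLinearMap ℝ (pathBilin (F := F) (E := E) B) :=
    ⟨fun A A' => by ext u t; simp [pathBilin], fun a A => by ext u t; simp [pathBilin]⟩
  have hn : ∀ A, ‖pathBilin (F := F) (E := E) B A‖ ≤ ‖B‖ * ‖A‖ := fun A => by
    unfold pathBilin
    exact LinearMap.mkContinuous_norm_le _ (mul_nonneg (norm_nonneg B) (norm_nonneg A)) _
  have hb : IsBoundedLinearMap ℝ (pathBilin (F := F) (E := E) B) :=
    IsLinearMap.with_bound hl ‖B‖ hn
  have hc : ContDiff ℝ n (pathBilin (F := F) (E := E) B) :=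
    IsBoundedLinearMap.contDiff (E := C(unitInterval, G))
      (F := C(unitInterval, E) →L[ℝ] C(unitInterval, F)) hb
  exact hc.comp hN

/-- Composition with a `C¹` map is differentiable on the space of continuous paths. -/
theorem hasFDerivAt_comp_left {E F : Type v} [NormedAddCommGroup E] [NormedSpace ℝ E]
    [NormedAddCommGroup F] [NormedSpace ℝ F] (f : C(E, F)) (f' : E → E →L[ℝ] F)
    (hc : Continuous f') (hf : ∀ x, HasFDerivAt f (f' x) x) (u : C(unitInterval, E)) :
    HasFDerivAt (fun u : C(unitInterval, E) => f.comp u) (pathBilin (.id ℝ _)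
      (ContinuousMap.comp ⟨f', hc⟩ u)) u := by
  rw [hasFDerivAt_iff_isLittleO_nhds_zero, Asymptotics.isLittleO_iff]
  intro ε hε
  have hK : IsCompact (range u) := isCompact_range u.continuous
  have h1 := hK.uniformContinuousAt_of_continuousAt f' (fun a _ => hc.continuousAt)
    (Metric.dist_mem_uniformity hε)
  obtain ⟨δ, hδ, h2⟩ := Metric.mem_uniformity_dist.1 h1
  filter_upwards [Metric.ball_mem_nhds (0 : C(unitInterval, E)) hδ] with h hh
  rw [mem_ball_zero_iff] at hh
  rw [ContinuousMap.norm_le _ (by positivity)]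
  intro t
  have hconv := (convex_ball (u t) δ).norm_image_sub_le_of_norm_hasFDerivWithin_le'
    (f := f) (f' := f') (φ := f' (u t)) (C := ε) (x := u t) (y := u t + h t)
    (fun x _ => (hf x).hasFDerivWithinAt) (fun x hx => by
      have := @h2 (u t) x (by rw [dist_comm]; exact hx) (mem_range_self t)
      simp only [mem_ofPred_eq] at this
      rw [← dist_eq_norm, dist_comm]; exact this.le)
    (Metric.mem_ball_self hδ) (by
      rw [Metric.mem_ball, dist_eq_norm, add_sub_cancel_left]
      exact (h.norm_coe_le_norm t).trans_lt hh)
  rw [add_sub_cancel_left] at hconv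
  exact hconv.trans (mul_le_mul_of_nonneg_left (h.norm_coe_le_norm t) hε.le)

/-- Composition with a `Cⁿ` map is `Cⁿ` on the space of continuous paths. -/
theorem contDiff_comp_left {E : Type v} [NormedAddCommGroup E] [NormedSpace ℝ E] (n : ℕ) :
    ∀ {F : Type v} [NormedAddCommGroup F] [NormedSpace ℝ F] (f : C(E, F)),
      ContDiff ℝ n f → ContDiff ℝ n (fun u : C(unitInterval, E) => f.comp u) := by
  induction n with
  | zero =>
    intro F _ _ f _
    exact contDiff_zero.2 (ContinuousMap.continuous_postcomp f)
  | succ n ih =>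
    intro F _ _ f hf
    rw [Nat.cast_succ, contDiff_succ_iff_hasFDerivAt] at hf ⊢
    obtain ⟨f', hf', hd⟩ := hf
    exact ⟨_, contDiff_pathBilin_comp (.id ℝ (E →L[ℝ] F)) (ih ⟨f', hf'.continuous⟩ hf'),
      fun u => hasFDerivAt_comp_left f f' hf'.continuous hd u⟩

/-- The primitive vanishing at `0`, as an operator on the space of continuous paths. -/
def pathPrimitive (E : Type v) [NormedAddCommGroup E] [NormedSpace ℝ E] :
    C(unitInterval, E) →L[ℝ] C(unitInterval, E) :=
  LinearMap.mkContinuous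
    { toFun := fun u => ⟨fun t => ∫ r in (0 : ℝ)..t, u (projIcc 0 1 zero_le_one r),
        (intervalIntegral.continuous_primitive (fun a b =>
          (u.continuous.comp continuous_projIcc).intervalIntegrable a b) 0).comp
            continuous_subtype_val⟩
      map_add' := fun u w => by
        ext t
        exact intervalIntegral.integral_add
          ((u.continuous.comp continuous_projIcc).intervalIntegrable _ _)
          ((w.continuous.comp continuous_projIcc).intervalIntegrable _ _)
      map_smul' := fun a u => by
        ext t
        exact intervalIntegral.integral_smul a _ } 1
    (fun u => by
      rw [one_mul, ContinuousMap.norm_le _ (norm_nonneg _)]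
      intro t
      refine (intervalIntegral.norm_integral_le_of_norm_le_const
        (fun r _ => u.norm_coe_le_norm _)).trans ?_
      rw [sub_zero, abs_of_nonneg t.2.1]
      exact mul_le_of_le_one_right (norm_nonneg _) t.2.2)

/-- A smooth map on an open set agrees near any of its points with a globally smooth map. -/
theorem exists_contDiff_eventuallyEq {E F : Type v} [NormedAddCommGroup E] [NormedSpace ℝ E]
    [FiniteDimensional ℝ E] [NormedAddCommGroup F] [NormedSpace ℝ F] {U : Set E} (hU : IsOpen U)
    {f : E → F} (hf : ContDiffOn ℝ ∞ f U) {x : E} (hx : x ∈ U) :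
    ∃ g : E → F, ContDiff ℝ ∞ g ∧ g =ᶠ[𝓝 x] f := by
  obtain ⟨r, hr, hrU⟩ := Metric.nhds_basis_closedBall.mem_iff.1 (hU.mem_nhds hx)
  let b : ContDiffBump x := ⟨r / 2, r, by linarith, by linarith⟩
  refine ⟨fun y => b y • f y, ?_, ?_⟩
  · rw [contDiff_iff_contDiffAt]
    intro y
    by_cases hy : y ∈ tsupport b
    · rw [b.tsupport_eq] at hy
      exact b.contDiffAt.smul ((hf y (hrU hy)).contDiffAt (hU.mem_nhds (hrU hy)))
    · have : (fun y => b y • f y) =ᶠ[𝓝 y] fun _ => 0 := by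
        filter_upwards [notMem_tsupport_iff_eventuallyEq.1 hy] with z hz
        simp [hz]
      exact contDiffAt_const.congr_of_eventuallyEq this
  · filter_upwards [Metric.closedBall_mem_nhds x b.rIn_pos] with y hy
    simp [b.one_of_mem_closedBall hy]

/-- The local flow of a smooth vector field is `C²` jointly in the initial point and the time. The
flow lines are obtained from the implicit function theorem for the integral equation
`u = x + s ∫₀ f(u)` in the space of continuous paths on `[0,1]`, solved near `s = 0`. -/
theorem exists_contDiffAt_flow {E : Type v} [NormedAddCommGroup E] [NormedSpace ℝ E]
    [FiniteDimensional ℝ E] {U : Set E} (hU : IsOpen U) {f : E → E} (hf : ContDiffOn ℝ ∞ f U)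
    {x₀ : E} (hx₀ : x₀ ∈ U) :
    ∃ ψ : E × ℝ → E, ContDiffAt ℝ 2 ψ (x₀, 0) ∧
      (∀ᶠ p in 𝓝 (x₀, (0 : ℝ)), ∃ u : ℝ → E, u 0 = p.1 ∧ u 1 = ψ p ∧
        ∀ t ∈ Icc (0 : ℝ) 1, u t ∈ U ∧ HasDerivWithinAt u (p.2 • f (u t)) (Icc 0 1) t) ∧
      (∀ᶠ x in 𝓝 x₀, ψ (x, 0) = x ∧ HasDerivAt (fun s => ψ (x, s)) (f x) 0) := by
  have hcomp := FiniteDimensional.complete ℝ E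
  obtain ⟨g, hg, hgf⟩ := exists_contDiff_eventuallyEq hU hf hx₀
  let gc : C(E, E) := ⟨g, hg.continuous⟩
  have hN : ContDiff ℝ 2 (fun u : C(unitInterval, E) => gc.comp u) :=
    contDiff_comp_left 2 gc (hg.of_le two_le_infty)
  let cst : E →L[ℝ] C(unitInterval, E) := LinearMap.mkContinuous
    { toFun := fun x => ContinuousMap.const unitInterval x
      map_add' := fun x y => rfl
      map_smul' := fun a x => rfl } 1 (fun x => by
        rw [one_mul, ContinuousMap.norm_le _ (norm_nonneg _)]
        exact fun t => le_rfl)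
  have hcst : ∀ x t, cst x t = x := fun x t => rfl
  let G : (E × ℝ) × C(unitInterval, E) → C(unitInterval, E) := fun p =>
    p.2 - cst p.1.1 - p.1.2 • pathPrimitive E (gc.comp p.2)
  have hG : ContDiff ℝ 2 G := by
    have h1 : ContDiff ℝ 2 (fun p : (E × ℝ) × C(unitInterval, E) => gc.comp p.2) :=
      hN.comp contDiff_snd
    have h2 := (pathPrimitive E).contDiff (n := 2).comp h1
    have h3 : ContDiff ℝ 2 (fun p : (E × ℝ) × C(unitInterval, E) => cst p.1.1) :=
      cst.contDiff.comp (contDiff_fst.comp contDiff_fst)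
    exact (contDiff_snd.sub h3).sub ((contDiff_snd.comp contDiff_fst).smul h2)
  set p₀ : (E × ℝ) × C(unitInterval, E) := ((x₀, 0), cst x₀) with hp₀
  have hG0 : G p₀ = 0 := by simp [G, hp₀]
  have hinr : fderiv ℝ G p₀ ∘L .inr ℝ (E × ℝ) C(unitInterval, E) = .id ℝ _ := by
    have h1 : HasFDerivAt (fun u : C(unitInterval, E) => G ((x₀, 0), u))
        (fderiv ℝ G p₀ ∘L .inr ℝ (E × ℝ) C(unitInterval, E)) (cst x₀) :=
      ((hG.differentiable (by simp)) p₀).hasFDerivAt.comp (cst x₀)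
        (hasFDerivAt_prodMk_right (x₀, (0 : ℝ)) (cst x₀))
    have h2 : HasFDerivAt (fun u : C(unitInterval, E) => G ((x₀, 0), u)) (.id ℝ _) (cst x₀) := by
      simp only [G, zero_smul, sub_zero]
      exact (hasFDerivAt_id _).sub_const _
    exact h1.unique h2
  have hinv : (fderiv ℝ G p₀ ∘L .inr ℝ (E × ℝ) C(unitInterval, E)).IsInvertible := by
    rw [hinr]; exact ⟨.refl ℝ _, rfl⟩
  set Φ := hG.contDiffAt.implicitFunction (by simp) hinv with hΦ
  have hΦc : ContDiffAt ℝ 2 Φ (x₀, 0) := hG.contDiffAt.contDiffAt_implicitFunction (by simp) hinv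
  have hΦ0 : Φ (x₀, 0) = cst x₀ := hG.contDiffAt.implicitFunction_apply_self (by simp) hinv
  have hΦe : ∀ᶠ p in 𝓝 (x₀, (0 : ℝ)), G (p, Φ p) = 0 := by
    have := hG.contDiffAt.eventually_apply_implicitFunction (by simp) hinv
    filter_upwards [this] with p hp
    rw [hp, hG0]
  have heq : ∀ p, G (p, Φ p) = 0 → ∀ t : unitInterval,
      Φ p t = p.1 + p.2 • ∫ r in (0 : ℝ)..t, g (Φ p (projIcc 0 1 zero_le_one r)) := by
    intro p hp t
    have := congrArg (fun u : C(unitInterval, E) => u t) hp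
    have h2 : Φ p t - p.1 - p.2 • ∫ r in (0 : ℝ)..t, g (Φ p (projIcc 0 1 zero_le_one r)) = 0 := this
    rw [sub_sub, sub_eq_zero] at h2
    exact h2
  let ev : C(unitInterval, E) →L[ℝ] E := ContinuousMap.evalCLM ℝ (1 : unitInterval)
  refine ⟨fun p => Φ p 1, ev.contDiff.contDiffAt.comp _ hΦc, ?_, ?_⟩
  · obtain ⟨r, hr, hrU⟩ := Metric.nhds_basis_closedBall.mem_iff.1
      (Filter.inter_mem hgf (hU.mem_nhds hx₀))
    have hnear : ∀ᶠ p in 𝓝 (x₀, (0 : ℝ)), dist (Φ p) (cst x₀) < r := by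
      have := hΦc.continuousAt
      rw [ContinuousAt, hΦ0] at this
      exact this (Metric.ball_mem_nhds _ hr)
    filter_upwards [hΦe, hnear] with p hp hn
    have hΦr : ∀ t, Φ p t ∈ {x | g x = f x} ∩ U := fun t => hrU (by
      rw [Metric.mem_closedBall]
      exact ((ContinuousMap.dist_apply_le_dist (g := cst x₀) t)).trans hn.le)
    have hcont : Continuous fun r => g (Φ p (projIcc 0 1 zero_le_one r)) :=
      hg.continuous.comp ((Φ p).continuous.comp continuous_projIcc)
    refine ⟨fun t => p.1 + p.2 • ∫ r in (0 : ℝ)..t, g (Φ p (projIcc 0 1 zero_le_one r)),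
      by simp, (heq p hp 1).symm, fun t ht => ?_⟩
    have hut := heq p hp ⟨t, ht⟩
    refine ⟨?_, ?_⟩
    · beta_reduce
      rw [← hut]; exact (hΦr _).2
    · beta_reduce
      rw [← hut, ← (hΦr ⟨t, ht⟩).1]
      have h1 := (hcont.integral_hasStrictDerivAt 0 t).hasDerivAt
      rw [projIcc_of_mem _ ht] at h1
      exact ((h1.const_smul p.2).const_add p.1).hasDerivWithinAt
  · have hcts : ∀ᶠ p in 𝓝 (x₀, (0 : ℝ)), ContinuousAt Φ p := by
      filter_upwards [hΦc.eventually (by simp)] with p hp using hp.continuousAt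
    have hemb : Tendsto (fun x : E => (x, (0 : ℝ))) (𝓝 x₀) (𝓝 (x₀, 0)) :=
      (Continuous.prodMk_left (0 : ℝ)).tendsto x₀
    filter_upwards [hemb.eventually hΦe, hemb.eventually hcts, hemb.eventually
      hΦe.eventually_nhds, hgf] with x hx hxc hxe hgx
    have hΦx : Φ (x, 0) = cst x := by
      ext t
      rw [heq _ hx]; simp [hcst]
    refine ⟨by simp [hΦx, hcst], ?_⟩
    have hemb2 : Tendsto (fun s : ℝ => (x, s)) (𝓝 0) (𝓝 (x, 0)) :=
      (Continuous.prodMk_right x).tendsto 0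
    let I : ℝ → E := fun s => pathPrimitive E (gc.comp (Φ (x, s))) 1
    have hI : ContinuousAt I 0 := by
      have h1 : ContinuousAt (fun s => Φ (x, s)) 0 :=
        ContinuousAt.comp (g := Φ) (f := fun s : ℝ => (x, s)) hxc hemb2
      have h2 := hN.continuous.continuousAt.comp h1
      exact ((ContinuousMap.evalCLM ℝ (1 : unitInterval)).continuous.comp
        (pathPrimitive E).continuous).continuousAt.comp h2
    have hI0 : I 0 = f x := by
      have : I 0 = ∫ r in (0 : ℝ)..1, g (Φ (x, 0) (projIcc 0 1 zero_le_one r)) := rfl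
      rw [this, hΦx]
      simp [hcst, hgx]
    have hd : HasDerivAt (fun s : ℝ => x + s • I s) (f x) 0 := by
      rw [hasDerivAt_iff_tendsto_slope]
      have : Tendsto I (𝓝[≠] 0) (𝓝 (f x)) := hI0 ▸ hI.tendsto.mono_left nhdsWithin_le_nhds
      refine this.congr' ?_
      filter_upwards [self_mem_nhdsWithin] with s hs
      simp [slope_def_module, smul_smul, inv_mul_cancel₀ (show s ≠ 0 from hs)]
    refine hd.congr_of_eventuallyEq ?_
    filter_upwards [hemb2.eventually hxe] with s hs
    exact heq _ hs 1

end Flow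

/-! ### Vector fields tangent to an immersion -/

section Tangency

variable {P E : Type*} [NormedAddCommGroup P] [NormedSpace ℝ P] [NormedAddCommGroup E]
  [NormedSpace ℝ E]

/-- If `V` and `W` are `g`-related to `v` and `w`, then the Lie brackets are `g`-related. This is
the symmetry of the second derivative of `g`. -/
theorem lieBracket_apply_of_related {g : P → E} {V W : E → E} {v w : P → P} {t : P}
    (hg : ContDiffAt ℝ 2 g t) (hv : DifferentiableAt ℝ v t) (hw : DifferentiableAt ℝ w t)
    (hV : DifferentiableAt ℝ V (g t)) (hW : DifferentiableAt ℝ W (g t))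
    (hgV : ∀ᶠ s in 𝓝 t, V (g s) = fderiv ℝ g s (v s))
    (hgW : ∀ᶠ s in 𝓝 t, W (g s) = fderiv ℝ g s (w s)) :
    VectorField.lieBracket ℝ V W (g t) = fderiv ℝ g t (fderiv ℝ w t (v t) - fderiv ℝ v t (w t)) := by
  have hgd : DifferentiableAt ℝ g t := hg.differentiableAt (by simp)
  have hg1 : DifferentiableAt ℝ (fderiv ℝ g) t :=
    (hg.fderiv_right (m := 1) (by norm_num)).differentiableAt (by simp)
  have key : ∀ (Z : E → E) (z : P → P), DifferentiableAt ℝ z t → DifferentiableAt ℝ Z (g t) →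
      (∀ᶠ s in 𝓝 t, Z (g s) = fderiv ℝ g s (z s)) → ∀ τ : P,
      fderiv ℝ Z (g t) (fderiv ℝ g t τ) =
        fderiv ℝ (fderiv ℝ g) t τ (z t) + fderiv ℝ g t (fderiv ℝ z t τ) := by
    intro Z z hz hZ hgZ τ
    have h1 : HasFDerivAt (fun s => Z (g s)) ((fderiv ℝ Z (g t)).comp (fderiv ℝ g t)) t :=
      hZ.hasFDerivAt.comp t hgd.hasFDerivAt
    have h2 := (hg1.hasFDerivAt.clm_apply hz.hasFDerivAt).congr_of_eventuallyEq hgZ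
    have h3 := congrArg (fun L : P →L[ℝ] E => L τ) (h1.unique h2)
    simp at h3
    rw [h3, add_comm]
  have hsymm := hg.isSymmSndFDerivAt (by simp)
  rw [VectorField.lieBracket_eq, map_sub]
  change fderiv ℝ W (g t) (V (g t)) - fderiv ℝ V (g t) (W (g t)) = _
  rw [hgV.self_of_nhds, hgW.self_of_nhds, key W w hw hW hgW, key V v hv hV hgV, hsymm (w t) (v t)]
  abel

/-- A vector field tangent to the image of an immersion `g` is `g`-related to a vector field on
the domain. -/
theorem exists_related_of_tangent [FiniteDimensional ℝ P] [FiniteDimensional ℝ E]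
    {g : P → E} {V : E → E} {t : P} (hg : ContDiffAt ℝ 2 g t)
    (hinj : Function.Injective (fderiv ℝ g t)) (hV : ContDiffAt ℝ 1 V (g t))
    (htan : ∀ᶠ s in 𝓝 t, V (g s) ∈ (fderiv ℝ g s).range) :
    ∃ v : P → P, ContDiffAt ℝ 1 v t ∧ ∀ᶠ s in 𝓝 t, V (g s) = fderiv ℝ g s (v s) := by
  have := FiniteDimensional.complete ℝ P
  obtain ⟨L', hL'⟩ := LinearMap.exists_leftInverse_of_injective
    (fderiv ℝ g t : P →ₗ[ℝ] E) (LinearMap.ker_eq_bot.2 hinj)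
  let L : E →L[ℝ] P := LinearMap.toContinuousLinearMap L'
  have hL : L ∘L fderiv ℝ g t = 1 := by
    ext τ
    exact congrArg (fun A : P →ₗ[ℝ] P => A τ) hL'
  have hA : ContDiffAt ℝ 1 (fun s => L ∘L fderiv ℝ g s) t :=
    contDiffAt_const.clm_comp (hg.fderiv_right (m := 1) (by norm_num))
  have hinv : ContDiffAt ℝ 1 (fun s => Ring.inverse (L ∘L fderiv ℝ g s)) t := by
    have h1 : ContDiffAt ℝ 1 (Ring.inverse : (P →L[ℝ] P) → _) (L ∘L fderiv ℝ g t) := by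
      rw [hL]; exact contDiffAt_ringInverse ℝ (1 : (P →L[ℝ] P)ˣ)
    exact h1.comp t hA
  have hunit : ∀ᶠ s in 𝓝 t, IsUnit (L ∘L fderiv ℝ g s) := by
    have : {A : P →L[ℝ] P | IsUnit A} ∈ 𝓝 (L ∘L fderiv ℝ g t) :=
      Units.isOpen.mem_nhds (by rw [hL]; exact isUnit_one)
    exact hA.continuousAt this
  refine ⟨fun s => Ring.inverse (L ∘L fderiv ℝ g s) (L (V (g s))),
    hinv.clm_apply (L.contDiff.contDiffAt.comp t (hV.comp t (hg.of_le (by norm_num)))), ?_⟩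
  filter_upwards [hunit, htan] with s hs hts
  obtain ⟨τ, hτ⟩ := hts
  have h1 : Ring.inverse (L ∘L fderiv ℝ g s) ((L ∘L fderiv ℝ g s) τ) = τ :=
    congrArg (fun A : P →L[ℝ] P => A τ) (Ring.inverse_mul_cancel _ hs)
  have h2 : (L ∘L fderiv ℝ g s) τ = L (V (g s)) := congrArg L hτ
  rw [← h2, h1]
  exact hτ.symm

/-- The vector fields tangent to the image of an immersion are closed under the Lie bracket. -/
theorem eventually_lieBracket_mem_range [FiniteDimensional ℝ P] [FiniteDimensional ℝ E]
    {g : P → E} {V W : E → E} {t : P}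
    (hg : ContDiffAt ℝ 2 g t) (hinj : Function.Injective (fderiv ℝ g t))
    (hV : ContDiffAt ℝ 1 V (g t)) (hW : ContDiffAt ℝ 1 W (g t))
    (htV : ∀ᶠ s in 𝓝 t, V (g s) ∈ (fderiv ℝ g s).range)
    (htW : ∀ᶠ s in 𝓝 t, W (g s) ∈ (fderiv ℝ g s).range) :
    ∀ᶠ s in 𝓝 t, VectorField.lieBracket ℝ V W (g s) ∈ (fderiv ℝ g s).range := by
  obtain ⟨v, hv, hgv⟩ := exists_related_of_tangent hg hinj hV htV
  obtain ⟨w, hw, hgw⟩ := exists_related_of_tangent hg hinj hW htW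
  filter_upwards [hg.eventually (by simp), hv.eventually (by simp), hw.eventually (by simp),
    hg.continuousAt.eventually (hV.eventually (by simp)),
    hg.continuousAt.eventually (hW.eventually (by simp)), hgv.eventually_nhds,
    hgw.eventually_nhds] with s h1 h2 h3 h4 h5 h6 h7
  exact ⟨_, (lieBracket_apply_of_related h1 (h2.differentiableAt (by simp))
    (h3.differentiableAt (by simp)) (h4.differentiableAt (by simp))
    (h5.differentiableAt (by simp)) h6 h7).symm⟩

end Tangency

/-! ### Chow's theorem -/

section Chow

variable {d m : ℕ} {M : Type*} [TopologicalSpace M] [ChartedSpace (EuclideanSpace ℝ (Fin d)) M]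
  [IsManifold (𝓡 d) ∞ M] {X : Fin m → (x : M) → TangentSpace (𝓡 d) x}

theorem IsIteratedBracket.contMDiff
    (hX : ∀ ℓ : Fin m,
      ContMDiff (𝓡 d) (𝓡 d).tangent ∞ (fun x : M => (⟨x, X ℓ x⟩ : TangentBundle (𝓡 d) M)))
    {V : (x : M) → TangentSpace (𝓡 d) x} (hV : IsIteratedBracket X V) :
    ContMDiff (𝓡 d) (𝓡 d).tangent ∞ (fun x : M => (⟨x, V x⟩ : TangentBundle (𝓡 d) M)) := by
  induction hV with
  | base ℓ => exact hX ℓ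
  | bracket V W _ _ ihV ihW =>
    have : IsManifold (𝓡 d) (minSmoothness ℝ 2) M := by
      rw [minSmoothness_of_isRCLikeNormedField]
      exact IsManifold.of_le two_le_infty
    have : IsManifold (𝓡 d) ((∞ : ℕ∞ω) + 1) M := by
      have h : (∞ : ℕ∞ω) + 1 = (∞ : ℕ∞ω) := rfl
      rw [h]; infer_instance
    intro x
    exact ContMDiffAt.mlieBracket_vectorField (m := ⊤) (n := ⊤) (ihV x) (ihW x) (by simp)

/-- If the `X ℓ` are tangent to the image of an immersion, so are their iterated brackets; as these
span, the immersion is a submersion. -/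
theorem range_eq_top_of_tangent (hX : IsSubRiemannianStructure X)
    {e : OpenPartialHomeomorph M (EuclideanSpace ℝ (Fin d))}
    (he : e ∈ atlas (EuclideanSpace ℝ (Fin d)) M) {P : Type*} [NormedAddCommGroup P]
    [NormedSpace ℝ P] [FiniteDimensional ℝ P] {g : P → EuclideanSpace ℝ (Fin d)} {t : P}
    (hg : ContDiffAt ℝ 2 g t) (hgt : g t ∈ e.target) (hinj : Function.Injective (fderiv ℝ g t))
    (htan : ∀ᶠ s in 𝓝 t, ∀ ℓ, coordField e (X ℓ) (g s) ∈ (fderiv ℝ g s).range) :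
    (fderiv ℝ g t).range = ⊤ := by
  have hsm : ∀ {V : (x : M) → TangentSpace (𝓡 d) x}, IsIteratedBracket X V →
      ContDiffAt ℝ 1 (coordField e V) (g t) := fun hV =>
    (((contDiffOn_coordField he (hV.contMDiff hX.smooth)).contDiffAt
      (e.open_target.mem_nhds hgt)).of_le (by simp))
  have hall : ∀ {V : (x : M) → TangentSpace (𝓡 d) x}, IsIteratedBracket X V →
      ∀ᶠ s in 𝓝 t, coordField e V (g s) ∈ (fderiv ℝ g s).range := by
    intro V hV
    induction hV with
    | base ℓ => filter_upwards [htan] with s hs using hs ℓ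
    | bracket V W hV hW ihV ihW =>
      filter_upwards [eventually_lieBracket_mem_range hg hinj (hsm hV) (hsm hW) ihV ihW,
        hg.continuousAt (e.open_target.mem_nhds hgt)] with s hs hst
      rwa [coordField_mlieBracket he (hV.contMDiff hX.smooth) (hW.contMDiff hX.smooth) hst]
  set z := e.symm (g t) with hz
  let D : TangentSpace (𝓡 d) z →ₗ[ℝ] EuclideanSpace ℝ (Fin d) := (chartDeriv e z).toLinearMap
  have hcomap : Submodule.comap D (fderiv ℝ g t).range = ⊤ := by
    rw [eq_top_iff, ← hX.span_eq_top z, Submodule.span_le]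
    rintro v ⟨V, hV, rfl⟩
    exact (hall hV).self_of_nhds
  have hsurj : Function.Surjective D :=
    (mdifferentiable_of_mem_atlas_infty he).mfderiv_surjective (e.map_target hgt)
  rw [eq_top_iff]
  intro v _
  obtain ⟨w, rfl⟩ := hsurj v
  have : w ∈ Submodule.comap D (fderiv ℝ g t).range := hcomap ▸ Submodule.mem_top
  exact this

/-- A `C²` family `φ y`, `y` near `x`, of immersions of a neighbourhood of `t` in the parameter
space `P` such that `φ y s` can be reached from `y` along horizontal curves of length at most
`L`. -/
structure IsReachFamily (X : Fin m → (x : M) → TangentSpace (𝓡 d) x) (L : ℝ)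
    (e : OpenPartialHomeomorph M (EuclideanSpace ℝ (Fin d))) (x : EuclideanSpace ℝ (Fin d))
    {P : Type} [NormedAddCommGroup P] [NormedSpace ℝ P]
    (φ : EuclideanSpace ℝ (Fin d) × P → EuclideanSpace ℝ (Fin d)) (t : P) : Prop where
  contDiffAt : ContDiffAt ℝ 2 φ (x, t)
  mem_target : φ (x, t) ∈ e.target
  injective : Function.Injective (fderiv ℝ (fun s => φ (x, s)) t)
  reach : ∀ᶠ p in 𝓝 (x, t), Reach X L (e.symm p.1) (e.symm (φ p))

/-- Krener's argument: as long as the immersions are not submersions, some `X ℓ` is transverse to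
their images, and flowing along it adds a parameter. -/
theorem IsReachFamily.exists_prod (hX : IsSubRiemannianStructure X)
    {e : OpenPartialHomeomorph M (EuclideanSpace ℝ (Fin d))}
    (he : e ∈ atlas (EuclideanSpace ℝ (Fin d)) M) {L δ : ℝ} (hL : 0 < L) (hδ : 0 < δ)
    {x : EuclideanSpace ℝ (Fin d)} {P : Type} [NormedAddCommGroup P]
    [NormedSpace ℝ P] [FiniteDimensional ℝ P]
    {φ : EuclideanSpace ℝ (Fin d) × P → EuclideanSpace ℝ (Fin d)} {t₀ : P}
    (h : IsReachFamily X L e x φ t₀) (hP : Module.finrank ℝ P < d) :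
    ∃ (φ' : EuclideanSpace ℝ (Fin d) × (P × ℝ) → EuclideanSpace ℝ (Fin d)) (t' : P × ℝ),
      IsReachFamily X (L + δ) e x φ' t' := by
  have hslice : ∀ t, ContDiffAt ℝ 2 φ (x, t) → ContDiffAt ℝ 2 (fun s => φ (x, s)) t := fun t ht =>
    ht.comp t (contDiffAt_const.prodMk contDiffAt_id)
  have hcont : Tendsto (fun t : P => (x, t)) (𝓝 t₀) (𝓝 (x, t₀)) :=
    (Continuous.prodMk_right x).tendsto t₀
  have hg := hslice t₀ h.contDiffAt
  have hnot : ¬ ∀ᶠ s in 𝓝 t₀, ∀ ℓ, coordField e (X ℓ) (φ (x, s)) ∈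
      (fderiv ℝ (fun s => φ (x, s)) s).range := by
    intro hcon
    have htop := range_eq_top_of_tangent hX he hg h.mem_target h.injective hcon
    have h1 := LinearMap.finrank_range_le (fderiv ℝ (fun s => φ (x, s)) t₀).toLinearMap
    have h2 : Module.finrank ℝ (fderiv ℝ (fun s => φ (x, s)) t₀).range = d := by
      rw [htop, finrank_top, finrank_euclideanSpace_fin]
    exact absurd (h2.symm.trans_le h1) (by omega)
  have hinj : ∀ᶠ s in 𝓝 t₀, Function.Injective (fderiv ℝ (fun s => φ (x, s)) s) := by
    have hc : ContinuousAt (fderiv ℝ (fun s => φ (x, s))) t₀ :=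
      (hg.fderiv_right (m := 1) (by norm_num)).continuousAt
    exact hc (ContinuousLinearMap.isOpen_injective.mem_nhds h.injective)
  obtain ⟨t, hnt, ht1, ht2, ht3, ht4⟩ := ((not_eventually.1 hnot).and_eventually
    (hinj.and ((hcont.eventually (h.contDiffAt.eventually (by simp))).and
      ((hcont.eventually h.reach.eventually_nhds).and
        (hg.continuousAt (e.open_target.mem_nhds h.mem_target)))))).exists
  push Not at hnt
  obtain ⟨ℓ, hℓ⟩ := hnt
  obtain ⟨ψ, hψ, hψu, hψ0⟩ := exists_contDiffAt_flow e.open_target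
    (contDiffOn_coordField he (hX.smooth ℓ)) ht4
  have hψ00 : ψ (φ (x, t), 0) = φ (x, t) := (hψ0.self_of_nhds).1
  let α : EuclideanSpace ℝ (Fin d) × (P × ℝ) → EuclideanSpace ℝ (Fin d) × ℝ :=
    fun p => (φ (p.1, p.2.1), p.2.2)
  have hα : ContDiffAt ℝ 2 α (x, (t, 0)) := by
    refine ContDiffAt.prodMk ?_ (by fun_prop)
    exact ContDiffAt.comp (g := φ) (x, (t, (0 : ℝ))) ht2 (by fun_prop)
  have hα' : ContinuousAt α (x, (t, 0)) := hα.continuousAt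
  refine ⟨fun p => ψ (α p), (t, 0), ContDiffAt.comp (g := ψ) (x, (t, (0 : ℝ))) hψ hα, ?_, ?_, ?_⟩
  · change ψ (φ (x, t), 0) ∈ e.target
    rw [hψ00]; exact ht4
  · have hψd : HasFDerivAt ψ (fderiv ℝ ψ (φ (x, t), 0)) (φ (x, t), 0) :=
      (hψ.differentiableAt (by simp)).hasFDerivAt
    have hψ1 : ∀ v, fderiv ℝ ψ (φ (x, t), 0) (v, 0) = v := by
      have h0 : HasFDerivAt (fun y : EuclideanSpace ℝ (Fin d) => (y, (0 : ℝ)))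
          (.inl ℝ (EuclideanSpace ℝ (Fin d)) ℝ) (φ (x, t)) := hasFDerivAt_prodMk_left _ _
      have h1 := HasFDerivAt.comp (g := ψ) (φ (x, t)) hψd h0
      have h2 : HasFDerivAt (fun y => ψ (y, (0 : ℝ))) (.id ℝ _) (φ (x, t)) :=
        (hasFDerivAt_id _).congr_of_eventuallyEq (hψ0.mono fun y hy => hy.1)
      intro v
      exact congrArg (fun A : EuclideanSpace ℝ (Fin d) →L[ℝ] EuclideanSpace ℝ (Fin d) => A v)
        (h1.unique h2)
    have hψ2 : ∀ r : ℝ, fderiv ℝ ψ (φ (x, t), 0) (0, r) = r • coordField e (X ℓ) (φ (x, t)) := by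
      have h0 : HasFDerivAt (fun s : ℝ => (φ (x, t), s))
          (.inr ℝ (EuclideanSpace ℝ (Fin d)) ℝ) 0 := hasFDerivAt_prodMk_right _ _
      have h1 := HasFDerivAt.comp (g := ψ) (0 : ℝ) hψd h0
      have h2 := (hψ0.self_of_nhds).2.hasFDerivAt
      intro r
      have := congrArg (fun A : ℝ →L[ℝ] EuclideanSpace ℝ (Fin d) => A r) (h1.unique h2)
      simpa using this
    have hgd : HasFDerivAt (fun s => φ (x, s)) (fderiv ℝ (fun s => φ (x, s)) t) t :=
      ((hslice t ht2).differentiableAt (by simp)).hasFDerivAt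
    have hd : HasFDerivAt (fun q : P × ℝ => ψ (α (x, q)))
        ((fderiv ℝ ψ (φ (x, t), 0)).comp (((fderiv ℝ (fun s => φ (x, s)) t).comp
          (.fst ℝ P ℝ)).prod (.snd ℝ P ℝ))) (t, 0) := by
      refine HasFDerivAt.comp (g := ψ) (t, (0 : ℝ)) hψd ?_
      exact (HasFDerivAt.comp (g := fun s => φ (x, s)) (t, (0 : ℝ)) hgd hasFDerivAt_fst).prodMk
        hasFDerivAt_snd
    change Function.Injective (fderiv ℝ (fun q : P × ℝ => ψ (α (x, q))) (t, 0))
    rw [hd.fderiv, injective_iff_map_eq_zero]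
    rintro ⟨τ, r⟩ hτ
    have h0 : fderiv ℝ ψ (φ (x, t), 0) (fderiv ℝ (fun s => φ (x, s)) t τ, r) = 0 := hτ
    have hsplit : ((fderiv ℝ (fun s => φ (x, s)) t τ, r) : EuclideanSpace ℝ (Fin d) × ℝ)
        = (fderiv ℝ (fun s => φ (x, s)) t τ, 0) + (0, r) := by simp
    rw [hsplit, map_add, hψ1, hψ2] at h0
    have hr : r = 0 := by
      by_contra hr
      refine hℓ ⟨-(r⁻¹ • τ), ?_⟩
      have h3 := eq_neg_of_add_eq_zero_left h0
      change fderiv ℝ (fun s => φ (x, s)) t (-(r⁻¹ • τ)) = _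
      rw [map_neg, map_smul, h3, smul_neg, neg_neg, smul_smul, inv_mul_cancel₀ hr, one_smul]
    rw [hr, zero_smul, add_zero] at h0
    rw [(injective_iff_map_eq_zero _).1 ht1 τ h0, hr]
    rfl
  · have hc1 : Tendsto (fun p : EuclideanSpace ℝ (Fin d) × (P × ℝ) => (p.1, p.2.1))
        (𝓝 (x, (t, 0))) (𝓝 (x, t)) := Continuous.tendsto (by fun_prop) (x, (t, (0 : ℝ)))
    have hc2 : ∀ᶠ p in 𝓝 (x, (t, (0 : ℝ))), ‖p.2.2‖ < δ := by
      have : Continuous fun p : EuclideanSpace ℝ (Fin d) × (P × ℝ) => ‖p.2.2‖ := by fun_prop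
      exact this.continuousAt.eventually_lt continuousAt_const (by simpa using hδ)
    filter_upwards [hc1.eventually ht3, hα'.eventually hψu, hc2] with p hp1 hp2 hp3
    obtain ⟨u, hu0, hu1, hu⟩ := hp2
    refine hp1.trans hL hδ ?_
    have hc : ∀ z, coordField e (horizontalField X (EuclideanSpace.single ℓ p.2.2)) z
        = p.2.2 • coordField e (X ℓ) z := fun z => by
      rw [coordField_horizontalField]
      simp [ite_smul]
    have := reach_of_integralCurve hX.smooth he (EuclideanSpace.single ℓ p.2.2) (f := u)
      (fun t ht => (hu t ht).1) (fun t ht => by rw [hc]; exact (hu t ht).2)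
    rw [hu0, hu1] at this
    exact this.mono (by simpa using hp3.le)

/-- Immersed families of reachable points exist in every dimension `k ≤ d`, with arbitrarily short
curves. -/
theorem exists_isReachFamily (hX : IsSubRiemannianStructure X)
    {e : OpenPartialHomeomorph M (EuclideanSpace ℝ (Fin d))}
    (he : e ∈ atlas (EuclideanSpace ℝ (Fin d)) M) {x : EuclideanSpace ℝ (Fin d)}
    (hx : x ∈ e.target) (k : ℕ) (hk : k ≤ d) :
    ∀ L > 0, ∃ (P : Type) (_ : NormedAddCommGroup P) (_ : NormedSpace ℝ P)
      (_ : FiniteDimensional ℝ P)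
      (φ : EuclideanSpace ℝ (Fin d) × P → EuclideanSpace ℝ (Fin d)) (t : P),
      Module.finrank ℝ P = k ∧ IsReachFamily X L e x φ t := by
  induction k with
  | zero =>
    intro L hL
    refine ⟨EuclideanSpace ℝ (Fin 0), inferInstance, inferInstance, inferInstance, Prod.fst, 0,
      by simp, contDiffAt_fst, hx, Function.injective_of_subsingleton _, ?_⟩
    exact Eventually.of_forall fun p => reach_refl hL.le _
  | succ k ih =>
    intro L hL
    obtain ⟨P, _, _, _, φ, t, hP, h⟩ := ih (by omega) (L / 2) (by positivity)
    obtain ⟨φ', t', h'⟩ := h.exists_prod hX he (half_pos hL) (half_pos hL) (by omega)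
    rw [add_halves] at h'
    exact ⟨P × ℝ, inferInstance, inferInstance, inferInstance, φ', t', by simp [hP], h'⟩

/-- Chow's theorem: all points near `z` can be reached from `z` along arbitrarily short horizontal curves. -/
theorem eventually_reach (hX : IsSubRiemannianStructure X) (z : M) {L : ℝ} (hL : 0 < L) :
    ∀ᶠ y in 𝓝 z, Reach X L z y := by
  set e := chartAt (EuclideanSpace ℝ (Fin d)) z with he'
  have he : e ∈ atlas (EuclideanSpace ℝ (Fin d)) M := chart_mem_atlas _ z
  have hz : z ∈ e.source := mem_chart_source _ z
  obtain ⟨P, _, _, _, φ, t, hP, h⟩ := exists_isReachFamily hX he (e.map_source hz) d le_rfl (L / 2)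
    (half_pos hL)
  set x := e z with hx
  have hφ := h.contDiffAt.hasStrictFDerivAt (by simp)
  have hsl : fderiv ℝ (fun s => φ (x, s)) t = (fderiv ℝ φ (x, t)).comp (.inr ℝ _ P) :=
    (hφ.hasFDerivAt.comp t (hasFDerivAt_prodMk_right x t)).fderiv
  have hsurj : Function.Surjective (fderiv ℝ (fun s => φ (x, s)) t) :=
    (LinearMap.injective_iff_surjective_of_finrank_eq_finrank
      (f := (fderiv ℝ (fun s => φ (x, s)) t).toLinearMap) (by simp [hP])).1 h.injective
  -- The point `φ (x, t)` is reached from `z`, and from every `y` near `z` by a nearby parameter.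
  have hF : HasStrictFDerivAt (fun p : EuclideanSpace ℝ (Fin d) × P => (p.1, φ p))
      ((ContinuousLinearMap.fst ℝ _ P).prod (fderiv ℝ φ (x, t))) (x, t) :=
    hasStrictFDerivAt_fst.prodMk hφ
  have hFs : ((ContinuousLinearMap.fst ℝ (EuclideanSpace ℝ (Fin d)) P).prod
      (fderiv ℝ φ (x, t))).range = ⊤ := by
    rw [LinearMap.range_eq_top]
    rintro ⟨v, w⟩
    obtain ⟨τ, hτ⟩ := hsurj (w - fderiv ℝ φ (x, t) (v, 0))
    refine ⟨(v, τ), Prod.ext rfl ?_⟩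
    change fderiv ℝ φ (x, t) (v, τ) = w
    have hsplit : ((v, τ) : EuclideanSpace ℝ (Fin d) × P) = (v, 0) + (0, τ) := by simp
    rw [hsl] at hτ
    have hτ' : fderiv ℝ φ (x, t) (0, τ) = w - fderiv ℝ φ (x, t) (v, 0) := hτ
    rw [hsplit, map_add, hτ']; abel
  have := FiniteDimensional.complete ℝ P
  have hmap := hF.map_nhds_eq_of_surj hFs
  have hev : ∀ᶠ q in 𝓝 (x, φ (x, t)), ∃ p : EuclideanSpace ℝ (Fin d) × P,
      (p.1, φ p) = q ∧ Reach X (L / 2) (e.symm p.1) (e.symm (φ p)) := by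
    rw [← hmap, eventually_map]
    filter_upwards [h.reach] with p hp using ⟨p, rfl, hp⟩
  have hc : Tendsto (fun y => (e y, φ (x, t))) (𝓝 z) (𝓝 (x, φ (x, t))) :=
    (e.continuousAt hz).prodMk continuousAt_const
  filter_upwards [hc.eventually hev, e.open_source.mem_nhds hz] with y hy hys
  obtain ⟨p, hp, hr⟩ := hy
  have h1 : p.1 = e y := congrArg Prod.fst hp
  have h2 : φ p = φ (x, t) := congrArg Prod.snd hp
  rw [h1, h2, e.left_inv hys] at hr
  have h0 := h.reach.self_of_nhds
  rw [hx, e.left_inv hz] at h0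
  have := h0.trans (half_pos hL) (half_pos hL) hr.symm
  rwa [add_halves] at this

end Chow

/-! ### The Carnot–Carathéodory distance -/

section CCDist

variable {d m : ℕ} {M : Type*} [TopologicalSpace M] [ChartedSpace (EuclideanSpace ℝ (Fin d)) M]
  {X : Fin m → (x : M) → TangentSpace (𝓡 d) x}

/-- The Carnot–Carathéodory distance, the infimum of the lengths of the horizontal curves from `x`
to `y`. -/
def ccDist (X : Fin m → (x : M) → TangentSpace (𝓡 d) x) (x y : M) : ℝ := sInf {L | Reach X L x y}

theorem bddBelow_reach (x y : M) : BddBelow {L | Reach X L x y} := ⟨0, fun _ h => h.nonneg⟩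

theorem ccDist_nonneg (x y : M) : 0 ≤ ccDist X x y := Real.sInf_nonneg fun _ h => h.nonneg

theorem Reach.ccDist_le {L : ℝ} {x y : M} (h : Reach X L x y) : ccDist X x y ≤ L :=
  csInf_le (bddBelow_reach x y) h

theorem ccDist_self (x : M) : ccDist X x x = 0 :=
  le_antisymm (reach_refl le_rfl x).ccDist_le (ccDist_nonneg x x)

theorem ccDist_comm (x y : M) : ccDist X x y = ccDist X y x := by
  unfold ccDist
  congr 1
  ext L
  exact ⟨Reach.symm, Reach.symm⟩

variable [IsManifold (𝓡 d) ∞ M]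

theorem exists_reach [ConnectedSpace M] (hX : IsSubRiemannianStructure X) (x y : M) :
    ∃ L, Reach X L x y := by
  have : Std.Symm (fun x y : M => ∃ L, Reach X L x y) := ⟨fun x y ⟨L, h⟩ => ⟨L, h.symm⟩⟩
  refine PreconnectedSpace.induction₂ (fun x y => ∃ L, Reach X L x y) (fun x => ?_) ⟨?_⟩ x y
  · filter_upwards [eventually_reach hX x one_pos] with y hy using ⟨1, hy⟩
  · intro x y z ⟨L₁, h₁⟩ ⟨L₂, h₂⟩
    exact ⟨_, (h₁.mono (le_max_left L₁ 1)).trans (by positivity) (by positivity)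
      (h₂.mono (le_max_left L₂ 1))⟩

theorem eventually_ccDist_lt (hX : IsSubRiemannianStructure X) (z : M) {ε : ℝ} (hε : 0 < ε) :
    ∀ᶠ y in 𝓝 z, ccDist X z y < ε := by
  filter_upwards [eventually_reach hX z (half_pos hε)] with y hy
  exact hy.ccDist_le.trans_lt (half_lt_self hε)

/-- A function which is `1`-Lipschitz for the Carnot–Carathéodory distance is continuous. -/
theorem continuous_of_sub_le_ccDist (hX : IsSubRiemannianStructure X) {w : M → ℝ}
    (hw : ∀ x y, w y - w x ≤ ccDist X x y) : Continuous w := by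
  rw [continuous_iff_continuousAt]
  intro z
  rw [ContinuousAt, Metric.tendsto_nhds]
  intro ε hε
  filter_upwards [eventually_ccDist_lt hX z hε] with y hy
  rw [Real.dist_eq, abs_lt]
  have h1 := hw z y
  have h2 := hw y z
  rw [ccDist_comm] at h2
  constructor <;> linarith

variable [ConnectedSpace M]

theorem reach_of_ccDist_lt (hX : IsSubRiemannianStructure X) {L : ℝ} {x y : M}
    (h : ccDist X x y < L) : Reach X L x y := by
  obtain ⟨L', hL', hlt⟩ := exists_lt_of_csInf_lt (exists_reach hX x y) h
  exact Reach.mono hL' hlt.le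

theorem ccDist_triangle (hX : IsSubRiemannianStructure X) (x y z : M) :
    ccDist X x z ≤ ccDist X x y + ccDist X y z := by
  refine le_of_forall_pos_le_add fun ε hε => ?_
  have h1 := reach_of_ccDist_lt hX (lt_add_of_pos_right (ccDist X x y) (half_pos hε))
  have h2 := reach_of_ccDist_lt hX (lt_add_of_pos_right (ccDist X y z) (half_pos hε))
  have := (h1.trans (by linarith [ccDist_nonneg (X := X) x y])
    (by linarith [ccDist_nonneg (X := X) y z]) h2).ccDist_le
  linarith

theorem subDist_le_ofReal_ccDist [SecondCountableTopology M] (hX : IsSubRiemannianStructure X)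
    (x y : M) : subDist X x y ≤ ENNReal.ofReal (ccDist X x y) := by
  have h : ∀ n : ℕ, subDist X x y ≤ ENNReal.ofReal (ccDist X x y + 1 / ((n : ℝ) + 1)) := fun n =>
    (reach_of_ccDist_lt hX (lt_add_of_pos_right _ Nat.one_div_pos_of_nat)).subDist_le hX.smooth
  refine ge_of_tendsto' (x := atTop) ?_ h
  refine (ENNReal.continuous_ofReal.tendsto _).comp ?_
  simpa only [add_zero] using
    (tendsto_one_div_add_atTop_nhds_zero_nat (𝕜 := ℝ)).const_add (ccDist X x y)

end CCDist

/-! ### Inf-convolution -/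

section InfConvolution

theorem eventually_le_of_hasDerivAt {g : ℝ → ℝ} {a b : ℝ} (hg : HasDerivAt g a 0) (hab : a < b) :
    ∀ᶠ s in 𝓝[>] (0 : ℝ), g s ≤ g 0 + s * b := by
  have h := (hasDerivAt_iff_tendsto_slope.1 hg).mono_left
    (nhdsWithin_mono (0 : ℝ) (fun s (hs : s ∈ Ioi (0 : ℝ)) => ne_of_gt hs))
  filter_upwards [h (Iio_mem_nhds hab), self_mem_nhdsWithin] with s hs hs0
  have hs0' : 0 < s := hs0
  simp only [mem_preimage, slope_def_field, sub_zero, mem_Iio] at hs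
  rw [div_lt_iff₀ hs0'] at hs
  linarith

variable {E C : Type*} [NormedAddCommGroup E] [InnerProductSpace ℝ E] [FiniteDimensional ℝ E]
  [NormedAddCommGroup C]

/-- Regularization by inf-convolution. If `f` grows at most at rate `‖c‖` along some curve with
velocity `Y c` from each point, then `h z = min_y (f y + ‖z - y‖² / ε)` grows at most at rate
`(1 + δ) ‖c‖` along every curve with velocity `Y c`: let the minimizer `y` move along with `z`;
since `Y c` is Lipschitz, the penalty increases at a rate controlled by its own size. -/
theorem exists_infConvolution {f : E → ℝ} {Y : C → E → E} {q : E} {r : ℝ} (hr : 0 < r) {K : ℝ}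
    (hK : 0 ≤ K) (hf : ContinuousOn f (Metric.closedBall q (3 * r)))
    (hY : ∀ c, ∀ x ∈ Metric.closedBall q (3 * r), ∀ y ∈ Metric.closedBall q (3 * r),
      ‖Y c x - Y c y‖ ≤ K * ‖c‖ * ‖x - y‖)
    (hfY : ∀ y ∈ Metric.ball q (3 * r), ∀ c, ∃ η : ℝ → E, η 0 = y ∧ HasDerivAt η (Y c y) 0 ∧
      ∀ᶠ s in 𝓝[>] (0 : ℝ), f (η s) ≤ f y + s * ‖c‖) {δ : ℝ} (hδ : 0 < δ) :
    ∃ h : E → ℝ, (∀ z ∈ Metric.ball q (2 * r), |h z - f z| ≤ δ) ∧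
      (∀ z ∈ Metric.ball q (2 * r),
        (fun p : E × E => h p.1 - h p.2) =O[𝓝 (z, z)] fun p => p.1 - p.2) ∧
      ∀ z ∈ Metric.ball q (2 * r), ∀ c (ζ : ℝ → E), ζ 0 = z → HasDerivAt ζ (Y c z) 0 →
        ∀ η > 0, ∀ᶠ s in 𝓝[>] (0 : ℝ), h (ζ s) ≤ h z + s * ((1 + δ) * ‖c‖ + η) := by
  set S := Metric.closedBall q (3 * r) with hS
  have hSc : IsCompact S := isCompact_closedBall q (3 * r)
  obtain ⟨B, hB⟩ := hSc.exists_bound_of_continuousOn hf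
  have hq : q ∈ S := Metric.mem_closedBall_self (by positivity)
  have hB0 : 0 ≤ B := (norm_nonneg _).trans (hB q hq)
  -- The oscillation allowed at the scale of the regularization.
  set δ' : ℝ := min δ (δ / (2 * K + 1)) with hδ'
  have hδ'0 : 0 < δ' := lt_min hδ (by positivity)
  have hδK : 2 * K * δ' ≤ δ := by
    have h1 : δ' ≤ δ / (2 * K + 1) := min_le_right _ _
    rw [le_div_iff₀ (by positivity)] at h1
    nlinarith
  obtain ⟨η₀, hη₀, hunif⟩ := Metric.uniformContinuousOn_iff.1
    (hSc.uniformContinuousOn_of_continuous hf) δ' hδ'0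
  set ρ : ℝ := min η₀ r with hρ
  have hρ0 : 0 < ρ := lt_min hη₀ hr
  set ε : ℝ := ρ ^ 2 / (2 * B + 1) with hε
  have hε0 : 0 < ε := by positivity
  have hmin : ∀ z, ∃ y ∈ S, ∀ y' ∈ S, f y + ‖z - y‖ ^ 2 / ε ≤ f y' + ‖z - y'‖ ^ 2 / ε := by
    intro z
    obtain ⟨y, hy, hyS⟩ := hSc.exists_isMinOn ⟨q, hq⟩
      (f := fun y => f y + ‖z - y‖ ^ 2 / ε) (by fun_prop)
    exact ⟨y, hy, fun y' hy' => hyS hy'⟩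
  choose y hyS hy using hmin
  have h2S : ∀ z ∈ Metric.ball q (2 * r), z ∈ S := fun z hz =>
    (Metric.ball_subset_closedBall.trans (Metric.closedBall_subset_closedBall (by linarith))) hz
  have hpen : ∀ z ∈ Metric.ball q (2 * r), ‖z - y z‖ ^ 2 / ε ≤ f z - f (y z) := fun z hz => by
    have := hy z z (h2S z hz)
    simp only [sub_self, norm_zero] at this
    rw [show (0 : ℝ) ^ 2 / ε = 0 by simp] at this
    linarith
  have hdist : ∀ z ∈ Metric.ball q (2 * r), ‖z - y z‖ < ρ := fun z hz => by
    have h1 := hpen z hz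
    have h2 := abs_le.1 (hB z (h2S z hz))
    have h3 := abs_le.1 (hB (y z) (hyS z))
    have h4 : ‖z - y z‖ ^ 2 ≤ 2 * B * ε := by
      rw [div_le_iff₀ hε0] at h1
      refine h1.trans (mul_le_mul_of_nonneg_right (by linarith [h2.2, h3.1]) hε0.le)
    have h5 : 2 * B * ε < ρ ^ 2 := by
      rw [hε, ← mul_div_assoc, div_lt_iff₀ (by positivity)]
      nlinarith [pow_pos hρ0 2]
    exact lt_of_pow_lt_pow_left₀ 2 hρ0.le (h4.trans_lt h5)
  have hosc : ∀ z ∈ Metric.ball q (2 * r), f z - f (y z) ≤ δ' := fun z hz => by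
    have := hunif z (h2S z hz) (y z) (hyS z)
      (by rw [dist_eq_norm]; exact (hdist z hz).trans_le (min_le_left _ _))
    rw [Real.dist_eq] at this
    exact (le_abs_self _).trans this.le
  refine ⟨fun z => f (y z) + ‖z - y z‖ ^ 2 / ε, fun z hz => ?_, fun z hz => ?_, ?_⟩
  · have h0 : 0 ≤ ‖z - y z‖ ^ 2 / ε := by positivity
    have hd : δ' ≤ δ := min_le_left _ _
    rw [abs_le]
    constructor <;> linarith [hpen z hz, hosc z hz]
  · refine Asymptotics.IsBigO.of_bound (10 * r / ε) ?_
    have hball : ∀ᶠ p in 𝓝 (z, z), p ∈ Metric.ball q (2 * r) ×ˢ Metric.ball q (2 * r) :=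
      (Metric.isOpen_ball.prod Metric.isOpen_ball).mem_nhds ⟨hz, hz⟩
    have key : ∀ a ∈ Metric.ball q (2 * r), ∀ b ∈ Metric.ball q (2 * r),
        (f (y a) + ‖a - y a‖ ^ 2 / ε) - (f (y b) + ‖b - y b‖ ^ 2 / ε)
          ≤ 10 * r / ε * ‖a - b‖ := by
      intro a ha b hb
      have h1 := hy a (y b) (hyS b)
      have hay : ‖a - y b‖ ≤ 5 * r := by
        have e1 := Metric.mem_ball.1 ha
        have e2 := Metric.mem_closedBall.1 (hyS b)
        rw [← dist_eq_norm]
        linarith [dist_triangle_right a (y b) q]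
      have hby : ‖b - y b‖ ≤ 5 * r := by
        have e1 := Metric.mem_ball.1 hb
        have e2 := Metric.mem_closedBall.1 (hyS b)
        rw [← dist_eq_norm]
        linarith [dist_triangle_right b (y b) q]
      have h2 : ‖a - y b‖ - ‖b - y b‖ ≤ ‖a - b‖ := by
        have := norm_sub_norm_le (a - y b) (b - y b)
        rwa [sub_sub_sub_cancel_right] at this
      have h3 : ‖a - y b‖ ^ 2 - ‖b - y b‖ ^ 2 ≤ 10 * r * ‖a - b‖ := by
        have n1 := norm_nonneg (a - y b)
        have n2 := norm_nonneg (b - y b)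
        have n3 := norm_nonneg (a - b)
        have e1 : (‖a - y b‖ - ‖b - y b‖) * (‖a - y b‖ + ‖b - y b‖)
            ≤ ‖a - b‖ * (‖a - y b‖ + ‖b - y b‖) := mul_le_mul_of_nonneg_right h2 (by linarith)
        have e2 : ‖a - b‖ * (‖a - y b‖ + ‖b - y b‖) ≤ ‖a - b‖ * (10 * r) :=
          mul_le_mul_of_nonneg_left (by linarith) n3
        nlinarith
      have h4 : ‖a - y b‖ ^ 2 / ε - ‖b - y b‖ ^ 2 / ε ≤ 10 * r / ε * ‖a - b‖ := by
        rw [← sub_div, div_mul_eq_mul_div]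
        exact div_le_div_of_nonneg_right h3 hε0.le
      linarith
    filter_upwards [hball] with p hp
    rw [Real.norm_eq_abs, abs_le]
    have k1 := key p.1 hp.1 p.2 hp.2
    have k2 := key p.2 hp.2 p.1 hp.1
    rw [norm_sub_rev p.2 p.1] at k2
    constructor <;> linarith
  · intro z hz c ζ hζ0 hζ η hη
    have hyb : y z ∈ Metric.ball q (3 * r) := by
      have h1 := (hdist z hz).trans_le (min_le_right η₀ r)
      rw [← dist_eq_norm, dist_comm] at h1
      have h2 := Metric.mem_ball.1 hz
      rw [Metric.mem_ball]
      linarith [dist_triangle (y z) z q]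
    obtain ⟨σ, hσ0, hσ, hσf⟩ := hfY (y z) hyb c
    have hN : HasDerivAt (fun s => ‖ζ s - σ s‖ ^ 2)
        (2 * inner ℝ (ζ 0 - σ 0) (Y c z - Y c (y z))) 0 := (hζ.sub hσ).norm_sq
    rw [hζ0, hσ0] at hN
    have hin : 2 * inner ℝ (z - y z) (Y c z - Y c (y z)) ≤ ε * (δ * ‖c‖) := by
      have h1 := (real_inner_le_norm (z - y z) (Y c z - Y c (y z))).trans
        (mul_le_mul_of_nonneg_left (hY c z (h2S z hz) (y z) (hyS z)) (norm_nonneg _))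
      have h2 : ‖z - y z‖ ^ 2 ≤ δ' * ε := by
        have := (hpen z hz).trans (hosc z hz)
        rwa [div_le_iff₀ hε0] at this
      have h3 : K * ‖c‖ * ‖z - y z‖ ^ 2 ≤ K * ‖c‖ * (δ' * ε) :=
        mul_le_mul_of_nonneg_left h2 (by positivity)
      have h4 : 2 * K * δ' * (ε * ‖c‖) ≤ δ * (ε * ‖c‖) :=
        mul_le_mul_of_nonneg_right hδK (by positivity)
      nlinarith
    have hev := eventually_le_of_hasDerivAt hN
      (show _ < ε * (δ * ‖c‖) + ε * η by nlinarith [mul_pos hε0 hη])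
    have hσb : ∀ᶠ s in 𝓝[>] (0 : ℝ), σ s ∈ Metric.ball q (3 * r) :=
      (hσ.continuousAt.eventually (Metric.isOpen_ball.mem_nhds (hσ0 ▸ hyb))).filter_mono
        nhdsWithin_le_nhds
    filter_upwards [hev, hσf, hσb] with s hs1 hs2 hs3
    have h1 := hy (ζ s) (σ s) (Metric.ball_subset_closedBall hs3)
    rw [hζ0, hσ0] at hs1
    have h2 : ‖ζ s - σ s‖ ^ 2 / ε ≤ ‖z - y z‖ ^ 2 / ε + s * (δ * ‖c‖ + η) := by
      rw [div_le_iff₀ hε0, add_mul, div_mul_cancel₀ _ hε0.ne']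
      linarith
    linarith

end InfConvolution

/-! ### Local regularization -/

section LocalRegularization

variable {d m : ℕ} {M : Type*} [TopologicalSpace M] [ChartedSpace (EuclideanSpace ℝ (Fin d)) M]

/-- `f` is Lipschitz near `z`, in charts. -/
def IsLipschitzNear (d : ℕ) {M : Type*} [TopologicalSpace M]
    [ChartedSpace (EuclideanSpace ℝ (Fin d)) M] (f : M → ℝ) (z : M) : Prop :=
  ∀ e ∈ atlas (EuclideanSpace ℝ (Fin d)) M, z ∈ e.source →
    (fun p : EuclideanSpace ℝ (Fin d) × EuclideanSpace ℝ (Fin d) =>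
      f (e.symm p.1) - f (e.symm p.2)) =O[𝓝 (e z, e z)] fun p => p.1 - p.2

/-- Along curves through `z` with velocity `∑ ℓ, c ℓ • X ℓ z`, the upper right Dini derivative of
`f` is at most `κ ‖c‖`. -/
def DiniBound (X : Fin m → (x : M) → TangentSpace (𝓡 d) x) (κ : ℝ) (f : M → ℝ) (z : M) : Prop :=
  ∀ (c : EuclideanSpace ℝ (Fin m)) (γ : ℝ → M), γ 0 = z →
    HasVelocity γ 0 (horizontalField X c (γ 0)) → ∀ η > 0,
      ∀ᶠ s in 𝓝[>] (0 : ℝ), f (γ s) ≤ f z + s * (κ * ‖c‖ + η)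

variable {X : Fin m → (x : M) → TangentSpace (𝓡 d) x}

theorem DiniBound.mono {κ κ' : ℝ} {f : M → ℝ} {z : M} (h : DiniBound X κ f z) (hκ : κ ≤ κ') :
    DiniBound X κ' f z := fun c γ h0 hγ η hη => by
  filter_upwards [h c γ h0 hγ η hη, self_mem_nhdsWithin] with s hs hs0
  have : s * (κ * ‖c‖ + η) ≤ s * (κ' * ‖c‖ + η) := mul_le_mul_of_nonneg_left
    (by gcongr) (le_of_lt hs0)
  linarith

theorem DiniBound.max {κ : ℝ} {f g : M → ℝ} {z : M} (hf : DiniBound X κ f z)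
    (hg : DiniBound X κ g z) : DiniBound X κ (fun y => max (f y) (g y)) z :=
  fun c γ h0 hγ η hη => by
  filter_upwards [hf c γ h0 hγ η hη, hg c γ h0 hγ η hη] with s hs1 hs2
  refine max_le (hs1.trans ?_) (hs2.trans ?_)
  · gcongr; exact le_max_left _ _
  · gcongr; exact le_max_right _ _

theorem DiniBound.sub_const {κ : ℝ} {f : M → ℝ} {z : M} (hf : DiniBound X κ f z) (a : ℝ) :
    DiniBound X κ (fun y => f y - a) z := fun c γ h0 hγ η hη => by
  filter_upwards [hf c γ h0 hγ η hη] with s hs1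
  linarith

theorem diniBound_const {κ : ℝ} (hκ : 0 ≤ κ) (a : ℝ) (z : M) : DiniBound X κ (fun _ => a) z :=
  fun c γ _ _ η hη => by
  filter_upwards [self_mem_nhdsWithin] with s hs
  have : 0 < s := hs
  have : 0 ≤ s * (κ * ‖c‖ + η) := by positivity
  linarith

theorem DiniBound.const_mul {κ a : ℝ} {f : M → ℝ} {z : M} (hf : DiniBound X κ f z) (ha : 0 < a) :
    DiniBound X (a * κ) (fun y => a * f y) z := fun c γ h0 hγ η hη => by
  filter_upwards [hf c γ h0 hγ (η / a) (by positivity)] with s hs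
  calc a * f (γ s) ≤ a * (f z + s * (κ * ‖c‖ + η / a)) := by gcongr
    _ = _ := by field_simp

variable {f g : M → ℝ} {z : M}

theorem IsLipschitzNear.max (hf : IsLipschitzNear d f z) (hg : IsLipschitzNear d g z) :
    IsLipschitzNear d (fun y => max (f y) (g y)) z := fun e he hz => by
  refine (Asymptotics.IsBigO.of_bound 1 (Eventually.of_forall fun p => ?_)).trans
    ((hf e he hz).norm_left.add (hg e he hz).norm_left)
  rw [one_mul, Real.norm_eq_abs, Real.norm_eq_abs (_ + _)]
  refine (abs_max_sub_max_le_max _ _ _ _).trans (le_trans ?_ (le_abs_self _))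
  rw [Real.norm_eq_abs, Real.norm_eq_abs]
  exact max_le (le_add_of_nonneg_right (abs_nonneg _)) (le_add_of_nonneg_left (abs_nonneg _))

theorem IsLipschitzNear.sub_const (hf : IsLipschitzNear d f z) (a : ℝ) :
    IsLipschitzNear d (fun y => f y - a) z := fun e he hz => by
  simpa only [sub_sub_sub_cancel_right] using hf e he hz

theorem isLipschitzNear_const (a : ℝ) (z : M) : IsLipschitzNear d (fun _ => a) z :=
  fun e he hz => by
  simpa only [sub_self] using Asymptotics.isBigO_zero _ _

theorem IsLipschitzNear.const_mul (hf : IsLipschitzNear d f z) (a : ℝ) :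
    IsLipschitzNear d (fun y => a * f y) z := fun e he hz => by
  simpa only [mul_sub] using (hf e he hz).const_mul_left a

theorem IsLipschitzNear.add (hf : IsLipschitzNear d f z) (hg : IsLipschitzNear d g z) :
    IsLipschitzNear d (fun y => f y + g y) z := fun e he hz => by
  simpa only [add_sub_add_comm] using (hf e he hz).add (hg e he hz)

theorem isLipschitzNear_sum {ι : Type*} {F : ι → M → ℝ} (s : Finset ι)
    (h : ∀ i ∈ s, IsLipschitzNear d (F i) z) :
    IsLipschitzNear d (fun y => ∑ i ∈ s, F i y) z := by
  classical
  induction s using Finset.induction_on with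
  | empty => simpa using isLipschitzNear_const 0 z
  | insert a s ha ih =>
    simp only [Finset.sum_insert ha]
    exact (h a (Finset.mem_insert_self a s)).add
      (ih fun i hi => h i (Finset.mem_insert_of_mem hi))

theorem IsLipschitzNear.congr (hf : IsLipschitzNear d f z) (hfg : f =ᶠ[𝓝 z] g) :
    IsLipschitzNear d g z := fun e he hz => by
  have h1 : Tendsto e.symm (𝓝 (e z)) (𝓝 z) := by
    have := e.continuousAt_symm (e.map_source hz)
    rwa [ContinuousAt, e.left_inv hz] at this
  have h2 : ∀ᶠ p in 𝓝 (e z, e z), f (e.symm p.1) = g (e.symm p.1) ∧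
      f (e.symm p.2) = g (e.symm p.2) := by
    rw [nhds_prod_eq]
    exact ((h1.eventually hfg).prod_inl _).and ((h1.eventually hfg).prod_inr _)
  refine (hf e he hz).congr' ?_ EventuallyEq.rfl
  filter_upwards [h2] with p hp
  rw [hp.1, hp.2]

theorem IsLipschitzNear.continuousAt (hf : IsLipschitzNear d f z)
    {e : OpenPartialHomeomorph M (EuclideanSpace ℝ (Fin d))}
    (he : e ∈ atlas (EuclideanSpace ℝ (Fin d)) M) (hz : z ∈ e.source) :
    ContinuousAt (fun u => f (e.symm u)) (e z) := by
  have h1 := (hf e he hz).comp_tendsto (k := fun u => (u, e z)) (l' := 𝓝 (e z))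
    ((Continuous.prodMk_left (e z)).tendsto (e z))
  have h2 : Tendsto (fun u => u - e z) (𝓝 (e z)) (𝓝 0) := by
    have : Continuous fun u : EuclideanSpace ℝ (Fin d) => u - e z := by fun_prop
    simpa using this.tendsto (e z)
  exact tendsto_sub_nhds_zero_iff.1 (h1.trans_tendsto h2)

theorem IsLipschitzNear.mul (hf : IsLipschitzNear d f z) (hg : IsLipschitzNear d g z) :
    IsLipschitzNear d (fun y => f y * g y) z := fun e he hz => by
  have hf1 : (fun p : EuclideanSpace ℝ (Fin d) × EuclideanSpace ℝ (Fin d) => f (e.symm p.1))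
      =O[𝓝 (e z, e z)] fun _ => (1 : ℝ) :=
    Tendsto.isBigO_one ℝ (ContinuousAt.comp (g := fun u => f (e.symm u)) (f := Prod.fst)
        (x := (e z, e z)) (hf.continuousAt he hz) continuousAt_fst)
  have hg1 : (fun p : EuclideanSpace ℝ (Fin d) × EuclideanSpace ℝ (Fin d) => g (e.symm p.2))
      =O[𝓝 (e z, e z)] fun _ => (1 : ℝ) :=
    Tendsto.isBigO_one ℝ (ContinuousAt.comp (g := fun u => g (e.symm u)) (f := Prod.snd)
        (x := (e z, e z)) (hg.continuousAt he hz) continuousAt_snd)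
  have h1 := hf1.mul (hg e he hz).norm_right
  have h2 := (hf e he hz).norm_right.mul hg1
  simp only [one_mul, mul_one] at h1 h2
  exact ((h1.add h2).of_norm_right).congr_left fun p => by ring

theorem isLocallyLipschitz_of_forall (h : ∀ z, IsLipschitzNear d f z) : IsLocallyLipschitz d f := by
  intro e he u hu
  have h1 := h (e.symm u) e he (e.map_target hu)
  rw [e.right_inv hu] at h1
  obtain ⟨C, hC⟩ := h1.bound
  rw [nhds_prod_eq] at hC
  obtain ⟨t, ht, hC⟩ := mem_prod_same_iff.1 hC
  refine ⟨C.toNNReal, t, mem_nhdsWithin_of_mem_nhds ht, LipschitzOnWith.of_dist_le_mul ?_⟩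
  intro a ha b hb
  have := hC (mk_mem_prod ha hb)
  rw [dist_eq_norm, dist_eq_norm]
  refine this.trans (mul_le_mul_of_nonneg_right (Real.le_coe_toNNReal C) (norm_nonneg _))

variable [IsManifold (𝓡 d) ∞ M]

theorem isLipschitzNear_of_chart {e : OpenPartialHomeomorph M (EuclideanSpace ℝ (Fin d))}
    (he : e ∈ atlas (EuclideanSpace ℝ (Fin d)) M) (hz : z ∈ e.source)
    (h : (fun p : EuclideanSpace ℝ (Fin d) × EuclideanSpace ℝ (Fin d) =>
      f (e.symm p.1) - f (e.symm p.2)) =O[𝓝 (e z, e z)] fun p => p.1 - p.2) :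
    IsLipschitzNear d f z := by
  intro e' he' hz'
  set τ : EuclideanSpace ℝ (Fin d) → EuclideanSpace ℝ (Fin d) := fun u => e (e'.symm u) with hτ
  have hu : e' z ∈ e'.target := e'.map_source hz'
  have hτz : τ (e' z) = e z := by rw [hτ]; simp only [e'.left_inv hz']
  have hτ1 : ContMDiffAt (𝓡 d) (𝓡 d) ∞ τ (e' z) :=
    ContMDiffAt.comp (I' := 𝓡 d) (e' z)
      (contMDiffAt_of_mem_atlas he (by rw [e'.left_inv hz']; exact hz))
      (contMDiffAt_symm_of_mem_atlas he' hu)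
  have hτs : HasStrictFDerivAt τ (fderiv ℝ τ (e' z)) (e' z) :=
    hτ1.contDiffAt.hasStrictFDerivAt (by simp)
  have hτc : Tendsto (fun p : EuclideanSpace ℝ (Fin d) × EuclideanSpace ℝ (Fin d) =>
      (τ p.1, τ p.2)) (𝓝 (e' z, e' z)) (𝓝 (e z, e z)) := by
    have h1 : ContinuousAt τ (e' z) := hτs.hasFDerivAt.continuousAt
    have h2 : Tendsto τ (𝓝 (e' z)) (𝓝 (e z)) := by rw [← hτz]; exact h1
    rw [nhds_prod_eq, nhds_prod_eq]
    exact h2.prodMap h2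
  have h1 := (h.comp_tendsto hτc).trans hτs.isBigO_sub
  have hsrc : ∀ᶠ u in 𝓝 (e' z), e.symm (τ u) = e'.symm u := by
    have hc : Tendsto e'.symm (𝓝 (e' z)) (𝓝 z) := by
      have := e'.continuousAt_symm hu
      rwa [ContinuousAt, e'.left_inv hz'] at this
    filter_upwards [hc (e.open_source.mem_nhds hz)] with u hu'
    exact e.left_inv hu'
  refine h1.congr' ?_ EventuallyEq.rfl
  have h2 : ∀ᶠ p in 𝓝 (e' z, e' z), e.symm (τ p.1) = e'.symm p.1 ∧
      e.symm (τ p.2) = e'.symm p.2 := by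
    rw [nhds_prod_eq]
    exact (hsrc.prod_inl _).and (hsrc.prod_inr _)
  filter_upwards [h2] with p hp
  simp only [Function.comp_apply]
  rw [hp.1, hp.2]

theorem isLipschitzNear_of_contMDiff {χ : M → ℝ} (hχ : ContMDiff (𝓡 d) 𝓘(ℝ, ℝ) ∞ χ) (z : M) :
    IsLipschitzNear d χ z := fun e he hz => by
  have h : ContMDiffAt (𝓡 d) 𝓘(ℝ, ℝ) ∞ (fun u => χ (e.symm u)) (e z) :=
    hχ.contMDiffAt.comp (e z) (contMDiffAt_symm_of_mem_atlas he (e.map_source hz))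
  exact (h.contDiffAt.hasStrictFDerivAt (by simp)).isBigO_sub

theorem norm_sum_smul_le {F : Type*} [NormedAddCommGroup F] [NormedSpace ℝ F]
    (c : EuclideanSpace ℝ (Fin m)) (v : Fin m → F) {K : Fin m → ℝ} (h : ∀ ℓ, ‖v ℓ‖ ≤ K ℓ) :
    ‖∑ ℓ, c ℓ • v ℓ‖ ≤ ‖c‖ * ∑ ℓ, K ℓ := by
  rw [Finset.mul_sum]
  refine norm_sum_le_of_le _ fun ℓ _ => ?_
  rw [norm_smul]
  exact mul_le_mul (PiLp.norm_apply_le c ℓ) (h ℓ) (norm_nonneg _) (norm_nonneg _)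

/-- Every point has a neighbourhood `V` on which functions that are `1`-Lipschitz for the
Carnot–Carathéodory distance can be regularized, and on which smooth functions have bounded
derivatives in the directions `X ℓ`. -/
theorem exists_local_regularization (hX : IsSubRiemannianStructure X) (q : M) :
    ∃ V : Set M, IsOpen V ∧ q ∈ V ∧
      (∀ w : M → ℝ, (∀ x y, w y - w x ≤ ccDist X x y) → ∀ δ > 0, ∃ h : M → ℝ,
        ∀ z ∈ V, |h z - w z| ≤ δ ∧ IsLipschitzNear d h z ∧ DiniBound X (1 + δ) h z) ∧
      ∀ χ : M → ℝ, ContMDiff (𝓡 d) 𝓘(ℝ, ℝ) ∞ χ → ∃ C ≥ 0, ∀ z ∈ V,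
        ∀ (c : EuclideanSpace ℝ (Fin m)) (γ : ℝ → M), γ 0 = z →
        HasVelocity γ 0 (horizontalField X c (γ 0)) → ∀ η > 0,
          ∀ᶠ s in 𝓝[>] (0 : ℝ), |χ (γ s) - χ z| ≤ s * (C * ‖c‖ + η) := by
  set e := chartAt (EuclideanSpace ℝ (Fin d)) q with he'
  have he : e ∈ atlas (EuclideanSpace ℝ (Fin d)) M := chart_mem_atlas _ q
  have hq : q ∈ e.source := mem_chart_source _ q
  obtain ⟨R, hR, hRt⟩ := Metric.nhds_basis_closedBall.mem_iff.1
    (e.open_target.mem_nhds (e.map_source hq))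
  obtain ⟨r, hr, rfl⟩ : ∃ r > 0, R = 3 * r := ⟨R / 3, by positivity, by ring⟩
  set V : Set M := e.source ∩ e ⁻¹' Metric.ball (e q) (2 * r) with hV
  have hYs : ∀ ℓ, ContDiffOn ℝ ∞ (coordField e (X ℓ)) e.target := fun ℓ =>
    contDiffOn_coordField he (hX.smooth ℓ)
  have hcurve : ∀ {z : M} {c : EuclideanSpace ℝ (Fin m)} {γ : ℝ → M}, z ∈ e.source → γ 0 = z →
      HasVelocity γ 0 (horizontalField X c (γ 0)) →
      HasDerivAt (fun s => e (γ s)) (coordField e (horizontalField X c) (e z)) 0 := by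
    intro z c γ hz h0 hγ
    have hz' : γ 0 ∈ e.source := h0 ▸ hz
    rw [← h0, coordField_apply hz']
    exact hγ.hasDerivAt_chart he hz'
  refine ⟨V, e.isOpen_inter_preimage Metric.isOpen_ball, ⟨hq, Metric.mem_ball_self (by positivity)⟩,
    ?_, ?_⟩
  · intro w hw δ hδ
    have hwc : Continuous w := continuous_of_sub_le_ccDist hX hw
    have hlip : ∀ ℓ, ∃ K, LipschitzOnWith K (coordField e (X ℓ)) (Metric.closedBall (e q) (3 * r)) :=
      fun ℓ => (((hYs ℓ).mono hRt).of_le (by simp)).exists_lipschitzOnWith (n := 1) (by simp)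
        (convex_closedBall _ _) (isCompact_closedBall _ _)
    choose K hK using hlip
    obtain ⟨h, h1, h2, h3⟩ := exists_infConvolution (f := fun u => w (e.symm u))
      (Y := fun c => coordField e (horizontalField X c)) (q := e q) hr
      (K := ∑ ℓ, (K ℓ : ℝ)) (by positivity)
      (hwc.comp_continuousOn (e.continuousOn_symm.mono hRt))
      (fun c x hx y hy => by
        rw [coordField_horizontalField, coordField_horizontalField, ← Finset.sum_sub_distrib]
        simp only [← smul_sub]
        refine (norm_sum_smul_le c _ (K := fun ℓ => K ℓ * ‖x - y‖) fun ℓ => ?_).trans_eq ?_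
        · have := (hK ℓ).dist_le_mul x hx y hy
          rwa [dist_eq_norm, dist_eq_norm] at this
        · rw [← Finset.sum_mul]; ring)
      (fun y hy c => by
        have hyt : y ∈ e.target := hRt (Metric.ball_subset_closedBall hy)
        have hYc : ContDiffOn ℝ ∞ (coordField e (horizontalField X c)) e.target := by
          have : coordField e (horizontalField X c) = fun u => ∑ ℓ, c ℓ • coordField e (X ℓ) u :=
            funext fun u => coordField_horizontalField X c e u
          rw [this]
          exact ContDiffOn.sum fun ℓ _ => ContDiffOn.const_smul _ (hYs ℓ)
        obtain ⟨ψ, -, hψ, hψ0⟩ := exists_contDiffAt_flow e.open_target hYc hyt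
        refine ⟨fun s => ψ (y, s), hψ0.self_of_nhds.1, hψ0.self_of_nhds.2, ?_⟩
        have hc : Tendsto (fun s : ℝ => (y, s)) (𝓝[>] 0) (𝓝 (y, 0)) :=
          ((Continuous.prodMk_right y).tendsto 0).mono_left nhdsWithin_le_nhds
        filter_upwards [hc.eventually hψ, self_mem_nhdsWithin] with s hs hs0
        obtain ⟨u, hu0, hu1, hu⟩ := hs
        have hreach := reach_of_integralCurve hX.smooth he (s • c) (f := u)
          (fun t ht => (hu t ht).1) (fun t ht => by
            have h := (hu t ht).2
            have hsm : s • coordField e (horizontalField X c) (u t)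
                = coordField e (horizontalField X (s • c)) (u t) := by
              rw [coordField_horizontalField, coordField_horizontalField, Finset.smul_sum]
              exact Finset.sum_congr rfl fun ℓ _ => by simp [mul_smul]
            rw [← hsm]; exact h)
        rw [hu0, hu1, norm_smul, Real.norm_eq_abs, abs_of_pos hs0] at hreach
        have := (hw _ _).trans hreach.ccDist_le
        linarith) hδ
    refine ⟨fun z => h (e z), fun z hz => ⟨?_, ?_, ?_⟩⟩
    · have := h1 (e z) hz.2
      rwa [e.left_inv hz.1] at this
    · refine isLipschitzNear_of_chart he hz.1 ((h2 (e z) hz.2).congr' ?_ EventuallyEq.rfl)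
      have ht : ∀ᶠ u in 𝓝 (e z), e (e.symm u) = u := by
        filter_upwards [e.open_target.mem_nhds (e.map_source hz.1)] with u hu
        exact e.right_inv hu
      rw [nhds_prod_eq]
      filter_upwards [(ht.prod_inl (𝓝 (e z))).and (ht.prod_inr (𝓝 (e z)))] with p hp
      rw [hp.1, hp.2]
    · intro c γ h0 hγ η hη
      have := h3 (e z) hz.2 c (fun s => e (γ s)) (by simp only [h0]) (hcurve hz.1 h0 hγ) η hη
      exact this
  · intro χ hχ
    set g : EuclideanSpace ℝ (Fin d) → ℝ := fun u => χ (e.symm u) with hg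
    have hgd : ContDiffOn ℝ ∞ g e.target := fun u hu => by
      have h : ContMDiffAt (𝓡 d) 𝓘(ℝ, ℝ) ∞ g u :=
        hχ.contMDiffAt.comp u (contMDiffAt_symm_of_mem_atlas he hu)
      exact h.contDiffAt.contDiffWithinAt
    have hbd : ∀ ℓ, ∃ C, ∀ u ∈ Metric.closedBall (e q) (3 * r),
        ‖fderiv ℝ g u (coordField e (X ℓ) u)‖ ≤ C := fun ℓ =>
      (isCompact_closedBall _ _).exists_bound_of_continuousOn
        (((hgd.continuousOn_fderiv_of_isOpen e.open_target (by simp)).clm_apply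
          (hYs ℓ).continuousOn).mono hRt)
    choose C hC using hbd
    refine ⟨max 0 (∑ ℓ, C ℓ), le_max_left _ _, fun z hz c γ h0 hγ η hη => ?_⟩
    have hzS : e z ∈ Metric.closedBall (e q) (3 * r) :=
      (Metric.ball_subset_closedBall.trans (Metric.closedBall_subset_closedBall (by linarith))) hz.2
    have hd := hcurve hz.1 h0 hγ
    have hgz : HasFDerivAt g (fderiv ℝ g (e (γ 0))) (e (γ 0)) := by
      rw [h0]
      exact ((hgd.contDiffAt (e.open_target.mem_nhds (hRt hzS))).differentiableAt
        (by simp)).hasFDerivAt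
    have hcomp : HasDerivAt (fun s => g (e (γ s)))
        (fderiv ℝ g (e (γ 0)) (coordField e (horizontalField X c) (e z))) 0 :=
      HasFDerivAt.comp_hasDerivAt (l := g) (f := fun s => e (γ s)) (0 : ℝ) hgz hd
    have hle : |fderiv ℝ g (e (γ 0)) (coordField e (horizontalField X c) (e z))|
        < max 0 (∑ ℓ, C ℓ) * ‖c‖ + η := by
      rw [h0, coordField_horizontalField, map_sum]
      simp only [map_smul]
      have h1 := norm_sum_smul_le c (fun ℓ => fderiv ℝ g (e z) (coordField e (X ℓ) (e z)))
        fun ℓ => hC ℓ (e z) hzS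
      have h2 : ‖c‖ * ∑ ℓ, C ℓ ≤ max 0 (∑ ℓ, C ℓ) * ‖c‖ := by
        rw [mul_comm]
        exact mul_le_mul_of_nonneg_right (le_max_right _ _) (norm_nonneg _)
      exact (h1.trans h2).trans_lt (lt_add_of_pos_right _ hη)
    rw [abs_lt] at hle
    have hγs : ∀ᶠ s in 𝓝[>] (0 : ℝ), γ s ∈ e.source := by
      have hc : ContinuousAt γ 0 := hγ.continuousAt
      exact (hc.eventually (e.open_source.mem_nhds (h0 ▸ hz.1))).filter_mono nhdsWithin_le_nhds
    filter_upwards [eventually_le_of_hasDerivAt hcomp hle.2,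
      eventually_le_of_hasDerivAt hcomp.neg (neg_lt.1 hle.1), hγs] with s hs1 hs2 hs3
    simp only [hg, e.left_inv hs3, h0, e.left_inv hz.1, Pi.neg_apply] at hs1 hs2
    rw [abs_le]
    constructor <;> linarith

end LocalRegularization

/-! ### Regularization on the manifold -/

section Regularization

variable {d m : ℕ} {M : Type*} [TopologicalSpace M] [ChartedSpace (EuclideanSpace ℝ (Fin d)) M]
  {X : Fin m → (x : M) → TangentSpace (𝓡 d) x}

theorem ae_differentiableAt_of_isLocallyLipschitz {w : M → ℝ} (hw : IsLocallyLipschitz d w)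
    {e : OpenPartialHomeomorph M (EuclideanSpace ℝ (Fin d))}
    (he : e ∈ atlas (EuclideanSpace ℝ (Fin d)) M) :
    ∀ᵐ u, u ∈ e.target → DifferentiableAt ℝ (fun u => w (e.symm u)) u := by
  rw [ae_iff]
  refine measure_null_of_locally_null _ fun u hu => ?_
  simp only [mem_ofPred_eq, Classical.not_imp] at hu
  obtain ⟨K, t, ht, hK⟩ := hw e he hu.1
  rw [e.open_target.nhdsWithin_eq hu.1] at ht
  refine ⟨{u | ¬(u ∈ e.target → DifferentiableAt ℝ (fun u => w (e.symm u)) u)} ∩ interior t,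
    inter_mem self_mem_nhdsWithin (mem_nhdsWithin_of_mem_nhds (interior_mem_nhds.2 ht)), ?_⟩
  have h1 := (hK.mono interior_subset).ae_differentiableWithinAt_of_mem (μ := volume)
  rw [ae_iff] at h1
  refine measure_mono_null ?_ h1
  rintro v ⟨hv1, hv2⟩ hv
  exact hv1 fun _ => (hv hv2).differentiableAt (isOpen_interior.mem_nhds hv2)

variable [IsManifold (𝓡 d) ∞ M]

/-- Functions which are `1`-Lipschitz for the Carnot–Carathéodory distance are uniformly
approximated by locally Lipschitz functions with almost the same bound on the derivatives in the
horizontal directions. The local regularizations are glued by a smooth partition of unity `ρ`;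
since `∑ ρ = 1`, the derivatives of `ρ` only meet the errors of the local regularizations, which
are chosen small compared to these derivatives. -/
theorem exists_regularization [T2Space M] [SecondCountableTopology M]
    (hX : IsSubRiemannianStructure X) {w : M → ℝ} (hw : ∀ x y, w y - w x ≤ ccDist X x y) {δ : ℝ}
    (hδ : 0 < δ) :
    ∃ w' : M → ℝ, (∀ z, |w' z - w z| ≤ δ) ∧ (∀ z, IsLipschitzNear d w' z) ∧
      ∀ z, DiniBound X (1 + δ) w' z := by
  classical
  rcases isEmpty_or_nonempty M with hM | hM
  · exact ⟨w, fun z => (hM.false z).elim, fun z => (hM.false z).elim, fun z => (hM.false z).elim⟩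
  have := ChartedSpace.locallyCompactSpace (EuclideanSpace ℝ (Fin d)) M
  have := sigmaCompactSpace_of_locallyCompact_secondCountable (X := M)
  choose V hVo hVm hVreg hVχ using exists_local_regularization hX
  obtain ⟨s, hsc, hs⟩ := TopologicalSpace.countable_cover_nhds (fun x => (hVo x).mem_nhds (hVm x))
  have hsne : s.Nonempty := by
    rcases s.eq_empty_or_nonempty with rfl | h
    · simp only [mem_empty_iff_false, iUnion_of_empty, iUnion_empty] at hs
      exact (hs ▸ mem_univ (Classical.arbitrary M) : Classical.arbitrary M ∈ (∅ : Set M)).elim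
    · exact h
  obtain ⟨x, hx⟩ := hsc.exists_eq_range hsne
  have hcov : univ ⊆ ⋃ n, V (x n) := by
    rw [← hs, hx]; simp
  obtain ⟨ρ, hρ⟩ := SmoothPartitionOfUnity.exists_isSubordinate (𝓡 d) isClosed_univ
    (fun n => V (x n)) (fun n => hVo _) hcov
  choose C hC0 hC using fun n => hVχ (x n) (ρ n) (ρ n).contMDiff
  obtain ⟨ε, hε0, hε⟩ := (countable_univ (α := ℕ)).exists_pos_forall_sum_le (half_pos hδ)
  have hε' : ∀ t : Finset ℕ, ∑ n ∈ t, ε n ≤ δ / 2 := fun t => hε t (subset_univ _)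
  set δ' : ℕ → ℝ := fun n => ε n / (C n + 1) with hδ'
  have hδ'0 : ∀ n, 0 < δ' n := fun n => div_pos (hε0 n) (by linarith [hC0 n])
  have hδ'C : ∀ n, δ' n * C n + δ' n = ε n := fun n => by
    have : C n + 1 ≠ 0 := by linarith [hC0 n]
    rw [hδ']; field_simp
  have hδ'ε : ∀ n, δ' n ≤ ε n := fun n => by
    have := mul_nonneg (hδ'0 n).le (hC0 n)
    linarith [hδ'C n]
  have hεδ : ∀ n, ε n ≤ δ / 2 := fun n => by simpa using hε' {n}
  choose h hh using fun n => hVreg (x n) w hw (δ' n) (hδ'0 n)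
  set w' : M → ℝ := fun y => ∑ᶠ n, ρ n y • h n y with hw'
  have hFV : ∀ z, ∀ n ∈ ρ.fintsupport z, z ∈ V (x n) := fun z n hn =>
    hρ n ((ρ.mem_fintsupport_iff z n).1 hn)
  have hsum : ∀ z, ∀ᶠ y in 𝓝 z, ∑ n ∈ ρ.fintsupport z, ρ n y = 1 ∧
      w' y = ∑ n ∈ ρ.fintsupport z, ρ n y * h n y := by
    intro z
    filter_upwards [ρ.eventually_finsupport_subset z] with y hy
    refine ⟨ρ.sum_finsupport' y (mem_univ y) hy, ?_⟩
    rw [hw']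
    simp only
    rw [← ρ.sum_finsupport_smul_eq_finsum y h]
    refine Finset.sum_subset hy fun n _ hn => ?_
    have : ρ n y = 0 := by
      rw [ρ.mem_finsupport y] at hn
      exact Function.notMem_support.1 hn
    simp [this]
  refine ⟨w', fun z => ?_, fun z => ?_, fun z => ?_⟩
  · obtain ⟨h1, h2⟩ := (hsum z).self_of_nhds
    have h3 : w' z - w z = ∑ n ∈ ρ.fintsupport z, ρ n z * (h n z - w z) := by
      simp only [mul_sub, Finset.sum_sub_distrib]
      rw [h2, ← Finset.sum_mul, h1, one_mul]
    rw [h3]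
    calc |∑ n ∈ ρ.fintsupport z, ρ n z * (h n z - w z)|
        ≤ ∑ n ∈ ρ.fintsupport z, ρ n z * δ := by
          refine (Finset.abs_sum_le_sum_abs _ _).trans (Finset.sum_le_sum fun n hn => ?_)
          rw [abs_mul, abs_of_nonneg (ρ.nonneg n z)]
          refine mul_le_mul_of_nonneg_left ?_ (ρ.nonneg n z)
          linarith [(hh n z (hFV z n hn)).1, hδ'ε n, hεδ n]
      _ = δ := by rw [← Finset.sum_mul, h1, one_mul]
  · refine IsLipschitzNear.congr (f := fun y => ∑ n ∈ ρ.fintsupport z, ρ n y * h n y) ?_ ?_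
    · exact isLipschitzNear_sum _ fun n hn =>
        (isLipschitzNear_of_contMDiff (ρ n).contMDiff z).mul (hh n z (hFV z n hn)).2.1
    · filter_upwards [hsum z] with y hy using hy.2.symm
  · intro c γ h0 hγ η hη
    have hγc : Tendsto γ (𝓝[>] (0 : ℝ)) (𝓝 z) := by
      have hc : ContinuousAt γ 0 := hγ.continuousAt
      rw [ContinuousAt, h0] at hc
      exact hc.mono_left nhdsWithin_le_nhds
    set F := ρ.fintsupport z with hF
    have hD : ∀ᶠ s in 𝓝[>] (0 : ℝ), ∀ n ∈ F,
        h n (γ s) ≤ h n z + s * ((1 + δ / 2) * ‖c‖ + η / 2) := by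
      rw [Filter.eventually_all_finset]
      intro n hn
      exact ((hh n z (hFV z n hn)).2.2.mono (by linarith [hδ'ε n, hεδ n])) c γ h0 hγ (η / 2)
        (half_pos hη)
    have hχ : ∀ᶠ s in 𝓝[>] (0 : ℝ), ∀ n ∈ F, |ρ n (γ s) - ρ n z| ≤ s * (C n * ‖c‖ + η / δ) := by
      rw [Filter.eventually_all_finset]
      intro n hn
      exact hC n z (hFV z n hn) c γ h0 hγ (η / δ) (by positivity)
    have hV : ∀ᶠ s in 𝓝[>] (0 : ℝ), ∀ n ∈ F, γ s ∈ V (x n) := by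
      rw [Filter.eventually_all_finset]
      intro n hn
      exact hγc ((hVo _).mem_nhds (hFV z n hn))
    filter_upwards [hD, hχ, hV, hγc.eventually (hsum z), self_mem_nhdsWithin] with s hs1 hs2 hs3 hs4
      hs0
    have hs0' : 0 < s := hs0
    obtain ⟨h1, h2⟩ := (hsum z).self_of_nhds
    have hterm : ∀ n ∈ F, ρ n (γ s) * h n (γ s) - ρ n z * h n z - w (γ s) * (ρ n (γ s) - ρ n z)
        ≤ ρ n z * (s * ((1 + δ / 2) * ‖c‖ + η / 2)) + ε n * (s * (‖c‖ + η / δ)) := by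
      intro n hn
      have e1 : ρ n z * (h n (γ s) - h n z) ≤ ρ n z * (s * ((1 + δ / 2) * ‖c‖ + η / 2)) :=
        mul_le_mul_of_nonneg_left (by linarith [hs1 n hn]) (ρ.nonneg n z)
      have e2 : (ρ n (γ s) - ρ n z) * (h n (γ s) - w (γ s))
          ≤ s * (C n * ‖c‖ + η / δ) * δ' n := by
        refine (le_abs_self _).trans ?_
        rw [abs_mul]
        exact mul_le_mul (hs2 n hn) (hh n (γ s) (hs3 n hn)).1 (abs_nonneg _)
          (by have := hC0 n; positivity)
      have e3 : s * (C n * ‖c‖ + η / δ) * δ' n ≤ ε n * (s * (‖c‖ + η / δ)) := by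
        have e4 : C n * δ' n ≤ ε n := by linarith [hδ'C n, (hδ'0 n).le]
        have e5 : C n * δ' n * (s * ‖c‖) ≤ ε n * (s * ‖c‖) :=
          mul_le_mul_of_nonneg_right e4 (by positivity)
        have e6 : δ' n * (s * (η / δ)) ≤ ε n * (s * (η / δ)) :=
          mul_le_mul_of_nonneg_right (hδ'ε n) (by positivity)
        nlinarith
      nlinarith
    have htot := Finset.sum_le_sum hterm
    rw [Finset.sum_add_distrib, Finset.sum_sub_distrib, Finset.sum_sub_distrib, ← Finset.sum_mul,
      ← Finset.sum_mul, ← Finset.mul_sum, Finset.sum_sub_distrib, hs4.1, h1, ← hs4.2, ← h2,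
      sub_self, mul_zero, sub_zero, one_mul] at htot
    have hlast : (∑ n ∈ F, ε n) * (s * (‖c‖ + η / δ)) ≤ δ / 2 * (s * (‖c‖ + η / δ)) :=
      mul_le_mul_of_nonneg_right (hε' F) (by positivity)
    have hfin : δ / 2 * (s * (‖c‖ + η / δ)) = s * (δ / 2 * ‖c‖ + η / 2) := by
      field_simp
    rw [hfin] at hlast
    linarith

theorem le_of_hasDerivAt_of_eventually_le {g : ℝ → ℝ} {a b : ℝ} (hg : HasDerivAt g a 0)
    (h : ∀ᶠ s in 𝓝[>] (0 : ℝ), g s ≤ g 0 + s * b) : a ≤ b := by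
  have h1 := (hasDerivAt_iff_tendsto_slope.1 hg).mono_left
    (nhdsWithin_mono (0 : ℝ) (fun s (hs : s ∈ Ioi (0 : ℝ)) => ne_of_gt hs))
  refine le_of_tendsto h1 ?_
  filter_upwards [h, self_mem_nhdsWithin] with s hs hs0
  have hs0' : 0 < s := hs0
  rw [slope_def_field, sub_zero, div_le_iff₀ hs0']
  linarith

/-- A locally Lipschitz function whose Dini derivatives in the horizontal directions are at most
`1` is in the class `𝓕`: where `w` is differentiable, test with the coefficients
`c ℓ = dw (X ℓ)`. -/
theorem mem_subunitFunctions {w : M → ℝ} (hL : ∀ z, IsLipschitzNear d w z)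
    (hD : ∀ z, DiniBound X 1 w z) : w ∈ subunitFunctions X := by
  have hLL := isLocallyLipschitz_of_forall hL
  refine ⟨hLL, fun e he => ?_⟩
  rw [ae_restrict_iff' e.open_target.measurableSet]
  filter_upwards [ae_differentiableAt_of_isLocallyLipschitz hLL he] with u hu hut
  have hd := hu hut
  set f : EuclideanSpace ℝ (Fin d) → ℝ := fun u => w (e.symm u) with hf
  set c : EuclideanSpace ℝ (Fin m) :=
    WithLp.toLp 2 fun ℓ => fderiv ℝ f u (coordField e (X ℓ) u) with hc
  have hcℓ : ∀ ℓ, c ℓ = fderiv ℝ f u (coordField e (X ℓ) u) := fun ℓ => rfl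
  set v := coordField e (horizontalField X c) u with hv
  have hfv : fderiv ℝ f u v = ‖c‖ ^ 2 := by
    rw [hv, coordField_horizontalField, map_sum, EuclideanSpace.norm_sq_eq]
    refine Finset.sum_congr rfl fun ℓ _ => ?_
    rw [map_smul, smul_eq_mul, ← hcℓ, Real.norm_eq_abs, sq_abs, sq]
  have hline : HasDerivAt (fun s : ℝ => u + s • v) v 0 := by
    simpa using ((hasDerivAt_id (0 : ℝ)).smul_const v).const_add u
  have h0 : u + (0 : ℝ) • v = u := by simp
  have hvel : HasVelocity (fun s : ℝ => e.symm (u + s • v)) 0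
      (horizontalField X c (e.symm (u + (0 : ℝ) • v))) := by
    have hut0 : u + (0 : ℝ) • v ∈ e.target := h0.symm ▸ hut
    refine (hasVelocity_symm_comp he hline hut0).congr_mfderiv ?_
    congr 1
    have hv0 : v = coordField e (horizontalField X c) (u + (0 : ℝ) • v) := by rw [h0]
    exact (congrArg _ hv0).trans (mfderiv_symm_coordField he (horizontalField X c) hut0)
  have hder : HasDerivAt (fun s : ℝ => f (u + s • v)) (‖c‖ ^ 2) 0 := by
    rw [← hfv]
    have hd' : HasFDerivAt f (fderiv ℝ f u) (u + (0 : ℝ) • v) := h0.symm ▸ hd.hasFDerivAt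
    exact HasFDerivAt.comp_hasDerivAt (l := f) (f := fun s : ℝ => u + s • v) (0 : ℝ) hd' hline
  have hle : ‖c‖ ^ 2 ≤ ‖c‖ := by
    refine le_of_forall_pos_le_add fun η hη => ?_
    refine le_of_hasDerivAt_of_eventually_le hder ?_
    have := hD (e.symm u) c (fun s : ℝ => e.symm (u + s • v)) (by rw [h0]) hvel η hη
    filter_upwards [this] with s hs
    rw [h0]
    simpa using hs
  have hc1 : ‖c‖ ^ 2 ≤ 1 := by
    have := norm_nonneg c
    nlinarith
  refine le_trans (le_of_eq ?_) hc1
  rw [EuclideanSpace.norm_sq_eq]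
  refine Finset.sum_congr rfl fun ℓ _ => ?_
  have := mvfderiv_eq_fderiv_chart he hut hd (X ℓ)
  rw [Real.norm_eq_abs, sq_abs, hcℓ, sq]
  exact congrArg₂ (· * ·) this this

end Regularization

/-! ### Lipschitz functions along absolutely continuous curves -/

section CurvesInEuclideanSpace

theorem absolutelyContinuousOnInterval_comp_lipschitz {E F : Type*} [PseudoMetricSpace E]
    [PseudoMetricSpace F] {f : E → F} {K : NNReal} {B : Set E} (hf : LipschitzOnWith K f B)
    {Γ : ℝ → E} {s t : ℝ} (hΓ : AbsolutelyContinuousOnInterval Γ s t)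
    (hB : ∀ τ ∈ uIcc s t, Γ τ ∈ B) : AbsolutelyContinuousOnInterval (fun τ => f (Γ τ)) s t := by
  rw [absolutelyContinuousOnInterval_iff] at hΓ ⊢
  intro ε hε
  obtain ⟨δ, hδ, h⟩ := hΓ (ε / (K + 1)) (by positivity)
  refine ⟨δ, hδ, fun I hI hIδ => ?_⟩
  have h1 := h I hI hIδ
  rw [lt_div_iff₀ (by positivity)] at h1
  have h2 : ∑ i ∈ Finset.range I.1, dist (f (Γ (I.2 i).1)) (f (Γ (I.2 i).2)) ≤
      K * ∑ i ∈ Finset.range I.1, dist (Γ (I.2 i).1) (Γ (I.2 i).2) := by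
    rw [Finset.mul_sum]
    exact Finset.sum_le_sum fun i hi =>
      hf.dist_le_mul _ (hB _ (hI.1 i hi).1) _ (hB _ (hI.1 i hi).2)
  have h3 : 0 ≤ ∑ i ∈ Finset.range I.1, dist (Γ (I.2 i).1) (Γ (I.2 i).2) :=
    Finset.sum_nonneg fun _ _ => dist_nonneg
  linarith

variable {d m : ℕ}

/-- Almost every translate of a curve avoids a given null set at almost all times. -/
theorem frequently_ae_add_notMem {Γ : ℝ → EuclideanSpace ℝ (Fin d)} (hΓ : Continuous Γ)
    {N : Set (EuclideanSpace ℝ (Fin d))} (hN : volume N = 0) :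
    ∃ᶠ h in 𝓝 (0 : EuclideanSpace ℝ (Fin d)), ∀ᵐ τ : ℝ, Γ τ + h ∉ N := by
  set N' := toMeasurable volume N
  have hN' : volume N' = 0 := (measure_toMeasurable N).trans hN
  have hmeas : MeasurableSet {p : ℝ × EuclideanSpace ℝ (Fin d) | Γ p.1 + p.2 ∉ N'} :=
    ((hΓ.comp continuous_fst).add continuous_snd).measurable
      (measurableSet_toMeasurable volume N).compl
  have h1 : ∀ᵐ τ : ℝ, ∀ᵐ h : EuclideanSpace ℝ (Fin d), Γ τ + h ∉ N' := by
    refine Eventually.of_forall fun τ => ?_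
    rw [ae_iff]
    simp only [not_not]
    exact (measure_preimage_add volume (Γ τ) N').trans hN'
  have h2 := Measure.dense_of_ae ((Measure.ae_ae_comm
    (p := fun (τ : ℝ) (h : EuclideanSpace ℝ (Fin d)) => Γ τ + h ∉ N') hmeas).1 h1)
  refine (mem_closure_iff_frequently.1 (h2 0)).mono fun h hh => ?_
  filter_upwards [hh] with τ hτ hN
  exact hτ (subset_toMeasurable volume N hN)

/-- If `f` is Lipschitz with `∑ ℓ, (Y ℓ f)² ≤ 1` almost everywhere, then `f` varies along a curve
with velocity `∑ ℓ, c ℓ • Y ℓ` by at most the integral of `‖c‖`. The curve itself may lie in the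
exceptional null set; one translates it by a small vector, which changes the
integrand only slightly since the `Y ℓ` are Lipschitz. -/
theorem enorm_sub_le_lintegral_of_ae_fderiv {f : EuclideanSpace ℝ (Fin d) → ℝ}
    {Y : Fin m → EuclideanSpace ℝ (Fin d) → EuclideanSpace ℝ (Fin d)}
    {u₀ : EuclideanSpace ℝ (Fin d)} {r : ℝ} (hr : 0 < r) {K L : NNReal}
    (hf : LipschitzOnWith K f (Metric.ball u₀ (2 * r)))
    (hY : ∀ ℓ, LipschitzOnWith L (Y ℓ) (Metric.ball u₀ (2 * r)))
    (hD : ∀ᵐ u, u ∈ Metric.ball u₀ (2 * r) →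
      DifferentiableAt ℝ f u ∧ ∑ ℓ, fderiv ℝ f u (Y ℓ u) ^ 2 ≤ 1)
    {Γ : ℝ → EuclideanSpace ℝ (Fin d)} {c : ℝ → EuclideanSpace ℝ (Fin m)} {s t : ℝ} (hst : s ≤ t)
    (hΓ : AbsolutelyContinuousOnInterval Γ s t) (hΓr : ∀ τ ∈ Icc s t, Γ τ ∈ Metric.ball u₀ r)
    (hc : ∀ᵐ τ : ℝ, τ ∈ Icc s t → HasDerivAt Γ (∑ ℓ, c τ ℓ • Y ℓ (Γ τ)) τ) :
    ‖f (Γ t) - f (Γ s)‖ₑ ≤ ∫⁻ τ in Icc s t, ‖c τ‖ₑ := by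
  set I := ∫⁻ τ in Icc s t, ‖c τ‖ₑ with hI
  rcases eq_or_ne I ⊤ with hI' | hI'
  · rw [hI']; exact le_top
  have hadd : ∀ h : EuclideanSpace ℝ (Fin d), ‖h‖ < r → ∀ τ ∈ Icc s t,
      Γ τ + h ∈ Metric.ball u₀ (2 * r) := fun h hh τ hτ => by
    have h1 := hΓr τ hτ
    rw [mem_ball_iff_norm] at h1 ⊢
    have h2 : Γ τ + h - u₀ = (Γ τ - u₀) + h := by abel
    rw [h2]
    linarith [norm_add_le (Γ τ - u₀) h]
  have hcont : Continuous (IccExtend hst ((Icc s t).domRestrict Γ)) := by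
    have := hΓ.continuousOn
    rw [uIcc_of_le hst] at this
    exact this.domRestrict.Icc_extend'
  have hfreq := frequently_ae_add_notMem hcont (ae_iff.1 hD)
  have hbound : ∃ᶠ h in 𝓝 (0 : EuclideanSpace ℝ (Fin d)),
      ‖f (Γ t + h) - f (Γ s + h)‖ₑ ≤ ENNReal.ofReal (1 + K * (m * (L * ‖h‖))) * I := by
    refine (hfreq.and_eventually (Metric.ball_mem_nhds 0 hr)).mono ?_
    rintro h ⟨hN, hh⟩
    rw [dist_zero_right] at hh
    have hg : AbsolutelyContinuousOnInterval (fun τ => f (Γ τ + h)) s t := by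
      refine absolutelyContinuousOnInterval_comp_lipschitz hf (Γ := fun τ => Γ τ + h) ?_ ?_
      · exact hΓ.add (LipschitzWith.const h).lipschitzOnWith.absolutelyContinuousOnInterval
      · rw [uIcc_of_le hst]
        exact hadd h hh
    have hae : ∀ᵐ τ : ℝ, τ ∈ Ioc s t → ‖deriv (fun τ => f (Γ τ + h)) τ‖ₑ ≤
        ENNReal.ofReal (1 + K * (m * (L * ‖h‖))) * ‖c τ‖ₑ := by
      filter_upwards [hN, hc] with τ hτN hτc hτ
      have hτ' : τ ∈ Icc s t := ⟨hτ.1.le, hτ.2⟩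
      have hmem := hadd h hh τ hτ'
      have hmem0 : Γ τ ∈ Metric.ball u₀ (2 * r) := by
        simpa using hadd 0 (by simpa using hr) τ hτ'
      rw [IccExtend_of_mem hst _ hτ'] at hτN
      simp only [not_not] at hτN
      obtain ⟨hdiff, hsum⟩ := hτN hmem
      simp only [domRestrict_apply] at hdiff hsum
      have hder : HasDerivAt (fun τ => f (Γ τ + h))
          (fderiv ℝ f (Γ τ + h) (∑ ℓ, c τ ℓ • Y ℓ (Γ τ))) τ :=
        HasFDerivAt.comp_hasDerivAt (l := f) (f := fun τ => Γ τ + h) τ hdiff.hasFDerivAt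
          ((hτc hτ').add_const h)
      set D := fderiv ℝ f (Γ τ + h) with hDdef
      have hDK : ‖D‖ ≤ K :=
        norm_fderiv_le_of_lipschitzOn ℝ (Metric.isOpen_ball.mem_nhds hmem) hf
      have h1 : ‖D (∑ ℓ, c τ ℓ • Y ℓ (Γ τ + h))‖ ≤ ‖c τ‖ := by
        have h2 : D (∑ ℓ, c τ ℓ • Y ℓ (Γ τ + h)) = ∑ ℓ, c τ ℓ * D (Y ℓ (Γ τ + h)) := by
          simp [map_sum]
        have h3 := Finset.sum_mul_sq_le_sq_mul_sq Finset.univ (fun ℓ => c τ ℓ)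
          (fun ℓ => D (Y ℓ (Γ τ + h)))
        have h4 : ∑ ℓ, c τ ℓ ^ 2 = ‖c τ‖ ^ 2 := by
          rw [EuclideanSpace.norm_sq_eq]
          simp
        rw [h4] at h3
        rw [h2, Real.norm_eq_abs]
        refine abs_le_of_sq_le_sq (h3.trans ?_) (norm_nonneg _)
        exact mul_le_of_le_one_right (sq_nonneg _) hsum
      have h2 : ‖D (∑ ℓ, c τ ℓ • (Y ℓ (Γ τ) - Y ℓ (Γ τ + h)))‖ ≤
          K * (‖c τ‖ * (m * (L * ‖h‖))) := by
        refine (D.le_opNorm _).trans (mul_le_mul hDK ?_ (norm_nonneg _) K.coe_nonneg)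
        refine (norm_sum_smul_le (K := fun _ => L * ‖h‖) (c τ) _ fun ℓ => ?_).trans_eq (by simp)
        refine ((hY ℓ).norm_sub_le hmem0 hmem).trans_eq ?_
        rw [sub_add_cancel_left, norm_neg]
      have h3 : ‖D (∑ ℓ, c τ ℓ • Y ℓ (Γ τ))‖ ≤ (1 + K * (m * (L * ‖h‖))) * ‖c τ‖ := by
        have h4 : D (∑ ℓ, c τ ℓ • Y ℓ (Γ τ)) = D (∑ ℓ, c τ ℓ • Y ℓ (Γ τ + h)) +
            D (∑ ℓ, c τ ℓ • (Y ℓ (Γ τ) - Y ℓ (Γ τ + h))) := by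
          rw [← map_add, ← Finset.sum_add_distrib]
          simp only [← smul_add, add_sub_cancel]
        rw [h4]
        refine (norm_add_le _ _).trans ((add_le_add h1 h2).trans_eq (by ring))
      rw [hder.deriv, ← ofReal_norm, ← ofReal_norm,
        ← ENNReal.ofReal_mul (by positivity)]
      exact ENNReal.ofReal_le_ofReal h3
    have hftc := hg.integral_deriv_eq_sub
    rw [← hftc, intervalIntegral.integral_of_le hst]
    calc ‖∫ τ in Ioc s t, deriv (fun τ => f (Γ τ + h)) τ‖ₑ
        ≤ ∫⁻ τ in Ioc s t, ‖deriv (fun τ => f (Γ τ + h)) τ‖ₑ := enorm_integral_le_lintegral_enorm _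
      _ ≤ ∫⁻ τ in Ioc s t, ENNReal.ofReal (1 + K * (m * (L * ‖h‖))) * ‖c τ‖ₑ :=
          lintegral_mono_ae ((ae_restrict_iff' measurableSet_Ioc).2 hae)
      _ = ENNReal.ofReal (1 + K * (m * (L * ‖h‖))) * ∫⁻ τ in Ioc s t, ‖c τ‖ₑ :=
          lintegral_const_mul' _ _ ENNReal.ofReal_ne_top
      _ ≤ _ := by
          gcongr
          exact lintegral_mono_set Ioc_subset_Icc_self
  have hlim : ∀ τ ∈ Icc s t, Tendsto (fun h => f (Γ τ + h)) (𝓝 0) (𝓝 (f (Γ τ))) := by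
    intro τ hτ
    have h0 : Γ τ ∈ Metric.ball u₀ (2 * r) := by simpa using hadd 0 (by simpa using hr) τ hτ
    have h1 : ContinuousAt f (Γ τ) := hf.continuousOn.continuousAt (Metric.isOpen_ball.mem_nhds h0)
    refine h1.tendsto.comp ?_
    have : Tendsto (fun h : EuclideanSpace ℝ (Fin d) => Γ τ + h) (𝓝 0) (𝓝 (Γ τ + 0)) :=
      (continuous_const.add continuous_id).tendsto 0
    rwa [add_zero] at this
  have hL : Tendsto (fun h => ‖f (Γ t + h) - f (Γ s + h)‖ₑ) (𝓝 0) (𝓝 ‖f (Γ t) - f (Γ s)‖ₑ) :=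
    ((hlim t (right_mem_Icc.2 hst)).sub (hlim s (left_mem_Icc.2 hst))).enorm
  have hR : Tendsto (fun h : EuclideanSpace ℝ (Fin d) =>
      ENNReal.ofReal (1 + K * (m * (L * ‖h‖))) * I) (𝓝 0) (𝓝 I) := by
    have h1 : Tendsto (fun h : EuclideanSpace ℝ (Fin d) => 1 + (K : ℝ) * (m * (L * ‖h‖))) (𝓝 0)
        (𝓝 1) := by
      have : Continuous fun h : EuclideanSpace ℝ (Fin d) => 1 + (K : ℝ) * (m * (L * ‖h‖)) := by
        fun_prop
      simpa using this.tendsto 0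
    have h2 := ENNReal.Tendsto.mul_const (ENNReal.tendsto_ofReal h1) (b := I) (Or.inr hI')
    simpa using h2
  exact le_of_tendsto_of_tendsto_of_frequently hL hR hbound

end CurvesInEuclideanSpace

/-! ### The class `𝓕` and the sub-Riemannian distance -/

section LowerBound

variable {d m : ℕ} {M : Type*} [TopologicalSpace M] [ChartedSpace (EuclideanSpace ℝ (Fin d)) M]

/-- The vector `(ξ (X ℓ z))_ℓ` of coefficients of `sharp X z ξ` with respect to the `X ℓ`. -/
def control (X : Fin m → (x : M) → TangentSpace (𝓡 d) x) (z : M)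
    (ξ : TangentSpace (𝓡 d) z →L[ℝ] ℝ) : EuclideanSpace ℝ (Fin m) :=
  WithLp.toLp 2 fun ℓ => ξ (X ℓ z)

variable {X : Fin m → (x : M) → TangentSpace (𝓡 d) x}

theorem ofReal_cometric (z : M) (ξ : TangentSpace (𝓡 d) z →L[ℝ] ℝ) :
    ENNReal.ofReal (cometric X z ξ ξ) = ‖control X z ξ‖ₑ ^ 2 := by
  have : cometric X z ξ ξ = ‖control X z ξ‖ ^ 2 := by
    rw [EuclideanSpace.norm_sq_eq]
    refine Finset.sum_congr rfl fun ℓ _ => ?_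
    rw [Real.norm_eq_abs, sq_abs, sq]
    rfl
  rw [this, ENNReal.ofReal_pow (norm_nonneg _), ofReal_norm]

theorem chartDeriv_sharp {e : OpenPartialHomeomorph M (EuclideanSpace ℝ (Fin d))} {z : M}
    (hz : z ∈ e.source) (ξ : TangentSpace (𝓡 d) z →L[ℝ] ℝ) :
    chartDeriv e z (sharp X z ξ) = ∑ ℓ, control X z ξ ℓ • coordField e (X ℓ) (e z) := by
  simp only [coordField_apply hz]
  have : sharp X z ξ = ∑ ℓ, control X z ξ ℓ • X ℓ z := rfl
  rw [this, map_sum]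
  simp only [map_smul]

variable [IsManifold (𝓡 d) ∞ M]

theorem exists_lipschitzOnWith_coordField
    (hX : ∀ ℓ : Fin m,
      ContMDiff (𝓡 d) (𝓡 d).tangent ∞ (fun x : M => (⟨x, X ℓ x⟩ : TangentBundle (𝓡 d) M)))
    {e : OpenPartialHomeomorph M (EuclideanSpace ℝ (Fin d))}
    (he : e ∈ atlas (EuclideanSpace ℝ (Fin d)) M) {u : EuclideanSpace ℝ (Fin d)}
    (hu : u ∈ e.target) :
    ∃ L : NNReal, ∃ B ∈ 𝓝 u, ∀ ℓ, LipschitzOnWith L (coordField e (X ℓ)) B := by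
  have h : ∀ ℓ, ∃ L : NNReal, ∃ B ∈ 𝓝 u, LipschitzOnWith L (coordField e (X ℓ)) B := fun ℓ =>
    (((contDiffOn_coordField he (hX ℓ)).contDiffAt (e.open_target.mem_nhds hu)).of_le
      (m := 1) (by simp)).exists_lipschitzOnWith
  choose L B hB hL using h
  refine ⟨∑ ℓ, L ℓ, ⋂ ℓ, B ℓ, Filter.iInter_mem.2 hB, fun ℓ => ?_⟩
  exact ((hL ℓ).mono (iInter_subset B ℓ)).weaken
    (Finset.single_le_sum (f := L) (fun _ _ => zero_le) (Finset.mem_univ ℓ))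

/-- Every point has a neighbourhood in which a function in the class `𝓕` varies along driven paths
by at most the integral of the norm of the control. -/
theorem exists_open_enorm_sub_le_lintegral
    (hX : ∀ ℓ : Fin m,
      ContMDiff (𝓡 d) (𝓡 d).tangent ∞ (fun x : M => (⟨x, X ℓ x⟩ : TangentBundle (𝓡 d) M)))
    {w : M → ℝ} (hw : w ∈ subunitFunctions X) (z : M) :
    ∃ O : Set M, IsOpen O ∧ z ∈ O ∧ ∀ (x y : M) (γ : Path x y)
      (ξ : (t : ℝ) → TangentSpace (𝓡 d) (γ.extend t) →L[ℝ] ℝ), IsAbsolutelyContinuous d γ →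
      IsDriving X γ ξ → ∀ s t : ℝ, 0 ≤ s → s ≤ t → t ≤ 1 → (∀ τ ∈ Icc s t, γ.extend τ ∈ O) →
      ‖w (γ.extend t) - w (γ.extend s)‖ₑ ≤
        ∫⁻ τ in Ioc s t, ‖control X (γ.extend τ) (ξ τ)‖ₑ := by
  set e := chartAt (EuclideanSpace ℝ (Fin d)) z
  have he : e ∈ atlas (EuclideanSpace ℝ (Fin d)) M := chart_mem_atlas _ z
  have hz : z ∈ e.source := mem_chart_source _ z
  have hu : e z ∈ e.target := e.map_source hz
  obtain ⟨K, B, hB, hK⟩ := hw.1 e he hu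
  rw [e.open_target.nhdsWithin_eq hu] at hB
  obtain ⟨L, B', hB', hL⟩ := exists_lipschitzOnWith_coordField hX he hu
  obtain ⟨R, hR, hRsub⟩ := Metric.mem_nhds_iff.1
    (inter_mem (inter_mem hB hB') (e.open_target.mem_nhds hu))
  set r := R / 2 with hr
  have hr0 : 0 < r := half_pos hR
  have h2r : 2 * r = R := by rw [hr]; ring
  refine ⟨e.source ∩ e ⁻¹' Metric.ball (e z) r, e.isOpen_inter_preimage Metric.isOpen_ball,
    ⟨hz, Metric.mem_ball_self hr0⟩, ?_⟩
  intro x y γ ξ hγ hξ s t hs hst ht hO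
  have hmain := enorm_sub_le_lintegral_of_ae_fderiv (f := fun u => w (e.symm u))
    (Y := fun ℓ => coordField e (X ℓ)) (u₀ := e z) (K := K) (L := L) hr0
    (hK.mono (by rw [h2r]; exact fun v hv => (hRsub hv).1.1))
    (fun ℓ => (hL ℓ).mono (by rw [h2r]; exact fun v hv => (hRsub hv).1.2))
    ?_ (Γ := fun τ => e (γ.extend τ)) (c := fun τ => control X (γ.extend τ) (ξ τ)) hst
    (hγ e he s t hs hst ht fun τ hτ => (hO τ hτ).1) (fun τ hτ => (hO τ hτ).2) ?_
  · simp only [e.left_inv (hO t (right_mem_Icc.2 hst)).1,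
      e.left_inv (hO s (left_mem_Icc.2 hst)).1] at hmain
    rwa [setLIntegral_congr Ioc_ae_eq_Icc]
  · have h1 := hw.2 e he
    rw [ae_restrict_iff' e.open_target.measurableSet] at h1
    filter_upwards [h1, ae_differentiableAt_of_isLocallyLipschitz hw.1 he] with u hu1 hu2 hu3
    rw [h2r] at hu3
    have hut := (hRsub hu3).2
    refine ⟨hu2 hut, le_trans (le_of_eq ?_) (hu1 hut)⟩
    refine Finset.sum_congr rfl fun ℓ _ => ?_
    have := mvfderiv_eq_fderiv_chart he hut (hu2 hut) (X ℓ)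
    rw [sq]
    exact (congrArg₂ (· * ·) this this).symm
  · have h1 := hξ.velocity
    rw [ae_restrict_iff' measurableSet_Icc] at h1
    filter_upwards [h1] with τ hτ hτ'
    have h2 := HasVelocity.hasDerivAt_chart he (hτ (Icc_subset_Icc hs ht hτ')) (hO τ hτ').1
    rwa [chartDeriv_sharp (hO τ hτ').1] at h2

/-- Functions in the class `𝓕` vary along a path by at most its length. -/
theorem enorm_sub_le_lintegral_control
    (hX : ∀ ℓ : Fin m,
      ContMDiff (𝓡 d) (𝓡 d).tangent ∞ (fun x : M => (⟨x, X ℓ x⟩ : TangentBundle (𝓡 d) M)))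
    {w : M → ℝ} (hw : w ∈ subunitFunctions X) {x y : M} {γ : Path x y}
    {ξ : (t : ℝ) → TangentSpace (𝓡 d) (γ.extend t) →L[ℝ] ℝ} (hγ : IsAbsolutelyContinuous d γ)
    (hξ : IsDriving X γ ξ) :
    ‖w y - w x‖ₑ ≤ ∫⁻ τ in Ioc (0 : ℝ) 1, ‖control X (γ.extend τ) (ξ τ)‖ₑ := by
  choose O hOo hzO hO using exists_open_enorm_sub_le_lintegral hX hw
  obtain ⟨t, ht0, htm, ⟨n, hn⟩, hcov⟩ := exists_monotone_Icc_subset_open_cover_unitInterval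
    (c := fun z => γ ⁻¹' O z) (fun z => (hOo z).preimage γ.continuous)
    (fun τ _ => mem_iUnion.2 ⟨γ τ, hzO (γ τ)⟩)
  have key : ∀ k, ‖w (γ.extend (t k)) - w x‖ₑ ≤
      ∫⁻ τ in Ioc (0 : ℝ) (t k), ‖control X (γ.extend τ) (ξ τ)‖ₑ := by
    intro k
    induction k with
    | zero => simp [ht0]
    | succ k ih =>
      obtain ⟨z, hz⟩ := hcov k
      have hle : (t k : ℝ) ≤ t (k + 1) := htm (Nat.le_succ k)
      have hstep := hO z x y γ ξ hγ hξ (t k) (t (k + 1)) (t k).2.1 hle (t (k + 1)).2.2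
        (fun τ hτ => by
          have hτ01 : τ ∈ Icc (0 : ℝ) 1 :=
            ⟨(t k).2.1.trans hτ.1, hτ.2.trans (t (k + 1)).2.2⟩
          rw [Path.extend_apply _ hτ01]
          exact hz (show (⟨τ, hτ01⟩ : unitInterval) ∈ Icc (t k) (t (k + 1)) from hτ))
      rw [← Ioc_union_Ioc_eq_Ioc (t k).2.1 hle,
        lintegral_union measurableSet_Ioc (Ioc_disjoint_Ioc_of_le le_rfl)]
      have hsplit : w (γ.extend (t (k + 1))) - w x =
          (w (γ.extend (t k)) - w x) + (w (γ.extend (t (k + 1))) - w (γ.extend (t k))) := by ring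
      rw [hsplit]
      exact (enorm_add_le _ _).trans (add_le_add ih hstep)
  have h1 := key n
  rw [hn n le_rfl] at h1
  simpa using h1

/-- The Cauchy–Schwarz inequality on a probability space, for a function which need not be
measurable: its lower integral is attained by a measurable minorant. -/
theorem lintegral_le_rpow_half_lintegral_sq {α : Type*} [MeasurableSpace α] (μ : Measure α)
    [IsProbabilityMeasure μ] (φ : α → ℝ≥0∞) :
    ∫⁻ a, φ a ∂μ ≤ (∫⁻ a, φ a ^ 2 ∂μ) ^ (1 / 2 : ℝ) := by
  obtain ⟨g, hg, hgφ, hint⟩ := exists_measurable_le_lintegral_eq μ φ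
  have h := ENNReal.lintegral_mul_le_Lp_mul_Lq μ Real.HolderConjugate.two_two
    hg.aemeasurable (aemeasurable_const (b := (1 : ℝ≥0∞)))
  simp only [Pi.mul_apply, mul_one, one_pow, ENNReal.one_rpow, lintegral_const, measure_univ,
    ENNReal.rpow_ofNat] at h
  rw [hint]
  refine h.trans (ENNReal.rpow_le_rpow (lintegral_mono fun a => ?_) (by norm_num))
  exact pow_le_pow_left' (hgφ a) 2

/-- Functions in the class `𝓕` are `1`-Lipschitz for the sub-Riemannian distance. -/
theorem enorm_sub_le_subDist
    (hX : ∀ ℓ : Fin m,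
      ContMDiff (𝓡 d) (𝓡 d).tangent ∞ (fun x : M => (⟨x, X ℓ x⟩ : TangentBundle (𝓡 d) M)))
    {w : M → ℝ} (hw : w ∈ subunitFunctions X) (x y : M) :
    ‖w y - w x‖ₑ ≤ subDist X x y := by
  refine le_iInf fun γ => ?_
  rw [← ENNReal.rpow_le_rpow_iff (z := 2) (by norm_num), ← ENNReal.rpow_mul]
  norm_num
  refine le_iInf fun hγ => le_iInf fun ξ => le_iInf fun hξ => ?_
  have : IsProbabilityMeasure (volume.restrict (Icc (0 : ℝ) 1)) := ⟨by simp⟩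
  have h1 := enorm_sub_le_lintegral_control hX hw hγ hξ
  rw [setLIntegral_congr Ioc_ae_eq_Icc] at h1
  have h2 := h1.trans (lintegral_le_rpow_half_lintegral_sq _ _)
  simp only [ofReal_cometric]
  have h3 := pow_le_pow_left' h2 2
  refine h3.trans_eq ?_
  rw [← ENNReal.rpow_natCast, ← ENNReal.rpow_mul]
  norm_num

end LowerBound

/-! ### Duality -/

section DistanceThrough

variable {d m : ℕ} {M : Type*} [TopologicalSpace M] [ChartedSpace (EuclideanSpace ℝ (Fin d)) M]
  {X : Fin m → (x : M) → TangentSpace (𝓡 d) x}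

theorem bddBelow_range_add_ccDist {A : Set M} {f : A → ℝ} (hf : ∀ a, 0 ≤ f a) (z : M) :
    BddBelow (range fun a : A => f a + ccDist X a z) :=
  ⟨0, by rintro _ ⟨a, rfl⟩; exact add_nonneg (hf a) (ccDist_nonneg _ _)⟩

variable [IsManifold (𝓡 d) ∞ M]

theorem const_mem_subunitFunctions (a : ℝ) : (fun _ : M => a) ∈ subunitFunctions X :=
  mem_subunitFunctions (isLipschitzNear_const a) (diniBound_const zero_le_one a)

theorem ciInf_add_ccDist_sub_le [ConnectedSpace M] (hX : IsSubRiemannianStructure X) {A : Set M}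
    (hA : A.Nonempty) {f : A → ℝ} (hf : ∀ a, 0 ≤ f a) (x y : M) :
    (⨅ a : A, (f a + ccDist X a y)) - (⨅ a : A, (f a + ccDist X a x)) ≤ ccDist X x y := by
  have := hA.to_subtype
  rw [sub_le_iff_le_add', ← sub_le_iff_le_add]
  refine le_ciInf fun a => ?_
  have := ciInf_le (bddBelow_range_add_ccDist (X := X) hf y) a
  linarith [ccDist_triangle hX a x y]

variable [T2Space M] [SecondCountableTopology M]

/-- A function which is `1`-Lipschitz for the Carnot–Carathéodory distance is, up to a factor
close to `1`, close to a function in the class `𝓕`. -/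
theorem exists_approximation (hX : IsSubRiemannianStructure X) {w : M → ℝ}
    (hw : ∀ x y, w y - w x ≤ ccDist X x y) {δ : ℝ} (hδ : 0 < δ) :
    ∃ v : M → ℝ, (∀ z, |v z - (1 + δ)⁻¹ * w z| ≤ δ) ∧ (∀ z, IsLipschitzNear d v z) ∧
      ∀ z, DiniBound X 1 v z := by
  obtain ⟨v, hv, hL, hD⟩ := exists_regularization hX hw hδ
  have h1 : 0 < (1 + δ)⁻¹ := by positivity
  have h2 : (1 + δ)⁻¹ ≤ 1 := inv_le_one_of_one_le₀ (by linarith)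
  refine ⟨fun z => (1 + δ)⁻¹ * v z, fun z => ?_, fun z => (hL z).const_mul _, fun z => ?_⟩
  · rw [← mul_sub, abs_mul, abs_of_pos h1]
    exact (mul_le_of_le_one_left (abs_nonneg _) h2).trans (hv z)
  · have := (hD z).const_mul h1
    rwa [inv_mul_cancel₀ (by positivity)] at this

variable [ConnectedSpace M]

/-- The lower bound for the supremum defining `d(x,A,y)`: use `w⁻ = d(x,·)` and `w⁺ = d(x,A,·)`,
which agree on `A`. As their approximations `v⁻` and `v⁺` agree on `A` only up to an error, `v⁺`
is replaced by the maximum of `v⁻` and a slight decrease of `v⁺`. -/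
theorem exists_pair_subunitFunctions (hX : IsSubRiemannianStructure X) (x y : M) {A : Set M}
    (hA : A.Nonempty) {δ : ℝ} (hδ : 0 < δ) :
    ∃ wm ∈ subunitFunctions X, ∃ wp ∈ subunitFunctions X, (∀ z ∈ A, wp z = wm z) ∧
      (1 + δ)⁻¹ * (⨅ a : A, (ccDist X x a + ccDist X a y)) - 4 * δ ≤ wp y - wm x := by
  have hf : ∀ a : A, 0 ≤ ccDist X x a := fun a => ccDist_nonneg _ _
  obtain ⟨v, hv, hvL, hvD⟩ := exists_approximation hX (w := ccDist X x)
    (fun z z' => by linarith [ccDist_triangle hX x z z']) hδ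
  obtain ⟨v', hv', hvL', hvD'⟩ := exists_approximation hX
    (ciInf_add_ccDist_sub_le hX hA hf) hδ
  refine ⟨v, mem_subunitFunctions hvL hvD, fun z => max (v' z - 2 * δ) (v z),
    mem_subunitFunctions (fun z => ((hvL' z).sub_const _).max (hvL z))
      fun z => ((hvD' z).sub_const _).max (hvD z), fun z hz => max_eq_right ?_, ?_⟩
  · have h1 := abs_le.1 (hv z)
    have h2 := abs_le.1 (hv' z)
    have h3 : (⨅ a : A, (ccDist X x a + ccDist X a z)) ≤ ccDist X x z := by
      have := ciInf_le (bddBelow_range_add_ccDist (X := X) hf z) ⟨z, hz⟩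
      simpa [ccDist_self] using this
    have h4 := mul_le_mul_of_nonneg_left h3 (by positivity : 0 ≤ (1 + δ)⁻¹)
    linarith [h1.1, h2.2]
  · have h1 := abs_le.1 (hv x)
    have h2 := abs_le.1 (hv' y)
    rw [ccDist_self, mul_zero] at h1
    have := le_max_left (v' y - 2 * δ) (v y)
    linarith [h1.2, h2.1]

theorem exists_subunitFunctions_eq_zero (hX : IsSubRiemannianStructure X) (x : M) {A : Set M}
    (hA : A.Nonempty) {δ : ℝ} (hδ : 0 < δ) :
    ∃ w ∈ subunitFunctions X, (∀ z ∈ A, w z = 0) ∧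
      (1 + δ)⁻¹ * (⨅ a : A, (0 + ccDist X a x)) - 4 * δ ≤ w x := by
  have hf : ∀ a : A, (0 : ℝ) ≤ (fun _ => 0) a := fun a => le_rfl
  obtain ⟨v, hv, hvL, hvD⟩ := exists_approximation hX (ciInf_add_ccDist_sub_le hX hA hf) hδ
  refine ⟨fun z => max (v z - δ) 0,
    mem_subunitFunctions (fun z => ((hvL z).sub_const _).max (isLipschitzNear_const 0 z))
      fun z => ((hvD z).sub_const _).max (diniBound_const zero_le_one 0 z),
    fun z hz => max_eq_right ?_, ?_⟩
  · have h1 := abs_le.1 (hv z)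
    have h3 : (⨅ a : A, (0 + ccDist X a z)) ≤ 0 := by
      have := ciInf_le (bddBelow_range_add_ccDist (X := X) hf z) ⟨z, hz⟩
      simpa [ccDist_self] using this
    have h4 := mul_nonpos_of_nonneg_of_nonpos (by positivity : 0 ≤ (1 + δ)⁻¹) h3
    linarith [h1.2]
  · have h1 := abs_le.1 (hv x)
    have := le_max_left (v x - δ) 0
    linarith [h1.1]

theorem ereal_coe_le_of_forall_scaled {D : ℝ} {S : EReal}
    (h : ∀ δ > 0, (((1 + δ)⁻¹ * D - 4 * δ : ℝ) : EReal) ≤ S) : (D : EReal) ≤ S := by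
  have h1 : Tendsto (fun δ : ℝ => (1 + δ)⁻¹ * D - 4 * δ) (𝓝[>] 0) (𝓝 D) := by
    have : ContinuousAt (fun δ : ℝ => (1 + δ)⁻¹ * D - 4 * δ) 0 := by
      fun_prop (disch := norm_num)
    simpa using this.tendsto.mono_left nhdsWithin_le_nhds
  refine le_of_tendsto ((continuous_coe_real_ereal.tendsto D).comp h1) ?_
  filter_upwards [self_mem_nhdsWithin] with δ hδ using h δ hδ

theorem coe_ennreal_le_coe_ciInf {ι : Type*} [Nonempty ι] {S : ℝ≥0∞} {f : ι → ℝ} (hf : ∀ i, 0 ≤ f i)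
    (h : ∀ i, S ≤ ENNReal.ofReal (f i)) : (S : EReal) ≤ ((⨅ i, f i : ℝ) : EReal) := by
  have h0 : 0 ≤ ⨅ i, f i := le_ciInf hf
  have : S ≤ ENNReal.ofReal (⨅ i, f i) := by
    have hS : S ≠ ⊤ := ne_top_of_le_ne_top ENNReal.ofReal_ne_top (h (Classical.arbitrary ι))
    rw [ENNReal.le_ofReal_iff_toReal_le hS h0]
    exact le_ciInf fun i => ENNReal.toReal_le_of_le_ofReal (hf i) (h i)
  refine (EReal.coe_ennreal_le_coe_ennreal_iff.2 this).trans_eq ?_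
  rw [EReal.coe_ennreal_ofReal, max_eq_left h0]

theorem coe_le_coe_ennreal_of_ofReal_le {r : ℝ} {S : ℝ≥0∞} (h : ENNReal.ofReal r ≤ S) :
    (r : EReal) ≤ S := by
  refine le_trans ?_ (EReal.coe_ennreal_le_coe_ennreal_iff.2 h)
  rw [EReal.coe_ennreal_ofReal]
  exact EReal.coe_le_coe_iff.2 (le_max_left _ _)

theorem sSup_eq_top_of_forall_coe_mem {S : Set EReal} (h : ∀ q : ℝ, (q : EReal) ∈ S) :
    sSup S = ⊤ :=
  EReal.eq_top_iff_forall_lt _ |>.2 fun q =>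
    (EReal.coe_lt_coe_iff.2 (lt_add_one q)).trans_le (le_sSup (h (q + 1)))

theorem distThrough_eq_sSup (hX : IsSubRiemannianStructure X) (x y : M) (A : Set M) :
    (distThrough X x A y : EReal) =
      sSup {r : EReal | ∃ wm ∈ subunitFunctions X, ∃ wp ∈ subunitFunctions X,
        (∀ z ∈ A, wp z = wm z) ∧ r = ((wp y - wm x : ℝ) : EReal)} := by
  refine le_antisymm ?_ (sSup_le ?_)
  · rcases A.eq_empty_or_nonempty with rfl | hA
    · refine le_top.trans_eq (sSup_eq_top_of_forall_coe_mem fun q => ?_).symm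
      exact ⟨_, const_mem_subunitFunctions 0, _, const_mem_subunitFunctions q, by simp, by simp⟩
    · have := hA.to_subtype
      refine (coe_ennreal_le_coe_ciInf (ι := A) (f := fun a => ccDist X x a + ccDist X a y)
        (fun a => add_nonneg (ccDist_nonneg _ _) (ccDist_nonneg _ _)) fun a => ?_).trans ?_
      · rw [ENNReal.ofReal_add (ccDist_nonneg _ _) (ccDist_nonneg _ _)]
        exact (iInf₂_le a.1 a.2).trans (add_le_add (subDist_le_ofReal_ccDist hX _ _)
          (subDist_le_ofReal_ccDist hX _ _))
      · refine ereal_coe_le_of_forall_scaled fun δ hδ => ?_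
        obtain ⟨wm, hm, wp, hp, hA', hle⟩ := exists_pair_subunitFunctions hX x y hA hδ
        exact (EReal.coe_le_coe_iff.2 hle).trans (le_sSup ⟨wm, hm, wp, hp, hA', rfl⟩)
  · rintro r ⟨wm, hm, wp, hp, hA, rfl⟩
    refine coe_le_coe_ennreal_of_ofReal_le (le_iInf₂ fun z hz => ?_)
    have h : wp y - wm x = (wm z - wm x) + (wp y - wp z) := by rw [hA z hz]; ring
    rw [h]
    exact (Real.ofReal_le_enorm _).trans ((enorm_add_le _ _).trans
      (add_le_add (enorm_sub_le_subDist hX.smooth hm x z) (enorm_sub_le_subDist hX.smooth hp z y)))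

theorem distTo_eq_sSup (hX : IsSubRiemannianStructure X) (x : M) (A : Set M) :
    (distTo X x A : EReal) =
      sSup {r : EReal | ∃ w ∈ subunitFunctions X, (∀ z ∈ A, w z = 0) ∧
        r = ((w x : ℝ) : EReal)} := by
  refine le_antisymm ?_ (sSup_le ?_)
  · rcases A.eq_empty_or_nonempty with rfl | hA
    · refine le_top.trans_eq (sSup_eq_top_of_forall_coe_mem fun q => ?_).symm
      exact ⟨_, const_mem_subunitFunctions q, by simp, rfl⟩
    · have := hA.to_subtype
      refine (coe_ennreal_le_coe_ciInf (ι := A) (f := fun a => 0 + ccDist X a x)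
        (fun a => add_nonneg le_rfl (ccDist_nonneg _ _)) fun a => ?_).trans ?_
      · rw [zero_add, ccDist_comm]
        exact (iInf₂_le a.1 a.2).trans (subDist_le_ofReal_ccDist hX _ _)
      · refine ereal_coe_le_of_forall_scaled fun δ hδ => ?_
        obtain ⟨w, hw, hA', hle⟩ := exists_subunitFunctions_eq_zero hX x hA hδ
        exact (EReal.coe_le_coe_iff.2 hle).trans (le_sSup ⟨w, hw, hA', rfl⟩)
  · rintro r ⟨w, hw, hA, rfl⟩
    refine coe_le_coe_ennreal_of_ofReal_le (le_iInf₂ fun z hz => ?_)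
    have h := enorm_sub_le_subDist hX.smooth hw x z
    rw [hA z hz, zero_sub, enorm_neg] at h
    exact (Real.ofReal_le_enorm _).trans h

end DistanceThrough

end SubRiemannian

end

theorem proposition4p1 {d m : ℕ} {M : Type*} [TopologicalSpace M] [T2Space M]
    [SecondCountableTopology M] [ConnectedSpace M]
    [ChartedSpace (EuclideanSpace ℝ (Fin d)) M] [IsManifold (𝓡 d) ∞ M]
    (X : Fin m → (x : M) → TangentSpace (𝓡 d) x)
    (hX : SubRiemannian.IsSubRiemannianStructure X)
    (x y : M) (A : Set M) (hA : IsClosed A) :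
    (SubRiemannian.distThrough X x A y : EReal) =
        sSup {r : EReal | ∃ wm ∈ SubRiemannian.subunitFunctions X,
          ∃ wp ∈ SubRiemannian.subunitFunctions X,
            (∀ z ∈ A, wp z = wm z) ∧ r = ((wp y - wm x : ℝ) : EReal)} ∧
      (SubRiemannian.distTo X x A : EReal) =
        sSup {r : EReal | ∃ w ∈ SubRiemannian.subunitFunctions X,
          (∀ z ∈ A, w z = 0) ∧ r = ((w x : ℝ) : EReal)} :=
  ⟨SubRiemannian.distThrough_eq_sSup hX x y A, SubRiemannian.distTo_eq_sSup hX x A⟩
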